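/- **Conventions.** Let $\mathbb F$ be a field of characteristic two. A *thin* Lie algebra over $\mathbb F$ is a graded Lie algebra $L=\bigoplus_{i\ge 1}L_i$ with $\dim L_1=2$, generated by $L_1$ (so no nonzero component follows a zero one), such that $[uL_1]=L_{i+1}$ for every $i\ge 1$ and every nonzero $u\in L_i$, and such that $L_1$ is not the only component of dimension two. Components of dimension two are called (genuine) *diamonds*; the *second diamond* is the first one, $L_k$ with $k>1$, after $L_1$. $L^j$ denotes the $j$-th term of the lower central series ($L^1=L$), and long brackets are left-normed. A *graded Lie algebra of maximal class* is a graded Lie algebra $M=\bigoplus_{i\ge1}M_i$ with $\dim M_1=2$, $\dim M_i\le 1$ for $i\ge 2$, and $[M_i,M_1]=M_{i+1}$ for $i\ge 1$. The *two-step centralizers* of $L$ are $C_{L_1}(L_i)=\{a\in L_1: [ab]=0 \text{ for all } b\in L_i\}$. A thin Lie algebra $L$ in characteristic two is *of Nottingham type with fake second diamond in degree $m$* if $L/L^{m+1}$ is metabelian and $L/L^{m+2}$ is a graded Lie algebra of maximal class that is not metabelian. For given $x,y\in L_1$, a component $L_h$ with $L_{h+1}\ne 0$ is a *diamond of type* $\mu\in\mathbb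 F$ if $L_{h-1}$ is spanned by a nonzero element $w$ with $[wxx]=0$, $[wyy]=0$ and $(1-\mu)[wxy]=\mu[wyx]$; a *fake diamond of type one* is a diamond of type $\mu=1$ with $\dim L_h=1$. **Theorem.** Let $L$ be a thin Lie algebra over a field $\mathbb F$ of characteristic two, with second (genuine) diamond $L_k$, and of (possibly infinite) dimension larger than $(4k+1)/3$. Suppose that $L/L^k$ is not metabelian, but $L/L^6$ is. Let $\mathbb F y=C_{L_1}(L_2)$ and $\mathbb F x=C_{L_1}(L_{\bar q})$ be the first two distinct two-step centralizers at their first occurrence, that is, $C_{L_1}(L_i)=\mathbb F y$ for $2\le i<\bar q$ and $\mathbb F x\ne\mathbb F y$. Then $\bar q$ is a power of two, $L$ is of Nottingham type with fake second diamond in degree $\bar q$, and: 1. each homogeneous component $L_i$, for $1<i<k-1$, is centralized by $x$ or by $y$; 2. $k=2r\bar q-1$, where $r\ge 1$ is a power of two; 3. with this $r$, the fake diamonds of type one of $L$ (with respect to $x,y$) in degrees $h$ with $1<h<k$ are exactly the fake second diamond $L_{\bar q}$ and those in the degrees $h=m\bar q-1$ for $1<m<2r$. -/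

import Mathlib

namespace ThinLie

section Generalities

variable (F : Type*) (K : Type*) [Field F] [LieRing K] [LieAlgebra F K]

/-- The Lie power `K^j` for `j ≥ 1`: the `j`-th term of the lower central series, counted
so that `K^1 = K` and `K^(j+1) = [K^j, K]` (Mathlib starts the count at `0`). -/
def liePower (j : ℕ) : LieIdeal F K :=
  LieModule.lowerCentralSeries F K K (j - 1)

/-- `K` is metabelian: its second derived algebra `[[K, K], [K, K]]` is zero. -/
def IsMetabelian : Prop :=
  LieAlgebra.derivedSeries F K 2 = ⊥

end Generalities

section Graded

variable {F : Type*} {K : Type*} [Field F] [LieRing K] [LieAlgebra F K]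

/-- `K = ⨁_{i ≥ 1} K_i` is a Lie algebra graded over the positive integers. The family is indexed
by `ℕ` and its member of index `0` is zero. -/
structure IsPositivelyGraded (𝒦 : ℕ → Submodule F K) : Prop where
  zero_eq_bot : 𝒦 0 = ⊥
  isInternal : DirectSum.IsInternal 𝒦
  bracket_mem : ∀ i j : ℕ, ∀ u ∈ 𝒦 i, ∀ v ∈ 𝒦 j, ⁅u, v⁆ ∈ 𝒦 (i + j)

/-- A graded Lie algebra of maximal class: `dim K_1 = 2`, `dim K_i ≤ 1` for `i ≥ 2`, and
`[K_i, K_1] = K_{i+1}` for `i ≥ 1`. -/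
structure IsMaximalClass (𝒦 : ℕ → Submodule F K) : Prop where
  graded : IsPositivelyGraded 𝒦
  finrank_one : Module.finrank F (𝒦 1) = 2
  rank_le_one : ∀ i : ℕ, 2 ≤ i → Module.rank F (𝒦 i) ≤ 1
  span_bracket : ∀ i : ℕ, 1 ≤ i →
    Submodule.span F {z : K | ∃ u ∈ 𝒦 i, ∃ v ∈ 𝒦 1, ⁅u, v⁆ = z} = 𝒦 (i + 1)

/-- A thin Lie algebra: a graded Lie algebra with `dim K_1 = 2` that has the covering property
`[u K_1] = K_{i+1}` for `0 ≠ u ∈ K_i`, and that has a diamond (a component of dimension two)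
besides `K_1`. The field `eq_bot_succ` completes the covering property where `K_i = 0`: it says that
no nonzero component follows a zero one, that is, that `K` is generated by `K_1`. -/
structure IsThin (𝒦 : ℕ → Submodule F K) : Prop where
  graded : IsPositivelyGraded 𝒦
  finrank_one : Module.finrank F (𝒦 1) = 2
  covering : ∀ i : ℕ, 1 ≤ i → ∀ u ∈ 𝒦 i, u ≠ 0 →
    (𝒦 1).map (LieAlgebra.ad F K u : K →ₗ[F] K) = 𝒦 (i + 1)
  eq_bot_succ : ∀ i : ℕ, 1 ≤ i → 𝒦 i = ⊥ → 𝒦 (i + 1) = ⊥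
  exists_diamond : ∃ k : ℕ, 1 < k ∧ Module.finrank F (𝒦 k) = 2

/-- `K_k` is the second (genuine) diamond: the first component of dimension two after `K_1`. -/
def IsSecondDiamond (𝒦 : ℕ → Submodule F K) (k : ℕ) : Prop :=
  1 < k ∧ Module.finrank F (𝒦 k) = 2 ∧
    ∀ i : ℕ, 1 < i → i < k → Module.finrank F (𝒦 i) ≠ 2

/-- The two-step centralizer `C_{K_1}(K_i)`. -/
def twoStepCentralizer (𝒦 : ℕ → Submodule F K) (i : ℕ) : Submodule F K where
  carrier := {a | a ∈ 𝒦 1 ∧ ∀ b ∈ 𝒦 i, ⁅a, b⁆ = 0}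
  add_mem' := fun ha hb =>
    ⟨(𝒦 1).add_mem ha.1 hb.1, fun c hc => by rw [add_lie, ha.2 c hc, hb.2 c hc, add_zero]⟩
  zero_mem' := ⟨(𝒦 1).zero_mem, fun c _ => zero_lie c⟩
  smul_mem' := fun t _ ha =>
    ⟨(𝒦 1).smul_mem t ha.1, fun c hc => by rw [smul_lie, ha.2 c hc, smul_zero]⟩

/-- `F y = C_{K_1}(K_2)` and `F x = C_{K_1}(K_qb)` are (one-dimensional and) the first two distinct
two-step centralizers, where `qb` is the degree in which the second one first occurs. -/
structure IsFirstTwoCentralizers (𝒦 : ℕ → Submodule F K) (qb : ℕ) (x y : K) : Prop where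
  x_ne_zero : x ≠ 0
  y_ne_zero : y ≠ 0
  two_le : 2 ≤ qb
  centralizer_two : twoStepCentralizer 𝒦 2 = Submodule.span F {y}
  centralizer_eq : ∀ i : ℕ, 2 ≤ i → i < qb → twoStepCentralizer 𝒦 i = Submodule.span F {y}
  centralizer_qb : twoStepCentralizer 𝒦 qb = Submodule.span F {x}
  span_ne : Submodule.span F {x} ≠ Submodule.span F {y}

/-- `K_h` is a diamond of finite type `μ` with respect to `x` and `y`: `K_{h-1}` is spanned by a
nonzero `w` with `[wxx] = 0`, `[wyy] = 0` and `(1 - μ)[wxy] = μ[wyx]` (brackets are left-normed), and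
`K_{h+1} ≠ 0`. Its dimension is not prescribed. -/
def IsDiamondOfType (𝒦 : ℕ → Submodule F K) (x y : K) (μ : F) (h : ℕ) : Prop :=
  𝒦 (h + 1) ≠ ⊥ ∧
    ∃ w : K, w ≠ 0 ∧ 𝒦 (h - 1) = Submodule.span F {w} ∧
      ⁅⁅w, x⁆, x⁆ = 0 ∧ ⁅⁅w, y⁆, y⁆ = 0 ∧
      (1 - μ) • ⁅⁅w, x⁆, y⁆ = μ • ⁅⁅w, y⁆, x⁆

/-- `K_h` is a fake diamond of type one: a diamond of type one that is one-dimensional. -/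
def IsFakeDiamondOfTypeOne (𝒦 : ℕ → Submodule F K) (x y : K) (h : ℕ) : Prop :=
  IsDiamondOfType 𝒦 x y (1 : F) h ∧ Module.finrank F (𝒦 h) = 1

/-- The family of the images of the components `K_i` in the quotient by an ideal. -/
def quotientGrading (I : LieIdeal F K) (𝒦 : ℕ → Submodule F K) : ℕ → Submodule F (K ⧸ I) :=
  fun i => (𝒦 i).map (LieSubmodule.Quotient.mk' I : K →ₗ[F] K ⧸ I)

/-- A thin Lie algebra (in characteristic two) is of Nottingham type with fake second diamond in
degree `m` if `K/K^(m+1)` is metabelian and `K/K^(m+2)` is a graded Lie algebra of maximal class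
which is not metabelian. -/
structure IsNottinghamWithFakeSecondDiamond (𝒦 : ℕ → Submodule F K) (m : ℕ) : Prop where
  charTwo : CharP F 2
  thin : IsThin 𝒦
  metabelian : IsMetabelian F (K ⧸ liePower F K (m + 1))
  maximalClass : IsMaximalClass (quotientGrading (liePower F K (m + 2)) 𝒦)
  not_metabelian : ¬ IsMetabelian F (K ⧸ liePower F K (m + 2))

end Graded

end ThinLie

/-!
The maps `ad x` and `ad y` are derivations, and in characteristic two so are the powers
`(ad x) ^ (2 ^ b)`; every relation below comes from expanding a bracket by the resulting Leibniz
rules and reading binomial coefficients modulo two. For instance, if `q` had an odd factor `2 r + 1`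
and `P` were the complementary power of two, then `⁅(ad x) ^ (2 r P) c, c⁆ = 0` for
`c = [y, x, …, x]` of degree `P` would force a nonzero component to vanish; so `q` is a power of
two.

Below the second diamond the components are one-dimensional, and everything is determined by the
degrees in which they are not centralized by `y`. Consecutive ones differ by `q` or by `q - 2 ^ b`;
`x` centralizes these components, except possibly one close to the diamond, and the last of them
turns out to have degree `k - q`. The first two of them are `1` and `q`. To exclude the later short
gaps one climbs from `[y, x, …, x]` of degree `q` through these degrees, carrying along an element
of complementary degree whose bracket with the current one is nonzero just below or at the diamond.
When the component just below the diamond is spanned by `v`, the bound on the dimension gives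
`[v, x, y] = ρ [v, y, x]` with `ρ ≠ 0`, and a short gap forces a value of `ρ` that contradicts this.
Hence `k + 1 = N q`.

Finally, let `W` be the adjoint map of `[y, x, …, x]` of degree `q`. Its powers applied to
`[y, x, …, x]` of degree `q - 1` span the fake diamonds in degrees `m q - 1`, and `W` continues to
move nonzero elements past the second diamond. If `N = Q (2 j + 1)` with `Q` a power of two and
`j > 0`, then a nonzero element beyond the diamond is, up to a scalar, of the form
`[D ^ (2 j) c, c]` with `D = W ^ Q` a derivation, or `[D ^ (2 j - 2) c, c]` if `Q = 1`; the Leibniz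
rule turns it into the bracket of an element with itself, which vanishes. So `N = 2 r` with `r` a
power of two.
-/

namespace ThinLie

section Binomials

variable {R : Type*} [CommRing R] (p : ℕ) [Fact p.Prime] [CharP R p]

theorem cast_choose_pow_mul_add (b n m : ℕ) {r s : ℕ} (hr : r < p ^ b) (hs : s < p ^ b) :
    ((p ^ b * n + r).choose (p ^ b * m + s) : R) = n.choose m * r.choose s := by
  have lucas (i j : ℕ) : (i.choose j : R) = (i % p).choose (j % p) * (i / p).choose (j / p) := by
    exact_mod_cast (CharP.natCast_eq_natCast R p).2
      Choose.choose_modEq_choose_mod_mul_choose_div_nat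
  have hp : 0 < p := (Fact.out : p.Prime).pos
  induction b generalizing r s with
  | zero =>
    obtain ⟨rfl, rfl⟩ : r = 0 ∧ s = 0 := by simpa using And.intro hr hs
    simp
  | succ b ih =>
    have hmod (i j : ℕ) : (p ^ (b + 1) * i + j) % p = j % p := by
      rw [pow_succ', mul_assoc, Nat.mul_add_mod]
    have hdiv (i j : ℕ) : (p ^ (b + 1) * i + j) / p = p ^ b * i + j / p := by
      rw [pow_succ', mul_assoc, Nat.mul_add_div hp]
    rw [lucas, hmod, hmod, hdiv, hdiv, lucas r s,
      ih (Nat.div_lt_of_lt_mul (pow_succ' p b ▸ hr)) (Nat.div_lt_of_lt_mul (pow_succ' p b ▸ hs))]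
    ring

theorem cast_choose_pow_sub_one {e l : ℕ} (hl : l < p ^ e) :
    ((p ^ e - 1).choose l : R) = (-1) ^ l := by
  induction l with
  | zero => simp
  | succ l ih =>
    have pascal : ((p ^ e).choose (l + 1) : R) =
        (p ^ e - 1).choose l + (p ^ e - 1).choose (l + 1) := by
      exact_mod_cast congrArg _ (Nat.choose_eq_choose_pred_add (by omega) l.succ_pos)
    have hdvd : ((p ^ e).choose (l + 1) : R) = 0 :=
      (CharP.cast_eq_zero_iff R p _).2
        ((Fact.out : p.Prime).dvd_choose_pow (by omega) (by omega))
    rw [hdvd, ih (by omega)] at pascal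
    linear_combination -pascal

theorem cast_choose_pow_sub_two {e l : ℕ} (hl : l + 1 < p ^ e) :
    ((p ^ e - 2).choose l : R) = (-1) ^ l * (l + 1) := by
  induction l with
  | zero => simp
  | succ l ih =>
    have pascal : ((p ^ e - 1).choose (l + 1) : R) =
        (p ^ e - 2).choose l + (p ^ e - 2).choose (l + 1) := by
      exact_mod_cast
        congrArg _ (Nat.choose_eq_choose_pred_add (n := p ^ e - 1) (by omega) l.succ_pos)
    rw [cast_choose_pow_sub_one p (by omega), ih (by omega)] at pascal
    push_cast
    linear_combination -pascal

theorem cast_choose_pow_add_pow_mul_sub_one (b o : ℕ) (ho : 0 < o) :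
    ((p ^ b + (p ^ b * o - 1)).choose (p ^ b) : R) = o := by
  have hb : 0 < p ^ b := pow_pos (Fact.out : p.Prime).pos b
  have key := cast_choose_pow_mul_add (R := R) p b o 1 (Nat.sub_lt hb one_pos) hb
  have hle : p ^ b ≤ p ^ b * o := Nat.le_mul_of_pos_right _ ho
  rw [show p ^ b + (p ^ b * o - 1) = p ^ b * o + (p ^ b - 1) by omega]
  simpa using key

theorem cast_choose_pow_sub_pow_add {e b m r s : ℕ} (hb : b ≤ e) (hm : m < p ^ (e - b))
    (hr : r < p ^ b) (hs : s < p ^ b) :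
    ((p ^ e - p ^ b + r).choose (p ^ b * m + s) : R) = (-1) ^ m * r.choose s := by
  have hfactor : p ^ e - p ^ b = p ^ b * (p ^ (e - b) - 1) := by
    rw [Nat.mul_sub, ← pow_add, Nat.add_sub_cancel' hb, mul_one]
  rw [hfactor, cast_choose_pow_mul_add p b _ _ hr hs, cast_choose_pow_sub_one p hm]

end Binomials

section IterateApply

variable {R M : Type*} [Semiring R] [AddCommMonoid M] [Module R M]

theorem pow_apply_pow (f : Module.End R M) (m n : ℕ) (u : M) :
    (f ^ m) ((f ^ n) u) = (f ^ (m + n)) u := by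
  rw [pow_add, Module.End.mul_apply]

theorem apply_pow (f : Module.End R M) (n : ℕ) (u : M) : f ((f ^ n) u) = (f ^ (n + 1)) u := by
  rw [pow_succ', Module.End.mul_apply]

theorem pow_apply_apply (f : Module.End R M) (n : ℕ) (u : M) :
    (f ^ n) (f u) = (f ^ (n + 1)) u := by
  rw [pow_succ, Module.End.mul_apply]

theorem pow_apply_eq_zero_of_le {f : Module.End R M} {m n : ℕ} {u : M} (h : (f ^ m) u = 0)
    (hmn : m ≤ n) : (f ^ n) u = 0 := by
  rw [← Nat.sub_add_cancel hmn, ← pow_apply_pow, h, map_zero]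

theorem pow_apply_eq_zero_of_apply_pow_eq_zero {f : Module.End R M} {u A : M} {i l : ℕ}
    (hu : (f ^ i) u = A) (hA : f A = 0) (hl : i < l) : (f ^ l) u = 0 :=
  pow_apply_eq_zero_of_le (m := i + 1) (by rw [← apply_pow, hu, hA]) hl

end IterateApply

section Derivations

variable {R L : Type*} [CommRing R] [LieRing L] [LieAlgebra R L]

/-- `δ` is a derivation of the Lie algebra `L`. Unlike `LieDerivation`, this is a predicate on
endomorphisms, so that it applies directly to powers of an adjoint map. -/
def IsDerivation (δ : Module.End R L) : Prop := ∀ u w : L, δ ⁅u, w⁆ = ⁅δ u, w⁆ + ⁅u, δ w⁆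

theorem isDerivation_ad (a : L) : IsDerivation (LieAlgebra.ad R L a) := leibniz_lie a

namespace IsDerivation

variable {δ : Module.End R L}

theorem pow_apply_lie (hδ : IsDerivation δ) (n : ℕ) (u w : L) :
    (δ ^ n) ⁅u, w⁆ = ∑ i ∈ Finset.range (n + 1), n.choose i • ⁅(δ ^ i) u, (δ ^ (n - i)) w⁆ := by
  let D : LieDerivation R L L := ⟨δ, fun a b => by rw [hδ, ← lie_skew b, sub_neg_eq_add, add_comm]⟩
  simp only [Module.End.pow_apply]
  exact D.iterate_apply_lie' n u w

theorem lie_pow_apply_of_apply_eq_zero (hδ : IsDerivation δ) {u : L} (hu : δ u = 0) (n : ℕ)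
    (a : L) : ⁅u, (δ ^ n) a⁆ = (δ ^ n) ⁅u, a⁆ := by
  induction n with
  | zero => rfl
  | succ n ih => rw [← apply_pow, ← apply_pow, ← ih, hδ, hu, zero_lie, zero_add]

theorem pow_char_pow (hδ : IsDerivation δ) (p : ℕ) [Fact p.Prime] [CharP R p] (n : ℕ) :
    IsDerivation (δ ^ p ^ n) := fun u w => by
  have hp : 0 < p ^ n := pow_pos (Fact.out : p.Prime).pos n
  have hvanish (i : ℕ) (hi : i ≠ 0) (hi' : i ≠ p ^ n) :
      (p ^ n).choose i • ⁅(δ ^ i) u, (δ ^ (p ^ n - i)) w⁆ = 0 := by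
    rw [← Nat.cast_smul_eq_nsmul R,
      (CharP.cast_eq_zero_iff R p _).2 ((Fact.out : p.Prime).dvd_choose_pow hi hi'), zero_smul]
  rw [hδ.pow_apply_lie, ← Finset.sum_subset (s₁ := {p ^ n, 0}), Finset.sum_pair hp.ne']
  · simp
  · simp [Finset.insert_subset_iff]
  · intro i _ hi
    simp only [Finset.mem_insert, Finset.mem_singleton, not_or] at hi
    exact hvanish i hi.2 hi.1

open TensorProduct in
theorem lie_pow_apply (hδ : IsDerivation δ) (n : ℕ) (u a : L) :
    ⁅u, (δ ^ n) a⁆ = ∑ l ∈ Finset.range (n + 1),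
      ((-1) ^ l * n.choose l : R) • (δ ^ (n - l)) ⁅(δ ^ l) u, a⁆ := by
  -- On `L ⊗ L`, the commuting maps `1 ⊗ δ` and `δ ⊗ 1` have a sum which the bracket intertwines
  -- with `δ`; so expand `1 ⊗ δ` as a difference by the binomial theorem.
  let bracket : L ⊗[R] L →ₗ[R] L := TensorProduct.lift (LieModule.toEnd R L L : L →ₗ[R] _)
  let A : Module.End R (L ⊗[R] L) := δ.rTensor L
  let B : Module.End R (L ⊗[R] L) := δ.lTensor L
  have hAB : Commute A B := by
    simp only [A, B, Commute, SemiconjBy, Module.End.mul_eq_comp, LinearMap.rTensor_comp_lTensor,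
      LinearMap.lTensor_comp_rTensor]
  have hbracket (m : ℕ) (t : L ⊗[R] L) : bracket (((A + B) ^ m) t) = (δ ^ m) (bracket t) := by
    have hone : bracket ∘ₗ (A + B) = δ ∘ₗ bracket :=
      TensorProduct.ext' fun u w => by simp [bracket, A, B, hδ u w]
    induction m generalizing t with
    | zero => rfl
    | succ m ih =>
      rw [← pow_apply_apply, ih, ← pow_apply_apply]
      exact congrArg _ (LinearMap.congr_fun hone t)
  have hcomm : Commute (-A) (A + B) := ((Commute.refl A).add_right hAB).neg_left
  have hpow : B ^ n = ∑ l ∈ Finset.range (n + 1), (-A) ^ l * (A + B) ^ (n - l) * n.choose l := by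
    rw [← hcomm.add_pow, neg_add_cancel_left]
  calc ⁅u, (δ ^ n) a⁆ = bracket ((B ^ n) (u ⊗ₜ a)) := by simp [bracket, B, LinearMap.lTensor_pow]
    _ = _ := by
        rw [hpow, LinearMap.sum_apply, map_sum]
        refine Finset.sum_congr rfl fun l _ => ?_
        rw [(hcomm.pow_pow l (n - l)).eq, ← nsmul_eq_mul', ← Nat.cast_smul_eq_nsmul R,
          LinearMap.smul_apply, map_smul, Module.End.mul_apply, hbracket, ← neg_one_smul R A,
          smul_pow, LinearMap.smul_apply, map_smul, map_smul, smul_smul, mul_comm]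
        simp [bracket, A, LinearMap.rTensor_pow]

end IsDerivation

section CharTwo

variable (R) [CharP R 2]

include R in
theorem add_self_eq_zero_of_charTwo (u : L) : u + u = 0 := by
  rw [← two_smul R, CharTwo.two_eq_zero, zero_smul]

include R in
theorem eq_of_add_eq_zero_of_charTwo {u w : L} (h : u + w = 0) : u = w :=
  add_right_cancel (h.trans (add_self_eq_zero_of_charTwo R w).symm)

include R in
theorem lie_comm_of_charTwo (u w : L) : ⁅u, w⁆ = ⁅w, u⁆ :=
  eq_of_add_eq_zero_of_charTwo R (by rw [← lie_skew u w, neg_add_cancel])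

namespace IsDerivation

variable {R} {δ : Module.End R L} {n m : ℕ} {u a c : L}

theorem lie_pow_eq_sum (hδ : IsDerivation δ) (s : Finset ℕ)
    (hs : ∀ l ≤ n, l ∉ s → ⁅(δ ^ l) u, a⁆ = 0) :
    ⁅u, (δ ^ n) a⁆ = ∑ l ∈ s, (n.choose l : R) • (δ ^ (n - l)) ⁅(δ ^ l) u, a⁆ := by
  rw [hδ.lie_pow_apply, ← Finset.sum_subset (Finset.inter_subset_left (s₂ := s)),
    Finset.sum_subset Finset.inter_subset_right]
  · simp only [CharTwo.neg_eq, one_pow, one_mul]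
  · intro l hl hl'
    rw [Nat.choose_eq_zero_of_lt (by simpa [hl] using hl'), Nat.cast_zero, mul_zero, zero_smul]
  · intro l hl hl'
    rw [hs l (Finset.mem_range_succ_iff.1 hl) (by simpa [hl] using hl'), map_zero, smul_zero]

theorem lie_pow_eq_zero (hδ : IsDerivation δ) (h : ∀ l ≤ n, ⁅(δ ^ l) u, a⁆ = 0) :
    ⁅u, (δ ^ n) a⁆ = 0 := by
  rw [hδ.lie_pow_eq_sum ∅ fun l hl _ => h l hl, Finset.sum_empty]

theorem lie_pow_eq_single (hδ : IsDerivation δ) (m : ℕ)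
    (h : ∀ l ≤ n, l ≠ m → ⁅(δ ^ l) u, a⁆ = 0) :
    ⁅u, (δ ^ n) a⁆ = (n.choose m : R) • (δ ^ (n - m)) ⁅(δ ^ m) u, a⁆ := by
  rw [hδ.lie_pow_eq_sum {m} (by simpa using h), Finset.sum_singleton]

theorem lie_pow_eq_pair (hδ : IsDerivation δ) (m : ℕ)
    (h : ∀ l ≤ n, l ≠ m → l ≠ m + 1 → ⁅(δ ^ l) u, a⁆ = 0) :
    ⁅u, (δ ^ n) a⁆ = (n.choose m : R) • (δ ^ (n - m)) ⁅(δ ^ m) u, a⁆ +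
      (n.choose (m + 1) : R) • (δ ^ (n - (m + 1))) ⁅(δ ^ (m + 1)) u, a⁆ := by
  rw [hδ.lie_pow_eq_sum {m, m + 1} (by simpa using h), Finset.sum_pair (by simp)]

theorem lie_pow_pow_eq (hδ : IsDerivation δ) (h : ∀ i < n, ⁅(δ ^ i) u, a⁆ = 0) {j : ℕ}
    (hj : j ≤ n) : ⁅(δ ^ (n - j)) u, (δ ^ j) a⁆ = ⁅(δ ^ n) u, a⁆ := by
  rw [hδ.lie_pow_eq_single j, Nat.choose_self, Nat.cast_one, one_smul, Nat.sub_self, pow_zero,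
    Module.End.one_apply, pow_apply_pow, Nat.add_sub_cancel' hj]
  intro l hl hlj
  rw [pow_apply_pow, h _ (by omega)]

theorem lie_pow_two_mul_self_eq_zero (hδ : IsDerivation δ)
    (hc : ∀ i < 2 * n, ⁅(δ ^ i) c, c⁆ = 0) : ⁅(δ ^ (2 * n)) c, c⁆ = 0 := by
  rw [← hδ.lie_pow_pow_eq hc (j := n) (by omega), show 2 * n - n = n by omega, lie_self]

end IsDerivation

end CharTwo

end Derivations

section ThinAlgebra

variable {F L : Type*} [Field F] [LieRing L] [LieAlgebra F L] {ℒ : ℕ → Submodule F L}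
  {k q : ℕ} {x y : L}

section Quotients

theorem isMetabelian_quotient_iff (I : LieIdeal F L) :
    IsMetabelian F (L ⧸ I) ↔ ∀ a ∈ liePower F L 2, ∀ b ∈ liePower F L 2, ⁅a, b⁆ ∈ I := by
  let π : L →ₗ⁅F⁆ L ⧸ I :=
    { (LieSubmodule.Quotient.mk' I : L →ₗ[F] L ⧸ I) with map_lie' := rfl }
  have hπ : Function.Surjective π := LieSubmodule.Quotient.surjective_mk' I
  have hker : π.ker = I := by
    ext u
    rw [LieHom.mem_ker]
    exact LieSubmodule.Quotient.mk_eq_zero (N := I)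
  rw [IsMetabelian, ← LieIdeal.derivedSeries_map_eq 2 hπ, LieIdeal.map_eq_bot_iff, hker]
  exact LieSubmodule.lie_le_iff _ _ _

/-- The sum of the components of degree at least `n`. -/
def degreeGE (ℒ : ℕ → Submodule F L) (n : ℕ) : Submodule F L := ⨆ i, ⨆ (_ : n ≤ i), ℒ i

theorem le_degreeGE {n i : ℕ} (h : n ≤ i) : ℒ i ≤ degreeGE ℒ n := le_iSup₂_of_le i h le_rfl

theorem degreeGE_le {n : ℕ} {P : Submodule F L} (h : ∀ i, n ≤ i → ℒ i ≤ P) : degreeGE ℒ n ≤ P :=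
  iSup₂_le h

theorem lie_mem_of_mem_degreeGE {m n : ℕ} {P : Submodule F L}
    (h : ∀ i j, m ≤ i → n ≤ j → ∀ u ∈ ℒ i, ∀ w ∈ ℒ j, ⁅u, w⁆ ∈ P) {u w : L}
    (hu : u ∈ degreeGE ℒ m) (hw : w ∈ degreeGE ℒ n) : ⁅u, w⁆ ∈ P := by
  have hhom (i : ℕ) (hi : m ≤ i) (a : L) (ha : a ∈ ℒ i) : ⁅a, w⁆ ∈ P := by
    have hle : degreeGE ℒ n ≤ P.comap (LieAlgebra.ad F L a : L →ₗ[F] L) :=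
      degreeGE_le fun j hj b hb => h i j hi hj a ha b hb
    exact hle hw
  have hle : degreeGE ℒ m ≤
      P.comap (LinearMap.flip (LieModule.toEnd F L L : L →ₗ[F] Module.End F L) w) :=
    degreeGE_le fun i hi a ha => hhom i hi a ha
  exact hle hu

theorem rank_biSup_le {ι : Type*} (s : Finset ι) (p : ι → Submodule F L) :
    Module.rank F ↥(⨆ i ∈ s, p i) ≤ ∑ i ∈ s, Module.rank F (p i) := by
  classical
  induction s using Finset.induction_on with
  | empty => simp
  | insert i s hi ih =>
    rw [Finset.iSup_insert, Finset.sum_insert hi]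
    exact (Submodule.rank_add_le_rank_add_rank _ _).trans (add_le_add_right ih _)

namespace IsPositivelyGraded

theorem degreeGE_one (G : IsPositivelyGraded ℒ) : degreeGE ℒ 1 = ⊤ := by
  rw [eq_top_iff, ← G.isInternal.submodule_iSup_eq_top]
  refine iSup_le fun i => ?_
  rcases Nat.eq_zero_or_pos i with rfl | h
  · rw [G.zero_eq_bot]
    exact bot_le
  · exact le_degreeGE h

theorem disjoint_degreeGE (G : IsPositivelyGraded ℒ) {i n : ℕ} (h : i < n) :
    Disjoint (ℒ i) (degreeGE ℒ n) :=
  (G.isInternal.submodule_iSupIndep i).mono_right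
    (degreeGE_le fun j hj => le_iSup₂_of_le j (by omega) le_rfl)

theorem toSubmodule_liePower (G : IsPositivelyGraded ℒ)
    (hgen : ∀ i, 1 ≤ i → ∀ t ∈ ℒ (i + 1), ∃ u ∈ ℒ i, ∃ a ∈ ℒ 1, ⁅u, a⁆ = t)
    (n : ℕ) : LieSubmodule.toSubmodule (liePower F L (n + 1)) = degreeGE ℒ (n + 1) := by
  rw [liePower, Nat.add_sub_cancel]
  induction n with
  | zero => rw [LieModule.lowerCentralSeries_zero, LieSubmodule.top_toSubmodule, G.degreeGE_one]
  | succ n ih =>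
    rw [LieModule.lowerCentralSeries_succ]
    apply le_antisymm
    · rw [LieSubmodule.lieIdeal_oper_eq_linear_span', Submodule.span_le]
      rintro _ ⟨a, -, u, hu, rfl⟩
      rw [← LieSubmodule.mem_toSubmodule, ih] at hu
      refine lie_mem_of_mem_degreeGE (m := 1) (fun i j hi hj u hu w hw => ?_)
        (G.degreeGE_one ▸ Submodule.mem_top) hu
      exact le_degreeGE (by omega) (G.bracket_mem i j u hu w hw)
    · refine degreeGE_le fun i hi t ht => ?_
      obtain ⟨j, rfl⟩ : ∃ j, i = j + 1 := ⟨i - 1, by omega⟩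
      obtain ⟨u, hu, a, -, rfl⟩ := hgen j (by omega) t ht
      rw [LieSubmodule.mem_toSubmodule, ← lie_skew]
      refine neg_mem (LieSubmodule.lie_mem_lie (LieSubmodule.mem_top a) ?_)
      rw [← LieSubmodule.mem_toSubmodule, ih]
      exact le_degreeGE (by omega) hu

section QuotientGrading

variable {I : LieIdeal F L} {n : ℕ}

theorem iSupIndep_quotientGrading (G : IsPositivelyGraded ℒ)
    (hI : LieSubmodule.toSubmodule I = degreeGE ℒ n) : iSupIndep (quotientGrading I ℒ) := by
  have hmk (u : L) : LieSubmodule.Quotient.mk' I u = 0 ↔ u ∈ degreeGE ℒ n := by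
    rw [LieSubmodule.Quotient.mk_eq_zero, ← hI, LieSubmodule.mem_toSubmodule]
  intro i
  rw [Submodule.disjoint_def]
  rintro _ ⟨u, hu, rfl⟩ hz
  simp only [quotientGrading, ← Submodule.map_iSup] at hz
  obtain ⟨w, hw, hwu⟩ := hz
  have hdiff : u - w ∈ degreeGE ℒ n := by
    rw [← hmk, map_sub, sub_eq_zero]
    exact hwu.symm
  rcases Nat.lt_or_ge i n with h | h
  · have hle : degreeGE ℒ n ≤ ⨆ j, ⨆ (_ : j ≠ i), ℒ j :=
      degreeGE_le fun j hj => le_iSup₂_of_le j (by omega) le_rfl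
    have hu' : u ∈ ⨆ j, ⨆ (_ : j ≠ i), ℒ j := by
      simpa using Submodule.add_mem _ (hle hdiff) hw
    rw [Submodule.disjoint_def.1 (G.isInternal.submodule_iSupIndep i) u hu hu', map_zero]
  · exact (hmk u).2 (le_degreeGE h hu)

theorem quotient (G : IsPositivelyGraded ℒ) (hI : LieSubmodule.toSubmodule I = degreeGE ℒ n) :
    IsPositivelyGraded (quotientGrading I ℒ) where
  zero_eq_bot := by rw [quotientGrading, G.zero_eq_bot, Submodule.map_bot]
  isInternal := by
    refine DirectSum.isInternal_submodule_of_iSupIndep_of_iSup_eq_top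
      (G.iSupIndep_quotientGrading hI) ?_
    change ⨆ i, (ℒ i).map (LieSubmodule.Quotient.mk' I : L →ₗ[F] L ⧸ I) = ⊤
    rw [← Submodule.map_iSup, G.isInternal.submodule_iSup_eq_top, Submodule.map_top,
      LinearMap.range_eq_top]
    exact LieSubmodule.Quotient.surjective_mk' I
  bracket_mem := by
    rintro i j _ ⟨u, hu, rfl⟩ _ ⟨w, hw, rfl⟩
    exact ⟨⁅u, w⁆, G.bracket_mem i j u hu w hw, rfl⟩

end QuotientGrading

end IsPositivelyGraded
end Quotients

section Thin

namespace IsThin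

theorem exists_lie_eq (T : IsThin ℒ) {i : ℕ} (hi : 1 ≤ i) {t : L} (ht : t ∈ ℒ (i + 1)) :
    ∃ u ∈ ℒ i, ∃ a ∈ ℒ 1, ⁅u, a⁆ = t := by
  by_cases hbot : ℒ i = ⊥
  · rw [T.eq_bot_succ i hi hbot] at ht
    exact ⟨0, zero_mem _, 0, zero_mem _, by rw [(Submodule.mem_bot F).1 ht, lie_zero]⟩
  · obtain ⟨u, hu, hu0⟩ := (Submodule.ne_bot_iff _).1 hbot
    rw [← T.covering i hi u hu hu0] at ht
    obtain ⟨a, ha, rfl⟩ := ht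
    exact ⟨u, hu, a, ha, rfl⟩

theorem toSubmodule_liePower (T : IsThin ℒ) (n : ℕ) :
    LieSubmodule.toSubmodule (liePower F L (n + 1)) = degreeGE ℒ (n + 1) :=
  T.graded.toSubmodule_liePower (fun _ hi _ ht => T.exists_lie_eq hi ht) n

theorem mk'_liePower_eq_zero_iff (T : IsThin ℒ) {n : ℕ} {u : L} :
    LieSubmodule.Quotient.mk' (liePower F L (n + 1)) u = 0 ↔ u ∈ degreeGE ℒ (n + 1) := by
  rw [LieSubmodule.Quotient.mk_eq_zero, ← T.toSubmodule_liePower, LieSubmodule.mem_toSubmodule]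

theorem eq_bot_of_le (T : IsThin ℒ) {i j : ℕ} (hi : 1 ≤ i) (hij : i ≤ j) (h : ℒ i = ⊥) :
    ℒ j = ⊥ := by
  induction j, hij using Nat.le_induction with
  | base => exact h
  | succ j hij ih => exact T.eq_bot_succ j (hi.trans hij) ih

theorem ne_bot (T : IsThin ℒ) (D : IsSecondDiamond ℒ k) {i : ℕ} (hi : 1 ≤ i) (hik : i ≤ k) :
    ℒ i ≠ ⊥ := by
  intro h
  have hfinrank := D.2.1
  rw [T.eq_bot_of_le hi hik h, finrank_bot] at hfinrank
  omega

theorem finrank_eq_one (T : IsThin ℒ) (D : IsSecondDiamond ℒ k) {i : ℕ} (hi : 2 ≤ i)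
    (hik : i < k) : Module.finrank F (ℒ i) = 1 := by
  obtain ⟨j, rfl⟩ : ∃ j, i = j + 1 := ⟨i - 1, by omega⟩
  obtain ⟨u, hu, hu0⟩ := (Submodule.ne_bot_iff _).1 (T.ne_bot D (i := j) (by omega) (by omega))
  have hcover := T.covering j (by omega) u hu hu0
  have : FiniteDimensional F (ℒ 1) :=
    FiniteDimensional.of_finrank_pos (by rw [T.finrank_one]; norm_num)
  have : FiniteDimensional F (ℒ (j + 1)) := hcover ▸ inferInstance
  have hpos : 0 < Module.finrank F (ℒ (j + 1)) := by
    rw [Module.finrank_pos_iff, Submodule.nontrivial_iff_ne_bot]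
    exact T.ne_bot D (by omega) (by omega)
  have hle : Module.finrank F (ℒ (j + 1)) ≤ 2 := by
    rw [← hcover, ← T.finrank_one]
    exact Submodule.finrank_map_le _ _
  have hne := D.2.2 (j + 1) (by omega) hik
  omega

theorem rank_eq_one (T : IsThin ℒ) (D : IsSecondDiamond ℒ k) {i : ℕ} (hi : 2 ≤ i)
    (hik : i < k) : Module.rank F (ℒ i) = 1 := by
  have h := T.finrank_eq_one D hi hik
  have : FiniteDimensional F (ℒ i) := FiniteDimensional.of_finrank_pos (by omega)
  rw [← Module.finrank_eq_rank, h, Nat.cast_one]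

theorem derivation_eq_zero (T : IsThin ℒ) {δ : Module.End F L} (hδ : IsDerivation δ)
    (h : ∀ u ∈ ℒ 1, δ u = 0) : δ = 0 := by
  have hhom (i : ℕ) (hi : 1 ≤ i) : ∀ u ∈ ℒ i, δ u = 0 := by
    induction i, hi using Nat.le_induction with
    | base => exact h
    | succ i hi ih =>
      intro t ht
      obtain ⟨u, hu, a, ha, rfl⟩ := T.exists_lie_eq hi ht
      rw [hδ, ih u hu, h a ha, zero_lie, lie_zero, add_zero]
  have hker : degreeGE ℒ 1 ≤ LinearMap.ker δ := degreeGE_le hhom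
  rwa [T.graded.degreeGE_one, top_le_iff, LinearMap.ker_eq_top] at hker

theorem isMaximalClass_quotient (T : IsThin ℒ) (D : IsSecondDiamond ℒ k) {n : ℕ} (hn : 1 ≤ n)
    (hnk : n < k) : IsMaximalClass (quotientGrading (liePower F L (n + 1)) ℒ) where
  graded := T.graded.quotient (T.toSubmodule_liePower n)
  finrank_one := by
    rw [quotientGrading, ← LinearMap.range_domRestrict, LinearMap.finrank_range_of_inj,
      T.finrank_one]
    rw [← LinearMap.ker_eq_bot, LinearMap.ker_eq_bot']
    rintro ⟨u, hu⟩ h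
    exact Subtype.ext (Submodule.disjoint_def.1 (T.graded.disjoint_degreeGE (by omega)) u hu
      (T.mk'_liePower_eq_zero_iff.1 h))
  rank_le_one i hi := by
    rcases Nat.lt_or_ge i k with h | h
    · exact (rank_map_le _ _).trans (T.rank_eq_one D hi h).le
    · have hbot : quotientGrading (liePower F L (n + 1)) ℒ i = ⊥ := by
        rw [eq_bot_iff]
        rintro _ ⟨u, hu, rfl⟩
        exact T.mk'_liePower_eq_zero_iff.2 (le_degreeGE (by omega) hu)
      rw [hbot, rank_bot]
      exact zero_le
  span_bracket i hi := by
    refine le_antisymm (Submodule.span_le.2 ?_) ?_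
    · rintro _ ⟨u, hu, w, hw, rfl⟩
      exact (T.graded.quotient (T.toSubmodule_liePower n)).bracket_mem i 1 u hu w hw
    · rintro _ ⟨t, ht, rfl⟩
      obtain ⟨u, hu, a, ha, rfl⟩ := T.exists_lie_eq hi ht
      exact Submodule.subset_span ⟨_, ⟨u, hu, rfl⟩, _, ⟨a, ha, rfl⟩, rfl⟩

theorem rank_le_of_eq_bot (T : IsThin ℒ) (D : IsSecondDiamond ℒ k) {M : ℕ} (hM : k ≤ M)
    (hone : ∀ i, k < i → i ≤ M → Module.rank F (ℒ i) ≤ 1) (hbot : ℒ (M + 1) = ⊥) :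
    Module.rank F L ≤ (M + 2 : ℕ) := by
  have hrank (i : ℕ) (hi : i ∈ Finset.Icc 1 M) : Module.rank F (ℒ i) ≤
      ((1 + (if i = 1 then 1 else 0) + if i = k then 1 else 0 : ℕ) : Cardinal) := by
    obtain ⟨hi1, hiM⟩ := Finset.mem_Icc.1 hi
    have hk1 := D.1
    have htwo {j : ℕ} (hj : Module.finrank F (ℒ j) = 2) : Module.rank F (ℒ j) ≤ (2 : ℕ) := by
      have : FiniteDimensional F (ℒ j) := FiniteDimensional.of_finrank_pos (by omega)
      rw [← Module.finrank_eq_rank, hj]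
    rcases eq_or_ne i 1 with rfl | h1
    · simpa [hk1.ne] using htwo T.finrank_one
    rcases eq_or_ne i k with rfl | hk
    · simpa [h1] using htwo D.2.1
    rcases Nat.lt_or_ge i k with h | h
    · simpa [h1, hk] using (T.rank_eq_one D (by omega) h).le
    · simpa [h1, hk] using hone i (by omega) hiM
  have htop : ⨆ i ∈ Finset.Icc 1 M, ℒ i = ⊤ := by
    rw [eq_top_iff, ← T.graded.degreeGE_one]
    refine degreeGE_le fun i hi => ?_
    rcases Nat.lt_or_ge M i with h | h
    · rw [T.eq_bot_of_le (by omega) h hbot]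
      exact bot_le
    · exact le_biSup ℒ (Finset.mem_Icc.2 ⟨hi, h⟩)
  calc Module.rank F L = Module.rank F ↥(⨆ i ∈ Finset.Icc 1 M, ℒ i) := by rw [htop, rank_top]
    _ ≤ ∑ i ∈ Finset.Icc 1 M, Module.rank F (ℒ i) := rank_biSup_le _ _
    _ ≤ _ := Finset.sum_le_sum hrank
    _ = (M + 2 : ℕ) := by
      rw [← Nat.cast_sum]
      have hk1 := D.1
      simp [Finset.sum_add_distrib, hk1.le, hM, hk1.le.trans hM, add_assoc, one_add_one_eq_two]

theorem succ_ne_bot (T : IsThin ℒ) (D : IsSecondDiamond ℒ k)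
    (hdim : ((4 * k + 1 : ℕ) : Cardinal) < 3 * Module.rank F L) {M : ℕ} (hM : k ≤ M)
    (hspan : ∀ i, k < i → i ≤ M → ∃ u, ℒ i = Submodule.span F {u})
    (hMk : 3 * (M + 2) ≤ 4 * k + 1) : ℒ (M + 1) ≠ ⊥ := by
  intro hbot
  have hrank : Module.rank F L ≤ (M + 2 : ℕ) := by
    refine T.rank_le_of_eq_bot D hM (fun i hki hi => ?_) hbot
    obtain ⟨u, hu⟩ := hspan i hki hi
    rw [hu]
    exact (rank_span_le _).trans_eq (Cardinal.mk_singleton u)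
  refine hdim.not_ge ?_
  calc 3 * Module.rank F L ≤ 3 * (M + 2 : ℕ) := mul_le_mul_right hrank 3
    _ = (3 * (M + 2) : ℕ) := by rw [Nat.cast_mul, Nat.cast_ofNat]
    _ ≤ (4 * k + 1 : ℕ) := Nat.cast_le.2 hMk

end IsThin

end Thin

local notation "X" => LieAlgebra.ad F L x
local notation "Y" => LieAlgebra.ad F L y

section Frames

/-- The standing hypotheses: `ℒ` is thin with second diamond `ℒ k`, and `x`, `y` span its first
two distinct two-step centralizers, the one spanned by `x` first occurring in degree `q`. -/
structure IsFrame (ℒ : ℕ → Submodule F L) (k q : ℕ) (x y : L) : Prop where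
  thin : IsThin ℒ
  diamond : IsSecondDiamond ℒ k
  centralizers : IsFirstTwoCentralizers ℒ q x y

/-- The component `ℒ i` is centralized by `y`. -/
def IsCentralizedBy (ℒ : ℕ → Submodule F L) (y : L) (i : ℕ) : Prop :=
  ∀ u ∈ ℒ i, LieAlgebra.ad F L y u = 0

namespace IsFrame

theorem derX : IsDerivation X := isDerivation_ad x

theorem derY : IsDerivation Y := isDerivation_ad y

theorem y_mem (S : IsFrame ℒ k q x y) : y ∈ ℒ 1 := by
  have h : y ∈ twoStepCentralizer ℒ 2 := by
    rw [S.centralizers.centralizer_two]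
    exact Submodule.mem_span_singleton_self y
  exact h.1

theorem x_mem_twoStepCentralizer (S : IsFrame ℒ k q x y) : x ∈ twoStepCentralizer ℒ q := by
  rw [S.centralizers.centralizer_qb]
  exact Submodule.mem_span_singleton_self x

theorem x_mem (S : IsFrame ℒ k q x y) : x ∈ ℒ 1 := S.x_mem_twoStepCentralizer.1

theorem X_eq_zero_of_mem (S : IsFrame ℒ k q x y) : ∀ u ∈ ℒ q, X u = 0 :=
  S.x_mem_twoStepCentralizer.2

theorem isCentralizedBy_of_lt (S : IsFrame ℒ k q x y) {i : ℕ} (hi : 2 ≤ i) (hiq : i < q) :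
    IsCentralizedBy ℒ y i := by
  have h : y ∈ twoStepCentralizer ℒ i := by
    rw [S.centralizers.centralizer_eq i hi hiq]
    exact Submodule.mem_span_singleton_self y
  exact h.2

theorem two_lt (S : IsFrame ℒ k q x y) : 2 < q := by
  refine lt_of_le_of_ne S.centralizers.two_le fun h => S.centralizers.span_ne ?_
  rw [← S.centralizers.centralizer_qb, ← S.centralizers.centralizer_two, h]

theorem span_pair (S : IsFrame ℒ k q x y) : Submodule.span F {x, y} = ℒ 1 := by
  have hli : LinearIndependent F ![x, y] := by
    rw [LinearIndependent.pair_iff' S.centralizers.x_ne_zero]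
    rintro a rfl
    have ha : a ≠ 0 := fun h => S.centralizers.y_ne_zero (by rw [h, zero_smul])
    exact S.centralizers.span_ne (Submodule.span_singleton_smul_eq (IsUnit.mk0 a ha) x).symm
  have hf := finrank_span_eq_card hli
  rw [Matrix.range_cons_cons_empty, Fintype.card_fin] at hf
  have : FiniteDimensional F (ℒ 1) :=
    FiniteDimensional.of_finrank_pos (by rw [S.thin.finrank_one]; norm_num)
  refine Submodule.eq_of_le_of_finrank_eq ?_ (by rw [hf, S.thin.finrank_one])
  exact Submodule.span_le.2 (Set.pair_subset S.x_mem S.y_mem)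

theorem exists_eq_smul_X_add_smul_Y (S : IsFrame ℒ k q x y) {i : ℕ} {u : L} (hi : 1 ≤ i)
    (hu : u ∈ ℒ i) (hu0 : u ≠ 0) {t : L} (ht : t ∈ ℒ (i + 1)) :
    ∃ a b : F, t = a • X u + b • Y u := by
  rw [← S.thin.covering i hi u hu hu0] at ht
  obtain ⟨z, hz, rfl⟩ := ht
  obtain ⟨a, b, rfl⟩ := Submodule.mem_span_pair.1 (S.span_pair.symm ▸ hz)
  refine ⟨-a, -b, ?_⟩
  simp [← lie_skew u, add_comm]

theorem lie_mem (S : IsFrame ℒ k q x y) {i j n : ℕ} {u w : L} (hu : u ∈ ℒ i) (hw : w ∈ ℒ j)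
    (hn : i + j = n) : ⁅u, w⁆ ∈ ℒ n := hn ▸ S.thin.graded.bracket_mem i j u hu w hw

theorem X_mem (S : IsFrame ℒ k q x y) {i j : ℕ} {u : L} (hu : u ∈ ℒ i) (hj : i + 1 = j) :
    X u ∈ ℒ j := S.lie_mem S.x_mem hu (by omega)

theorem Y_mem (S : IsFrame ℒ k q x y) {i j : ℕ} {u : L} (hu : u ∈ ℒ i) (hj : i + 1 = j) :
    Y u ∈ ℒ j := S.lie_mem S.y_mem hu (by omega)

theorem X_pow_mem (S : IsFrame ℒ k q x y) {i j : ℕ} {u : L} (n : ℕ) (hu : u ∈ ℒ i)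
    (hj : i + n = j) : (X ^ n) u ∈ ℒ j := by
  induction n generalizing j with
  | zero => simpa [← hj] using hu
  | succ n ih =>
    rw [← apply_pow]
    exact S.X_mem (ih rfl) (by omega)

theorem X_pow_y_mem (S : IsFrame ℒ k q x y) {n j : ℕ} (hj : n + 1 = j) : (X ^ n) y ∈ ℒ j :=
  S.X_pow_mem n S.y_mem (by omega)

theorem ne_bot (S : IsFrame ℒ k q x y) {i : ℕ} (hi : 1 ≤ i) (hik : i ≤ k) : ℒ i ≠ ⊥ :=
  S.thin.ne_bot S.diamond hi hik

theorem exists_ne_zero (S : IsFrame ℒ k q x y) {i : ℕ} (hi : 1 ≤ i) (hik : i ≤ k) :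
    ∃ u ∈ ℒ i, u ≠ 0 := (Submodule.ne_bot_iff _).1 (S.ne_bot hi hik)

theorem exists_eq_smul (S : IsFrame ℒ k q x y) {i : ℕ} (hi : 2 ≤ i) (hik : i < k) {u w : L}
    (hu : u ∈ ℒ i) (hu0 : u ≠ 0) (hw : w ∈ ℒ i) : ∃ a : F, w = a • u := by
  obtain ⟨a, ha⟩ := (finrank_eq_one_iff_of_nonzero' (⟨u, hu⟩ : ℒ i)
    (fun h => hu0 (congrArg Subtype.val h))).1 (S.thin.finrank_eq_one S.diamond hi hik) ⟨w, hw⟩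
  exact ⟨a, (congrArg Subtype.val ha).symm⟩

theorem succ_eq_bot_of_X_Y_eq_zero (S : IsFrame ℒ k q x y) {i : ℕ} {u : L} (hi : 1 ≤ i)
    (hu : u ∈ ℒ i) (hu0 : u ≠ 0) (hX : X u = 0) (hY : Y u = 0) : ℒ (i + 1) = ⊥ := by
  rw [eq_bot_iff]
  intro t ht
  obtain ⟨a, b, rfl⟩ := S.exists_eq_smul_X_add_smul_Y hi hu hu0 ht
  rw [hX, hY, smul_zero, smul_zero, add_zero]
  exact zero_mem _

theorem X_ne_zero (S : IsFrame ℒ k q x y) {i : ℕ} {u : L} (hi : 1 ≤ i) (hu : u ∈ ℒ i)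
    (hu0 : u ≠ 0) (hY : Y u = 0) (hbot : ℒ (i + 1) ≠ ⊥) : X u ≠ 0 :=
  fun hX => hbot (S.succ_eq_bot_of_X_Y_eq_zero hi hu hu0 hX hY)

theorem Y_ne_zero (S : IsFrame ℒ k q x y) {i : ℕ} {u : L} (hi : 1 ≤ i) (hu : u ∈ ℒ i)
    (hu0 : u ≠ 0) (hX : X u = 0) (hbot : ℒ (i + 1) ≠ ⊥) : Y u ≠ 0 :=
  fun hY => hbot (S.succ_eq_bot_of_X_Y_eq_zero hi hu hu0 hX hY)

theorem X_y_ne_zero (S : IsFrame ℒ k q x y) : X y ≠ 0 :=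
  S.X_ne_zero le_rfl S.y_mem S.centralizers.y_ne_zero (lie_self y)
    (S.ne_bot (by norm_num) S.diamond.1)

theorem three_le (S : IsFrame ℒ k q x y) : 3 ≤ k := by
  have hk := S.diamond.1
  suffices k ≠ 2 by omega
  rintro rfl
  have hle : ℒ 2 ≤ Submodule.span F {X y} := fun t ht => by
    obtain ⟨a, b, rfl⟩ := S.exists_eq_smul_X_add_smul_Y le_rfl S.y_mem S.centralizers.y_ne_zero ht
    rw [show Y y = 0 from lie_self y, smul_zero, add_zero]
    exact Submodule.smul_mem _ _ (Submodule.mem_span_singleton_self _)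
  have hfinrank := Submodule.finrank_mono hle
  rw [S.diamond.2.1, finrank_span_singleton S.X_y_ne_zero] at hfinrank
  omega

theorem linearIndependent_X_Y (S : IsFrame ℒ k q x y) {v : L} (hv : v ∈ ℒ (k - 1)) (hv0 : v ≠ 0) :
    LinearIndependent F ![X v, Y v] := by
  have hk := S.three_le
  have hspan : Submodule.span F (Set.range ![X v, Y v]) = ℒ k := by
    rw [Matrix.range_cons_cons_empty]
    apply le_antisymm
    · exact Submodule.span_le.2 (Set.pair_subset (S.X_mem hv (by omega)) (S.Y_mem hv (by omega)))
    · intro t ht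
      obtain ⟨a, b, rfl⟩ := S.exists_eq_smul_X_add_smul_Y (i := k - 1) (by omega) hv hv0
        (by rwa [Nat.sub_add_cancel (by omega)])
      exact Submodule.mem_span_pair.2 ⟨a, b, rfl⟩
  rw [linearIndependent_iff_card_eq_finrank_span, Set.finrank, hspan, S.diamond.2.1,
    Fintype.card_fin]

theorem X_last_ne_zero (S : IsFrame ℒ k q x y) {v : L} (hv : v ∈ ℒ (k - 1)) (hv0 : v ≠ 0) :
    X v ≠ 0 := (S.linearIndependent_X_Y hv hv0).ne_zero 0

theorem Y_last_ne_zero (S : IsFrame ℒ k q x y) {v : L} (hv : v ∈ ℒ (k - 1)) (hv0 : v ≠ 0) :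
    Y v ≠ 0 := (S.linearIndependent_X_Y hv hv0).ne_zero 1

theorem add_two_le (S : IsFrame ℒ k q x y) : q + 2 ≤ k := by
  have hk := S.three_le
  obtain ⟨v, hv, hv0⟩ := S.exists_ne_zero (i := k - 1) (by omega) (by omega)
  by_contra h
  rcases Nat.lt_or_ge q k with hqk | hqk
  · exact S.X_last_ne_zero hv hv0 (S.X_eq_zero_of_mem v (by rwa [show k - 1 = q by omega] at hv))
  · exact S.Y_last_ne_zero hv hv0 (S.isCentralizedBy_of_lt (by omega) (by omega) v hv)

theorem derivation_eq_zero (S : IsFrame ℒ k q x y) {δ : Module.End F L} (hδ : IsDerivation δ)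
    (hx : δ x = 0) (hy : δ y = 0) : δ = 0 := by
  refine S.thin.derivation_eq_zero hδ fun u hu => ?_
  obtain ⟨a, b, rfl⟩ := Submodule.mem_span_pair.1 (S.span_pair.symm ▸ hu)
  rw [map_add, map_smul, map_smul, hx, hy, smul_zero, smul_zero, add_zero]

theorem isCentralizedBy_of_Y_eq_zero (S : IsFrame ℒ k q x y) {i : ℕ} {u : L} (hi : 2 ≤ i)
    (hik : i < k) (hu : u ∈ ℒ i) (hu0 : u ≠ 0) (hY : Y u = 0) : IsCentralizedBy ℒ y i := by
  intro w hw
  obtain ⟨a, rfl⟩ := S.exists_eq_smul hi hik hu hu0 hw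
  rw [map_smul, hY, smul_zero]

theorem Y_ne_zero_of_not_isCentralizedBy (S : IsFrame ℒ k q x y) {i : ℕ} {u : L} (hi : 2 ≤ i)
    (hik : i < k) (hn : ¬ IsCentralizedBy ℒ y i) (hu : u ∈ ℒ i) (hu0 : u ≠ 0) : Y u ≠ 0 :=
  fun h => hn (S.isCentralizedBy_of_Y_eq_zero hi hik hu hu0 h)

theorem add_lt_and_X_pow_ne_zero (S : IsFrame ℒ k q x y) {i : ℕ} {u : L} (hi : 1 ≤ i) (hik : i < k)
    (hu : u ∈ ℒ i) (hu0 : u ≠ 0) (n : ℕ) (h : ∀ l < n, Y ((X ^ l) u) = 0) :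
    i + n < k ∧ (X ^ n) u ≠ 0 := by
  induction n with
  | zero => exact ⟨hik, by simpa using hu0⟩
  | succ n ih =>
    obtain ⟨hlt, hne⟩ := ih fun l hl => h l (by omega)
    have hY := h n (by omega)
    have hmem := S.X_pow_mem n hu rfl
    have hlast : i + n ≠ k - 1 := fun hin => S.Y_last_ne_zero (hin ▸ hmem) hne hY
    refine ⟨by omega, ?_⟩
    rw [← apply_pow]
    exact S.X_ne_zero (by omega) hmem hne hY (S.ne_bot (by omega) (by omega))

theorem add_lt_and_X_pow_ne_zero_of_isCentralizedBy (S : IsFrame ℒ k q x y) {i : ℕ} {u : L}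
    (hi : 1 ≤ i) (hik : i < k) (hu : u ∈ ℒ i) (hu0 : u ≠ 0) (n : ℕ)
    (h : ∀ j, i ≤ j → j < i + n → IsCentralizedBy ℒ y j) : i + n < k ∧ (X ^ n) u ≠ 0 :=
  S.add_lt_and_X_pow_ne_zero hi hik hu hu0 n fun l hl =>
    h (i + l) (by omega) (by omega) _ (S.X_pow_mem l hu rfl)

theorem exists_X_pow_eq (S : IsFrame ℒ k q x y) {i : ℕ} (hi : 2 ≤ i) (n : ℕ) {j : ℕ} {t : L}
    (hj : i + n = j) (hjk : j < k) (ht : t ∈ ℒ j)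
    (h : ∀ l, i ≤ l → l < j → IsCentralizedBy ℒ y l) : ∃ u ∈ ℒ i, (X ^ n) u = t := by
  subst hj
  obtain ⟨u, hu, hu0⟩ := S.exists_ne_zero (i := i) (by omega) (by omega)
  obtain ⟨-, hne⟩ :=
    S.add_lt_and_X_pow_ne_zero_of_isCentralizedBy (by omega) (by omega) hu hu0 n h
  obtain ⟨a, rfl⟩ := S.exists_eq_smul (by omega) hjk (S.X_pow_mem n hu rfl) hne ht
  exact ⟨a • u, (ℒ i).smul_mem _ hu, map_smul _ _ _⟩

theorem Y_X_pow_y (S : IsFrame ℒ k q x y) {n : ℕ} (hn : n + 2 ≤ q) : Y ((X ^ n) y) = 0 := by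
  rcases Nat.eq_zero_or_pos n with rfl | h
  · exact lie_self y
  · exact S.isCentralizedBy_of_lt (by omega) (by omega) _ (S.X_pow_y_mem rfl)

theorem X_pow_y_ne_zero (S : IsFrame ℒ k q x y) {n : ℕ} (hn : n + 1 ≤ q) : (X ^ n) y ≠ 0 := by
  have := S.add_two_le
  exact (S.add_lt_and_X_pow_ne_zero le_rfl (by omega) S.y_mem S.centralizers.y_ne_zero n
    fun l hl => S.Y_X_pow_y (by omega)).2

theorem X_pow_pred_y_mem (S : IsFrame ℒ k q x y) : (X ^ (q - 1)) y ∈ ℒ q :=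
  S.X_pow_y_mem (by have := S.two_lt; omega)

theorem X_X_pow_pred_y (S : IsFrame ℒ k q x y) : X ((X ^ (q - 1)) y) = 0 :=
  S.X_eq_zero_of_mem _ S.X_pow_pred_y_mem

theorem Y_X_pow_pred_y_ne_zero (S : IsFrame ℒ k q x y) : Y ((X ^ (q - 1)) y) ≠ 0 := by
  have := S.add_two_le
  have := S.two_lt
  exact S.Y_ne_zero (by omega) S.X_pow_pred_y_mem (S.X_pow_y_ne_zero (by omega)) S.X_X_pow_pred_y
    (S.ne_bot (by omega) (by omega))

theorem X_pow_y_eq_zero (S : IsFrame ℒ k q x y) {n : ℕ} (hn : q ≤ n) : (X ^ n) y = 0 := by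
  have := S.two_lt
  exact pow_apply_eq_zero_of_apply_pow_eq_zero rfl S.X_X_pow_pred_y (by omega)

theorem not_isCentralizedBy (S : IsFrame ℒ k q x y) : ¬ IsCentralizedBy ℒ y q :=
  fun h => S.Y_X_pow_pred_y_ne_zero (h _ S.X_pow_pred_y_mem)

variable [CharP F 2]

variable (F) in
theorem lie_y (u : L) : ⁅u, y⁆ = Y u := lie_comm_of_charTwo F u y

variable (F) in
theorem Y_x : Y x = X y := lie_comm_of_charTwo F y x

theorem Y_Y (S : IsFrame ℒ k q x y) (u : L) : Y (Y u) = 0 := by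
  have hsq : Y ^ 2 = 0 := by
    refine S.derivation_eq_zero (derY.pow_char_pow 2 1) ?_ ?_
    · rw [pow_two, Module.End.mul_apply, Y_x F (x := x)]
      exact S.isCentralizedBy_of_lt le_rfl S.two_lt _ (S.X_mem S.y_mem rfl)
    · rw [pow_two, Module.End.mul_apply, show Y y = 0 from lie_self y, map_zero]
  rw [← Module.End.mul_apply, ← pow_two, hsq, LinearMap.zero_apply]

theorem X_pow_eq_zero (S : IsFrame ℒ k q x y) {e : ℕ} (hq : q = 2 ^ e) {n : ℕ} (hn : q ≤ n)
    (u : L) : (X ^ n) u = 0 := by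
  have hX : X ^ q = 0 := by
    refine S.derivation_eq_zero (hq ▸ derX.pow_char_pow 2 e) ?_ (S.X_pow_y_eq_zero le_rfl)
    exact pow_apply_eq_zero_of_le (m := 1) (by simp) (by have := S.two_lt; omega)
  exact pow_apply_eq_zero_of_le (m := q) (by rw [hX, LinearMap.zero_apply]) hn

theorem X_pow_Y_X_pow_pred_y_eq_zero (S : IsFrame ℒ k q x y) {f r : ℕ} (hr : 0 < r)
    (hq : q = 2 ^ f * (2 * r + 1)) :
    (X ^ (2 ^ f - 1)) (Y ((X ^ (q - 1)) y)) = 0 := by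
  set P := 2 ^ f with hP
  have hP0 : 0 < P := by positivity
  have hqP : q = P * (2 * r) + P := by rw [hq]; ring
  have hPr : P * 2 ≤ P * (2 * r) := Nat.mul_le_mul_left _ (by omega)
  have hpow (i : ℕ) : ((X ^ P) ^ i) ((X ^ (P - 1)) y) = (X ^ (P * i + (P - 1))) y := by
    rw [← pow_mul, pow_apply_pow]
  have hzero (i : ℕ) (hi : i < 2 * r) :
      ⁅((X ^ P) ^ i) ((X ^ (P - 1)) y), (X ^ (P - 1)) y⁆ = 0 := by
    rw [hpow]
    refine derX.lie_pow_eq_zero fun l hl => ?_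
    have hPi : P * (i + 1) ≤ P * (2 * r) := Nat.mul_le_mul_left _ (by omega)
    rw [mul_add, mul_one] at hPi
    rw [lie_y F, pow_apply_pow]
    exact S.Y_X_pow_y (by omega)
  -- `X ^ P` is a derivation, and for `c = X ^ (P - 1) y` the bracket `⁅(X ^ P) ^ (2 * r) c, c⁆`
  -- equals `⁅(X ^ P) ^ r c, (X ^ P) ^ r c⁆`.
  have hself := (derX.pow_char_pow 2 f).lie_pow_two_mul_self_eq_zero hzero
  rw [← hP, hpow, show P * (2 * r) + (P - 1) = q - 1 by omega,
    derX.lie_pow_eq_single 0] at hself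
  · rwa [Nat.choose_zero_right, Nat.cast_one, one_smul, pow_zero, Module.End.one_apply, lie_y F,
      Nat.sub_zero] at hself
  · intro l _ hl
    rw [pow_apply_pow, S.X_pow_y_eq_zero (by omega), zero_lie]

theorem Y_X_pow_Y_X_pow_pred_y_eq_zero (S : IsFrame ℒ k q x y) {f l : ℕ} (hfq : 2 * 2 ^ f ≤ q)
    (hl : l < 2 ^ f - 1) : Y ((X ^ l) (Y ((X ^ (q - 1)) y))) = 0 := by
  set P := 2 ^ f
  have hzero : Y ⁅(X ^ (q - 1 - (P - 1 - l))) y, (X ^ (P - 1)) y⁆ = 0 := by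
    rw [derY, S.Y_X_pow_y (by omega), S.Y_X_pow_y (by omega), zero_lie, lie_zero, add_zero]
  rw [derX.lie_pow_eq_single (P - 1 - l)] at hzero
  · rw [lie_y F, pow_apply_pow, map_smul,
      show P - 1 - l + (q - 1 - (P - 1 - l)) = q - 1 by omega,
      show P - 1 - (P - 1 - l) = l by omega,
      cast_choose_pow_sub_one 2 (by omega), CharTwo.neg_eq, one_pow, one_smul] at hzero
    exact hzero
  · intro m _ hml
    rw [lie_y F, pow_apply_pow]
    rcases Nat.lt_or_ge m (P - 1 - l) with h | h
    · exact S.Y_X_pow_y (by omega)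
    · rw [S.X_pow_y_eq_zero (by omega), map_zero]

theorem exists_eq_two_pow (S : IsFrame ℒ k q x y) : ∃ e, q = 2 ^ e := by
  have htwo := S.two_lt
  have hqk := S.add_two_le
  obtain ⟨f, _, ⟨r, rfl⟩, hq⟩ := Nat.exists_eq_two_pow_mul_odd (n := q) (by omega)
  rcases Nat.eq_zero_or_pos r with rfl | hr
  · exact ⟨f, by simpa using hq⟩
  have hfq : 2 ^ f * 3 ≤ q := hq ▸ Nat.mul_le_mul_left _ (by omega)
  exact absurd (S.X_pow_Y_X_pow_pred_y_eq_zero hr hq)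
    (S.add_lt_and_X_pow_ne_zero (by omega) (by omega) (S.Y_mem S.X_pow_pred_y_mem rfl)
      S.Y_X_pow_pred_y_ne_zero (2 ^ f - 1)
      fun l hl => S.Y_X_pow_Y_X_pow_pred_y_eq_zero (by omega) hl).2

end IsFrame

end Frames

theorem exists_prev_not {P : ℕ → Prop} {q s : ℕ} (hq : ¬ P q) (hs : q < s) :
    ∃ p, q ≤ p ∧ p < s ∧ ¬ P p ∧ ∀ i, p < i → i < s → P i := by
  classical
  refine ⟨Nat.findGreatest (fun i => ¬ P i) (s - 1), Nat.le_findGreatest (by omega) hq,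
    (Nat.findGreatest_le (s - 1)).trans_lt (by omega),
    Nat.findGreatest_spec (P := fun i => ¬ P i) (show q ≤ s - 1 by omega) hq, fun i hi his => ?_⟩
  exact not_not.1 (Nat.findGreatest_is_greatest hi (by omega))

theorem exists_next_not {P : ℕ → Prop} {s m : ℕ} (hm : ¬ P m) (hs : s < m) :
    ∃ p, s < p ∧ p ≤ m ∧ ¬ P p ∧ ∀ i, s < i → i < p → P i := by
  classical
  have hex : ∃ p, s < p ∧ ¬ P p := ⟨m, hs, hm⟩
  exact ⟨Nat.find hex, (Nat.find_spec hex).1, Nat.find_min' hex ⟨hs, hm⟩, (Nat.find_spec hex).2,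
    fun i hi hip => not_not.1 fun hPi => Nat.find_min hex hip ⟨hi, hPi⟩⟩

theorem eight_le_of_eq_two_pow {q e : ℕ} (he : 3 ≤ e) (hq : q = 2 ^ e) : 8 ≤ q :=
  hq ▸ Nat.pow_le_pow_right (n := 2) two_pos he

theorem two_pow_mul_two_le {q e b : ℕ} (hq : q = 2 ^ e) (hb : b < e) : 2 ^ b * 2 ≤ q := by
  rw [hq, ← pow_succ]
  exact Nat.pow_le_pow_right two_pos hb

theorem lt_of_two_pow_lt {q e b : ℕ} (hq : q = 2 ^ e) (hb : 2 ^ b < q) : b < e :=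
  (Nat.pow_lt_pow_iff_right one_lt_two).1 (hq ▸ hb)

theorem two_pow_mul_four_le_and_add_le {q e b o : ℕ} (hq : q = 2 ^ e) (ho : Odd o)
    (hlt : 2 ^ b * o < q) (hne : 2 ^ b * o + 2 ^ b ≠ q) :
    2 ^ b * 4 ≤ q ∧ 2 ^ b * o + 2 ^ b * 3 ≤ q := by
  have hbe : b < e := lt_of_two_pow_lt hq ((Nat.le_mul_of_pos_right _ ho.pos).trans_lt hlt)
  obtain ⟨d, rfl⟩ : ∃ d, e = b + (d + 1) := ⟨e - b - 1, by omega⟩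
  rw [pow_add, pow_succ] at hq
  subst hq
  have hod : o < 2 ^ d * 2 := lt_of_mul_lt_mul_left hlt (Nat.zero_le _)
  have hod' : o + 1 ≠ 2 ^ d * 2 := fun h => hne (by rw [← h, mul_add, mul_one])
  have := ho.pos
  obtain ⟨t, rfl⟩ := ho
  rw [← mul_add]
  exact ⟨Nat.mul_le_mul_left _ (by omega), Nat.mul_le_mul_left _ (by omega)⟩

section Gaps

namespace IsFrame

theorem not_isCentralizedBy_pred (S : IsFrame ℒ k q x y) : ¬ IsCentralizedBy ℒ y (k - 1) := by
  have := S.three_le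
  obtain ⟨v, hv, hv0⟩ := S.exists_ne_zero (i := k - 1) (by omega) (by omega)
  exact fun h => S.Y_last_ne_zero hv hv0 (h v hv)

variable [CharP F 2]

theorem Y_X_pow_Y_eq_zero_of_run (S : IsFrame ℒ k q x y) {p n b o : ℕ} {A : L}
    (hpk : p + 1 < k) (hA : A ∈ ℒ p) (hYA : Y A ≠ 0) (hno : n + 1 = 2 ^ b * o) (ho : Odd o)
    (hb : 2 ^ b + 2 ≤ p) (hnq : n + 2 ^ b + 2 ≤ q)
    (hbt : ∀ i, p < i → i < p + 1 + n → IsCentralizedBy ℒ y i)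
    (hrun : ∀ i, i < p → p ≤ i + 2 ^ b → IsCentralizedBy ℒ y i) :
    Y ((X ^ n) (Y A)) = 0 := by
  have hYAm : Y A ∈ ℒ (p + 1) := S.Y_mem hA rfl
  have hb0 : 0 < 2 ^ b := by positivity
  obtain ⟨c, hc⟩ := S.exists_eq_smul (by omega) hpk hYAm hYA (S.X_mem hA rfl)
  obtain ⟨μ, hμ, hμA⟩ := S.exists_X_pow_eq (i := p - 2 ^ b) (by omega) (2 ^ b) (j := p) (by omega)
    (by omega) hA fun l h1 h2 => hrun l h2 (by omega)
  have hzero : Y ⁅μ, (X ^ (2 ^ b + n)) y⁆ = 0 := by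
    rw [derY, S.Y_X_pow_y (by omega), hrun (p - 2 ^ b) (by omega) (by omega) _ hμ, zero_lie,
      lie_zero, add_zero]
  have hcast : (((2 ^ b + n).choose (2 ^ b) : ℕ) : F) = 1 := by
    rw [show n = 2 ^ b * o - 1 by omega, cast_choose_pow_add_pow_mul_sub_one 2 b o ho.pos,
      CharTwo.natCast_eq_ite, if_neg (Nat.not_even_iff_odd.2 ho)]
  rw [derX.lie_pow_eq_single (2 ^ b), lie_y F, hμA, map_smul, hcast, one_smul,
    Nat.add_sub_cancel_left] at hzero
  · exact hzero
  · intro l hl hlb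
    rw [lie_y F]
    rcases Nat.lt_or_gt_of_ne hlb with h | h
    · exact hrun (p - 2 ^ b + l) (by omega) (by omega) _ (S.X_pow_mem l hμ rfl)
    · obtain ⟨t, rfl⟩ : ∃ t, l = t + 1 + 2 ^ b := ⟨l - 1 - 2 ^ b, by omega⟩
      rw [← pow_apply_pow, hμA, ← pow_apply_apply, hc, map_smul, map_smul,
        hbt (p + 1 + t) (by omega) (by omega) _ (S.X_pow_mem t hYAm rfl), smul_zero]

theorem eq_add_or_add_two_pow_eq_add_of_run (S : IsFrame ℒ k q x y) {e : ℕ} (he : 3 ≤ e)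
    (hq : q = 2 ^ e) {p s : ℕ} (hp : q ≤ p) (hps : p < s) (hs : s < k)
    (hpn : ¬ IsCentralizedBy ℒ y p) (hsn : ¬ IsCentralizedBy ℒ y s)
    (hbt : ∀ i, p < i → i < s → IsCentralizedBy ℒ y i)
    (hrun : ∀ i, i < p → p ≤ i + q / 4 → IsCentralizedBy ℒ y i) :
    s = p + q ∨ ∃ b, b < e ∧ s + 2 ^ b = p + q := by
  have hq8 := eight_le_of_eq_two_pow he hq
  obtain ⟨A, hA, hA0⟩ := S.exists_ne_zero (i := p) (by omega) (by omega)
  have hYA := S.Y_ne_zero_of_not_isCentralizedBy (by omega) (by omega) hpn hA hA0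
  have hYAm : Y A ∈ ℒ (p + 1) := S.Y_mem hA rfl
  obtain ⟨n, rfl⟩ : ∃ n, s = p + 1 + n := ⟨s - p - 1, by omega⟩
  obtain ⟨-, hne⟩ := S.add_lt_and_X_pow_ne_zero_of_isCentralizedBy (by omega) (by omega) hYAm hYA n
    fun j h1 h2 => hbt j (by omega) (by omega)
  have hnq : n < q := not_le.1 fun h => hne (S.X_pow_eq_zero hq h _)
  rcases Nat.lt_or_ge (n + 1) q with hlt | hge
  swap
  · exact Or.inl (by omega)
  obtain ⟨b, o, ho, hno⟩ := Nat.exists_eq_two_pow_mul_odd (n := n + 1) (by omega)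
  have hbo : 2 ^ b ≤ 2 ^ b * o := Nat.le_mul_of_pos_right _ ho.pos
  refine Or.inr ⟨b, lt_of_two_pow_lt hq (by omega), ?_⟩
  by_contra hcon
  obtain ⟨hb4, hb3⟩ := two_pow_mul_four_le_and_add_le hq ho (hno ▸ hlt) (by omega)
  have hb0 : 0 < 2 ^ b := by positivity
  refine S.Y_ne_zero_of_not_isCentralizedBy (by omega) hs hsn (S.X_pow_mem n hYAm rfl) hne ?_
  exact S.Y_X_pow_Y_eq_zero_of_run (by omega) hA hYA hno ho (by omega) (by omega) hbt
    fun i h1 h2 => hrun i h1 (by omega)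

theorem isCentralizedBy_of_lt_add_half (S : IsFrame ℒ k q x y) {e : ℕ} (he : 3 ≤ e)
    (hq : q = 2 ^ e) {s : ℕ} (hqs : q ≤ s) (hsk : s < k) (hsn : ¬ IsCentralizedBy ℒ y s) {i : ℕ}
    (his : i < s) (hi : s < i + q / 2) : IsCentralizedBy ℒ y i := by
  induction s using Nat.strong_induction_on generalizing i with
  | _ s ih =>
    have hq8 := eight_le_of_eq_two_pow he hq
    rcases Nat.eq_or_lt_of_le hqs with rfl | hlt
    · exact S.isCentralizedBy_of_lt (by omega) his
    obtain ⟨p, hqp, hps, hpn, hbt⟩ := exists_prev_not S.not_isCentralizedBy hlt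
    refine hbt i ?_ his
    rcases S.eq_add_or_add_two_pow_eq_add_of_run he hq hqp hps hsk hpn hsn hbt fun j hj hj2 =>
      ih p hps hqp (by omega) hpn hj (by omega) with h | ⟨b, hb, h⟩
    · omega
    · have := two_pow_mul_two_le hq hb
      omega

theorem eq_add_or_add_two_pow_eq_add (S : IsFrame ℒ k q x y) {e : ℕ} (he : 3 ≤ e)
    (hq : q = 2 ^ e) {p s : ℕ} (hp : q ≤ p) (hps : p < s) (hs : s < k)
    (hpn : ¬ IsCentralizedBy ℒ y p) (hsn : ¬ IsCentralizedBy ℒ y s)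
    (hbt : ∀ i, p < i → i < s → IsCentralizedBy ℒ y i) :
    s = p + q ∨ ∃ b, b < e ∧ s + 2 ^ b = p + q := by
  have hq8 := eight_le_of_eq_two_pow he hq
  exact S.eq_add_or_add_two_pow_eq_add_of_run he hq hp hps hs hpn hsn hbt fun i h1 h2 =>
    S.isCentralizedBy_of_lt_add_half he hq hp (by omega) hpn h1 (by omega)

end IsFrame

end Gaps

section Tails

theorem mem_of_eq_span {M : Submodule F L} {u : L} (h : M = Submodule.span F {u}) : u ∈ M :=
  h ▸ Submodule.mem_span_singleton_self u

theorem exists_eq_smul_of_eq_span {M : Submodule F L} {u w : L} (h : M = Submodule.span F {u})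
    (hw : w ∈ M) : ∃ a : F, w = a • u := by
  obtain ⟨a, ha⟩ := Submodule.mem_span_singleton.1 (h ▸ hw)
  exact ⟨a, ha.symm⟩

theorem ne_zero_of_eq_span {M : Submodule F L} {u : L} (h : M = Submodule.span F {u})
    (hM : M ≠ ⊥) : u ≠ 0 :=
  fun hu => hM (by rw [h, hu, Submodule.span_zero_singleton])

theorem isCentralizedBy_of_eq_span {i : ℕ} {u : L} (h : ℒ i = Submodule.span F {u})
    (hY : Y u = 0) : IsCentralizedBy ℒ y i := by
  intro w hw
  obtain ⟨a, rfl⟩ := exists_eq_smul_of_eq_span h hw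
  rw [map_smul, hY, smul_zero]

namespace IsFrame

theorem succ_eq_span_pair (S : IsFrame ℒ k q x y) {i : ℕ} {u : L} (hi : 1 ≤ i) (hu : u ∈ ℒ i)
    (hu0 : u ≠ 0) : ℒ (i + 1) = Submodule.span F {X u, Y u} := by
  refine le_antisymm (fun w hw => ?_)
    (Submodule.span_le.2 (Set.pair_subset (S.X_mem hu rfl) (S.Y_mem hu rfl)))
  obtain ⟨a, b, rfl⟩ := S.exists_eq_smul_X_add_smul_Y hi hu hu0 hw
  exact Submodule.mem_span_pair.2 ⟨a, b, rfl⟩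

theorem eq_span_pair (S : IsFrame ℒ k q x y) {i : ℕ} {u : L} (hi : 1 ≤ i)
    (h : ℒ i = Submodule.span F {u}) : ℒ (i + 1) = Submodule.span F {X u, Y u} := by
  rcases eq_or_ne u 0 with rfl | hu0
  · rw [S.thin.eq_bot_succ i hi (by rw [h, Submodule.span_zero_singleton]), map_zero, map_zero,
      Set.pair_eq_singleton, Submodule.span_zero_singleton]
  · exact S.succ_eq_span_pair hi (mem_of_eq_span h) hu0

theorem eq_span_X (S : IsFrame ℒ k q x y) {i j : ℕ} {u : L} (hi : 1 ≤ i) (hj : i + 1 = j)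
    (h : ℒ i = Submodule.span F {u}) (hY : Y u = 0) : ℒ j = Submodule.span F {X u} := by
  rw [← hj, S.eq_span_pair hi h, hY, Set.pair_comm, Submodule.span_insert_zero]

theorem eq_span_Y (S : IsFrame ℒ k q x y) {i j : ℕ} {u : L} (hi : 1 ≤ i) (hj : i + 1 = j)
    (h : ℒ i = Submodule.span F {u}) (hX : X u = 0) : ℒ j = Submodule.span F {Y u} := by
  rw [← hj, S.eq_span_pair hi h, hX, Submodule.span_insert_zero]

theorem eq_span_X_pow (S : IsFrame ℒ k q x y) {i j : ℕ} {u : L} (hi : 1 ≤ i) (n : ℕ)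
    (hj : i + n = j) (h : ℒ i = Submodule.span F {u}) (hY : ∀ l < n, Y ((X ^ l) u) = 0) :
    ℒ j = Submodule.span F {(X ^ n) u} := by
  induction n generalizing j with
  | zero => simpa [← hj] using h
  | succ n ih =>
    rw [← apply_pow]
    exact S.eq_span_X (by omega) (by omega) (ih rfl fun l hl => hY l (by omega)) (hY n (by omega))

end IsFrame

variable (ℒ k q x y) in
/-- The configuration around the second diamond: `τ` spans the last component in degree less than
`k - 1` which is not centralized by `y`, and `v` spans the component of degree `k - 1`. The number
`d` is the excess of `t` over `k - q - 1`; only `d = 1` survives. -/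
structure IsTail (e d t : ℕ) (τ v : L) (ρ : F) : Prop extends IsFrame ℒ k q x y where
  three_le_exponent : 3 ≤ e
  q_eq : q = 2 ^ e
  d_eq : d = 1 ∨ d = 2
  q_le : q ≤ t
  t_add_eq : t + q + 1 = k + d
  isCentralizedBy_of_gt : ∀ i, t < i → i + 1 < k → IsCentralizedBy ℒ y i
  τ_mem : τ ∈ ℒ t
  X_τ : X τ = 0
  v_eq : (X ^ (q - d - 1)) (Y τ) = v
  v_ne_zero : v ≠ 0
  Y_X_v : Y (X v) = ρ • X (Y v)
  ρ_ne_zero : ρ ≠ 0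
  succ_eq_span : ℒ (k + 1) = Submodule.span F {X (Y v)}
  Y_X_pow_Y_v : ∀ a, a + 3 ≤ q → Y ((X ^ a) (Y v)) = 0

namespace IsFrame

variable [CharP F 2]

theorem succ_eq_span (S : IsFrame ℒ k q x y) {v : L} (hv : v ∈ ℒ (k - 1)) (hv0 : v ≠ 0) :
    ℒ (k + 1) = Submodule.span F {X (Y v)} := by
  have hk := S.three_le
  rw [S.succ_eq_span_pair (by omega) (S.Y_mem hv (by omega)) (S.Y_last_ne_zero hv hv0), S.Y_Y,
    Set.pair_comm, Submodule.span_insert_zero]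

theorem exists_Y_X_eq_smul (S : IsFrame ℒ k q x y) {v : L} (hv : v ∈ ℒ (k - 1)) (hv0 : v ≠ 0)
    (hk1 : ℒ (k + 1) ≠ ⊥) : ∃ ρ : F, ρ ≠ 0 ∧ Y (X v) = ρ • X (Y v) := by
  have hk := S.three_le
  have hspan := S.succ_eq_span hv hv0
  have hXv : X v ∈ ℒ k := S.X_mem hv (by omega)
  obtain ⟨ρ, hρ⟩ := exists_eq_smul_of_eq_span hspan (S.Y_mem hXv rfl)
  obtain ⟨σ, hσ⟩ := exists_eq_smul_of_eq_span hspan (S.X_mem hXv rfl)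
  refine ⟨ρ, ?_, hρ⟩
  rintro rfl
  have hu0 : X v + σ • Y v ≠ 0 := fun h => one_ne_zero
    (LinearIndependent.pair_iff.1 (S.linearIndependent_X_Y hv hv0) 1 σ (by rw [one_smul, h])).1
  refine hk1 (S.succ_eq_bot_of_X_Y_eq_zero (by omega)
    ((ℒ k).add_mem hXv ((ℒ k).smul_mem σ (S.Y_mem hv (by omega)))) hu0 ?_ ?_)
  · rw [map_add, map_smul, hσ, add_self_eq_zero_of_charTwo F]
  · rw [map_add, map_smul, hρ, S.Y_Y, smul_zero, zero_smul, add_zero]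

theorem X_eq_zero_of_last (S : IsFrame ℒ k q x y) {e : ℕ} (he : 3 ≤ e) (hq : q = 2 ^ e) {t n : ℕ}
    (hk : k = t + 2 + n) (ht : q ≤ t) (htn : ¬ IsCentralizedBy ℒ y t) {τ : L} (hτ : τ ∈ ℒ t)
    (hτ0 : τ ≠ 0) (hn : q / 2 ≤ n + 1) (hXv : X ((X ^ n) (Y τ)) ≠ 0) : X τ = 0 := by
  have hq8 := eight_le_of_eq_two_pow he hq
  have hYτ := S.Y_ne_zero_of_not_isCentralizedBy (by omega) (by omega) htn hτ hτ0
  obtain ⟨c, hc⟩ := S.exists_eq_smul (by omega) (by omega) (S.Y_mem hτ rfl) hYτ (S.X_mem hτ rfl)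
  obtain ⟨μ, _, hμτ⟩ := S.exists_X_pow_eq (i := t - (q / 2 - 1)) (by omega) (q / 2 - 1)
    (by omega) (by omega) hτ fun l h1 h2 =>
      S.isCentralizedBy_of_lt_add_half he hq ht (by omega) htn h2 (by omega)
  have hzero : (X ^ (n + 1 + 1 + (q / 2 - 1))) μ = 0 := by
    have hq2 : 2 ∣ q := hq ▸ dvd_pow_self 2 (by omega)
    exact S.X_pow_eq_zero hq (by omega) μ
  rw [← pow_apply_pow, hμτ, ← pow_apply_apply, hc, map_smul, ← apply_pow, smul_eq_zero] at hzero
  rw [hc, hzero.resolve_right hXv, zero_smul]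

theorem not_odd_of_last (S : IsFrame ℒ k q x y) {e : ℕ} (he : 3 ≤ e) (hq : q = 2 ^ e)
    {t n : ℕ} (hk : k = t + 2 + n) (ht : q ≤ t) (htn : ¬ IsCentralizedBy ℒ y t) {τ : L}
    (hτ : τ ∈ ℒ t) (hXτ : X τ = 0) (hn : n + 4 ≤ q) (hYX : Y (X ((X ^ n) (Y τ))) ≠ 0) :
    ¬ Odd n := by
  intro hodd
  have hq8 := eight_le_of_eq_two_pow he hq
  have hcent : ∀ l, l < t → t ≤ l + 1 → IsCentralizedBy ℒ y l := fun l h1 h2 =>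
    S.isCentralizedBy_of_lt_add_half he hq ht (by omega) htn h1 (by omega)
  obtain ⟨μ, hμ, hμτ⟩ := S.exists_X_pow_eq (i := t - 1) (by omega) 1 (by omega) (by omega) hτ
    fun l h1 h2 => hcent l h2 (by omega)
  have hYμ : Y μ = 0 := hcent _ (by omega) (by omega) _ hμ
  have hzero : Y ⁅μ, (X ^ (n + 2)) y⁆ = 0 := by
    rw [derY, S.Y_X_pow_y (by omega), hYμ, zero_lie, lie_zero, add_zero]
  have hcast : ((n + 2 : ℕ) : F) = 1 := by
    rw [CharTwo.natCast_eq_ite,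
      if_neg (Nat.not_even_iff_odd.2 (by simpa [parity_simps] using hodd))]
  rw [derX.lie_pow_eq_single 1, lie_y F, hμτ, map_smul, Nat.choose_one_right, hcast, one_smul,
    show n + 2 - 1 = n + 1 by omega, ← apply_pow] at hzero
  · exact hYX hzero
  · intro l hl hl1
    rcases Nat.lt_or_gt_of_ne hl1 with h | h
    · rw [Nat.lt_one_iff.1 h, lie_y F, pow_zero, Module.End.one_apply, hYμ]
    · obtain ⟨j, rfl⟩ : ∃ j, l = j + 1 + 1 := ⟨l - 2, by omega⟩
      rw [← pow_apply_pow, hμτ, ← pow_apply_apply, hXτ, map_zero, zero_lie]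

theorem Y_X_pow_Y_eq_zero_of_last (S : IsFrame ℒ k q x y) {e : ℕ} (hq : q = 2 ^ e) {t n : ℕ}
    (hk : k = t + 2 + n) (hn : q ≤ n + 3) {A v : L} (hA : A ∈ ℒ (t + 1))
    (hv : (X ^ n) A = v) (hv0 : v ≠ 0)
    (hbt : ∀ i, t < i → i + 1 < k → IsCentralizedBy ℒ y i) {ρ : F} (hρ0 : ρ ≠ 0)
    (hρ : Y (X v) = ρ • X (Y v)) {a : ℕ} (ha : a + 3 ≤ q) : Y ((X ^ a) (Y v)) = 0 := by
  have hvm : v ∈ ℒ (k - 1) := hv ▸ S.X_pow_mem n hA (by omega)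
  induction a using Nat.strong_induction_on with
  | _ a ih =>
  rcases Nat.eq_zero_or_pos a with rfl | hapos
  · exact S.Y_Y v
  obtain ⟨m, hm⟩ : ∃ m, q = 2 + a + m := ⟨q - 2 - a, by omega⟩
  have hum : (X ^ (n - m)) A ∈ ℒ (t + 1 + (n - m)) := S.X_pow_mem _ hA rfl
  have huv : (X ^ m) ((X ^ (n - m)) A) = v := by
    rw [pow_apply_pow, Nat.add_sub_of_le (by omega), hv]
  set u := (X ^ (n - m)) A
  have hun : ∀ l < m, Y ((X ^ l) u) = 0 := fun l hl =>
    hbt (t + 1 + (n - m) + l) (by omega) (by omega) _ (S.X_pow_mem l hum rfl)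
  obtain ⟨σ, hσ⟩ := exists_eq_smul_of_eq_span (S.succ_eq_span hvm hv0)
    (S.X_mem (S.X_mem hvm (by omega)) rfl)
  have hzero : Y ⁅u, (X ^ (q - 2)) y⁆ = 0 := by
    rw [derY, S.Y_X_pow_y (by omega), show Y u = 0 from hun 0 (by omega), zero_lie,
      lie_zero, add_zero]
  rw [derX.lie_pow_eq_pair m] at hzero
  · have hcoeff : ((m : F) + 1) + ((m : F) + 2) * ρ ≠ 0 := by
      have h2 : (2 : F) = 0 := CharTwo.two_eq_zero
      rw [CharTwo.natCast_eq_ite]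
      split_ifs
      · simpa only [zero_add, h2, zero_mul, add_zero] using one_ne_zero
      · simpa only [CharTwo.add_self_eq_zero, h2, zero_add, add_zero, one_mul] using hρ0
    rw [lie_y F, lie_y F, ← apply_pow, huv, hρ, show q - 2 - m = a by omega,
      show q - 2 - (m + 1) = a - 1 by omega, map_smul, pow_apply_apply, Nat.sub_add_cancel hapos,
      hq, cast_choose_pow_sub_two 2 (by omega), cast_choose_pow_sub_two 2 (by omega), smul_smul,
      ← add_smul, map_smul] at hzero
    refine (smul_eq_zero.1 hzero).resolve_left ?_
    simpa only [CharTwo.neg_eq, one_pow, one_mul, Nat.cast_succ, add_assoc, one_add_one_eq_two]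
      using hcoeff
  · intro l hl hlm hlm1
    rw [lie_y F]
    rcases Nat.lt_or_gt_of_ne hlm with h | h
    · exact hun l h
    · obtain ⟨j, rfl⟩ : ∃ j, l = j + 1 + 1 + m := ⟨l - 2 - m, by omega⟩
      rw [← pow_apply_pow, huv, ← pow_apply_apply, ← pow_apply_apply, hσ, map_smul, map_smul,
        pow_apply_apply, ih (j + 1) (by omega) (by omega), smul_zero]

theorem exists_t_add_eq (S : IsFrame ℒ k q x y) {e : ℕ} (he : 3 ≤ e) (hq : q = 2 ^ e) {t n : ℕ}
    (hk : k = t + 2 + n) (ht : q ≤ t) (htn : ¬ IsCentralizedBy ℒ y t)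
    (hbt : ∀ i, t < i → i < k - 1 → IsCentralizedBy ℒ y i) {τ : L} (hτ : τ ∈ ℒ t) (hXτ : X τ = 0)
    (hn : n + 2 ≤ q) (hYX : Y (X ((X ^ n) (Y τ))) ≠ 0) :
    ∃ d, (d = 1 ∨ d = 2) ∧ t + q + 1 = k + d := by
  rcases S.eq_add_or_add_two_pow_eq_add he hq ht (by omega) (by omega) htn
    S.not_isCentralizedBy_pred hbt with h | ⟨b, hb, h⟩
  · omega
  refine ⟨2 ^ b, ?_, by omega⟩
  suffices hb1 : b ≤ 1 by interval_cases b <;> simp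
  by_contra hb2
  have hb4 : 2 ^ 2 ∣ 2 ^ b := pow_dvd_pow 2 (by omega)
  have hq4 : 2 ^ 2 ∣ q := hq ▸ pow_dvd_pow 2 (by omega)
  refine S.not_odd_of_last he hq hk ht htn hτ hXτ ?_ hYX (Nat.odd_iff.2 (by omega))
  have : 0 < 2 ^ b := by positivity
  omega

theorem exists_isTail (S : IsFrame ℒ k q x y) {e : ℕ} (he : 3 ≤ e) (hq : q = 2 ^ e)
    (hk1 : ℒ (k + 1) ≠ ⊥) : ∃ d t τ v, ∃ ρ : F, IsTail ℒ k q x y e d t τ v ρ := by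
  have hq8 := eight_le_of_eq_two_pow he hq
  have hqk := S.add_two_le
  obtain ⟨t, ht, htk, htn, hbt⟩ :=
    exists_prev_not (s := k - 1) S.not_isCentralizedBy (by omega)
  obtain ⟨τ, hτ, hτ0⟩ := S.exists_ne_zero (i := t) (by omega) (by omega)
  have hYτ := S.Y_ne_zero_of_not_isCentralizedBy (by omega) (by omega) htn hτ hτ0
  obtain ⟨n, hk⟩ : ∃ n, k = t + 2 + n := ⟨k - 2 - t, by omega⟩
  have hvm : (X ^ n) (Y τ) ∈ ℒ (k - 1) := S.X_pow_mem n (S.Y_mem hτ rfl) (by omega)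
  have hv0 : (X ^ n) (Y τ) ≠ 0 := (S.add_lt_and_X_pow_ne_zero_of_isCentralizedBy (by omega)
    (by omega) (S.Y_mem hτ rfl) hYτ n fun j h1 h2 => hbt j (by omega) (by omega)).2
  have hspan := S.succ_eq_span hvm hv0
  obtain ⟨ρ, hρ0, hρ⟩ := S.exists_Y_X_eq_smul hvm hv0 hk1
  have hXv0 := S.X_last_ne_zero hvm hv0
  have hnq : n + 2 ≤ q := by
    by_contra h
    exact hXv0 (by rw [apply_pow]; exact S.X_pow_eq_zero hq (by omega) _)
  have hnq2 : q / 2 ≤ n + 1 := by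
    rcases S.eq_add_or_add_two_pow_eq_add he hq ht htk (by omega) htn
      S.not_isCentralizedBy_pred hbt with h | ⟨b, hb, h⟩
    · omega
    · have := two_pow_mul_two_le hq hb
      omega
  have hXτ := S.X_eq_zero_of_last he hq hk ht htn hτ hτ0 hnq2 hXv0
  obtain ⟨d, hd, htd⟩ := S.exists_t_add_eq he hq hk ht htn hbt hτ hXτ hnq
    (hρ ▸ smul_ne_zero hρ0 (ne_zero_of_eq_span hspan hk1))
  have hbt' : ∀ i, t < i → i + 1 < k → IsCentralizedBy ℒ y i := fun i h1 h2 =>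
    hbt i h1 (by omega)
  exact ⟨d, t, τ, _, ρ, S, he, hq, hd, ht, htd, hbt', hτ, hXτ, by congr 2; omega, hv0, hρ, hρ0,
    hspan, fun a ha => S.Y_X_pow_Y_eq_zero_of_last hq hk (by omega) (S.Y_mem hτ rfl) rfl hv0 hbt'
      hρ0 hρ ha⟩

end IsFrame

end Tails

section Neighbours

variable (ℒ x y) in
/-- `p` and `p + 1 + n` are consecutive degrees not centralized by `y`, as witnessed by the element
`A` of degree `p`. In a thin algebra whose first two-step centralizers change in degree `q = 2 ^ e`,
only the lengths listed in `length_eq` occur. -/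
structure IsGap (q e p n : ℕ) (A : L) : Prop where
  mem : A ∈ ℒ p
  length_eq : n + 1 = q ∨ ∃ b < e, n + 1 + 2 ^ b = q
  Y_X_pow_Y : ∀ l < n, Y ((X ^ l) (Y A)) = 0
  Y_X_pow_Y_ne_zero : Y ((X ^ n) (Y A)) ≠ 0

namespace IsGap

variable {e p n : ℕ} {A : L}

theorem X_pow_Y_ne_zero (G : IsGap ℒ x y q e p n A) : (X ^ n) (Y A) ≠ 0 :=
  fun h => G.Y_X_pow_Y_ne_zero (by rw [h, map_zero])

theorem Y_ne_zero (G : IsGap ℒ x y q e p n A) : Y A ≠ 0 :=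
  fun h => G.X_pow_Y_ne_zero (by rw [h, map_zero])

theorem not_isCentralizedBy (G : IsGap ℒ x y q e p n A) : ¬ IsCentralizedBy ℒ y p :=
  fun h => G.Y_ne_zero (h A G.mem)

theorem length_lt (G : IsGap ℒ x y q e p n A) : n < q := by
  rcases G.length_eq with h | ⟨b, -, h⟩
  · omega
  · have := Nat.two_pow_pos b
    omega

theorem le_two_mul_length (G : IsGap ℒ x y q e p n A) (hq : q = 2 ^ e) : q ≤ 2 * (n + 1) := by
  rcases G.length_eq with h | ⟨b, hb, h⟩
  · omega
  · have := two_pow_mul_two_le hq hb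
    omega

theorem exists_X_eq_smul (G : IsGap ℒ x y q e p n A) (S : IsFrame ℒ k q x y) (hp : 1 ≤ p)
    (hpk : p + 1 < k) : ∃ c : F, X A = c • Y A :=
  S.exists_eq_smul (by omega) hpk (S.Y_mem G.mem rfl) G.Y_ne_zero (S.X_mem G.mem rfl)

theorem exists_X_pow_succ_Y_eq_smul (G : IsGap ℒ x y q e p n A) (S : IsFrame ℒ k q x y)
    (hp : p + 2 + n < k) : ∃ c : F, (X ^ (n + 1)) (Y A) = c • Y ((X ^ n) (Y A)) := by
  have hmem := S.X_pow_mem n (S.Y_mem G.mem rfl) rfl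
  rw [← apply_pow]
  exact S.exists_eq_smul (by omega) (by omega) (S.Y_mem hmem rfl) G.Y_X_pow_Y_ne_zero
    (S.X_mem hmem rfl)

theorem Y_lie_X_pow_Y (G : IsGap ℒ x y q e p n A) {j : ℕ} (hj : j < n) (u : L) :
    Y ⁅u, (X ^ j) (Y A)⁆ = ⁅Y u, (X ^ j) (Y A)⁆ := by
  rw [IsFrame.derY, G.Y_X_pow_Y j hj, lie_zero, add_zero]

end IsGap

namespace IsTail

variable {e d t : ℕ} {τ v : L} {ρ : F}

theorem eight_le (T : IsTail ℒ k q x y e d t τ v ρ) : 8 ≤ q :=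
  eight_le_of_eq_two_pow T.three_le_exponent T.q_eq

theorem eight_dvd (T : IsTail ℒ k q x y e d t τ v ρ) : 8 ∣ q :=
  T.q_eq ▸ pow_dvd_pow 2 T.three_le_exponent

theorem t_lt (T : IsTail ℒ k q x y e d t τ v ρ) : t + 1 < k := by
  have := T.eight_le
  have := T.t_add_eq
  rcases T.d_eq with h | h <;> omega

theorem v_mem (T : IsTail ℒ k q x y e d t τ v ρ) : v ∈ ℒ (k - 1) := by
  have := T.eight_le
  have := T.t_add_eq
  rw [← T.v_eq]
  exact T.X_pow_mem _ (T.Y_mem T.τ_mem rfl) (by rcases T.d_eq with h | h <;> omega)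

theorem Y_τ_ne_zero (T : IsTail ℒ k q x y e d t τ v ρ) : Y τ ≠ 0 :=
  fun h => T.v_ne_zero (by rw [← T.v_eq, h, map_zero])

theorem not_isCentralizedBy_t (T : IsTail ℒ k q x y e d t τ v ρ) : ¬ IsCentralizedBy ℒ y t :=
  fun h => T.Y_τ_ne_zero (h _ T.τ_mem)

theorem add_eq_span (T : IsTail ℒ k q x y e d t τ v ρ) {a : ℕ} (ha1 : 1 ≤ a) (ha : a + 2 ≤ q) :
    ℒ (k + a) = Submodule.span F {(X ^ a) (Y v)} := by
  obtain ⟨a, rfl⟩ := Nat.exists_eq_add_of_le' ha1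
  rw [← pow_apply_apply]
  refine T.eq_span_X_pow (by omega) a (by omega) T.succ_eq_span fun l hl => ?_
  rw [pow_apply_apply]
  exact T.Y_X_pow_Y_v _ (by omega)

theorem isCentralizedBy_of_gt_diamond (T : IsTail ℒ k q x y e d t τ v ρ) {i : ℕ} (hi : k < i)
    (hiq : i + 3 ≤ k + q) : IsCentralizedBy ℒ y i := by
  obtain ⟨a, rfl⟩ := Nat.exists_eq_add_of_lt hi
  exact isCentralizedBy_of_eq_span (T.add_eq_span (a := a + 1) (by omega) (by omega))
    (T.Y_X_pow_Y_v _ (by omega))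

theorem X_pow_Y_v_ne_zero (T : IsTail ℒ k q x y e d t τ v ρ) (hbig : ℒ (k + q / 2 + 1) ≠ ⊥)
    {a : ℕ} (ha : a ≤ q / 2 + 1) : (X ^ a) (Y v) ≠ 0 := by
  have := T.eight_le
  exact fun h => ne_zero_of_eq_span (T.add_eq_span (by omega) (by omega)) hbig
    (pow_apply_eq_zero_of_le h ha)

theorem Y_X_pow_Y_τ (T : IsTail ℒ k q x y e d t τ v ρ) {l : ℕ} (hl : l + d + 1 < q) :
    Y ((X ^ l) (Y τ)) = 0 :=
  T.isCentralizedBy_of_gt (t + 1 + l) (by omega) (by have := T.t_add_eq; omega) _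
    (T.X_pow_mem l (T.Y_mem T.τ_mem rfl) rfl)

theorem Y_v_ne_zero (T : IsTail ℒ k q x y e d t τ v ρ) : Y v ≠ 0 :=
  T.Y_last_ne_zero T.v_mem T.v_ne_zero

theorem eq_v_of_Y_eq (T : IsTail ℒ k q x y e d t τ v ρ) {u : L} (hu : u ∈ ℒ (k - 1))
    (h : Y u = Y v) : u = v := by
  have := T.add_two_le
  have := T.eight_le
  obtain ⟨a, rfl⟩ := T.exists_eq_smul (by omega) (by omega) T.v_mem T.v_ne_zero hu
  have h0 : (a - 1) • Y v = 0 := by rw [sub_smul, one_smul, ← map_smul, h, sub_self]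
  rw [sub_eq_zero.1 ((smul_eq_zero.1 h0).resolve_right T.Y_v_ne_zero), one_smul]

theorem exists_X_X_v_eq_smul (T : IsTail ℒ k q x y e d t τ v ρ) :
    ∃ σ : F, X (X v) = σ • X (Y v) :=
  exists_eq_smul_of_eq_span T.succ_eq_span
    (T.X_mem (T.X_mem T.v_mem (by have := T.add_two_le; omega)) rfl)

end IsTail

variable [CharP F 2]

theorem lie_X_pow_pred_y {e : ℕ} (hq : q = 2 ^ e) {u A : L} {i : ℕ}
    (hi : i + 1 ≤ q) (hu : (X ^ i) u = A) (hA : X A = 0) (h : ∀ l < i, Y ((X ^ l) u) = 0) :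
    ⁅u, (X ^ (q - 1)) y⁆ = (X ^ (q - 1 - i)) (Y A) := by
  rw [IsFrame.derX.lie_pow_eq_single i, IsFrame.lie_y F, hu, hq,
    cast_choose_pow_sub_one 2 (by omega)]
  · simp only [CharTwo.neg_eq, one_pow, one_smul]
  · rintro l - hli
    rw [IsFrame.lie_y F]
    rcases Nat.lt_or_gt_of_ne hli with hl | hl
    · exact h l hl
    · rw [pow_apply_eq_zero_of_apply_pow_eq_zero hu hA hl, map_zero]

theorem lie_Y_X_pow_pred_y {e : ℕ} (hq : q = 2 ^ e) {u A : L} {i : ℕ} (hi0 : 0 < i)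
    (hi : i + 1 ≤ q) (hu : (X ^ i) u = A) (hA : X A = 0) (h : ∀ l < i, Y ((X ^ l) u) = 0) :
    ⁅u, Y ((X ^ (q - 1)) y)⁆ = Y ((X ^ (q - 1 - i)) (Y A)) := by
  rw [← lie_X_pow_pred_y hq hi hu hA h, IsFrame.derY, show Y u = 0 from h 0 hi0, zero_lie, zero_add]

namespace IsFrame

theorem exists_X_pow_eq_of_not_isCentralizedBy (S : IsFrame ℒ k q x y) {e : ℕ} (he : 3 ≤ e)
    (hq : q = 2 ^ e) {p i : ℕ} {A : L} (hp : q ≤ p) (hpk : p < k)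
    (hpn : ¬ IsCentralizedBy ℒ y p) (hA : A ∈ ℒ p) (hi : i < q / 2) :
    ∃ κ ∈ ℒ (p - i), (X ^ i) κ = A ∧ ∀ l < i, Y ((X ^ l) κ) = 0 := by
  have hq8 := eight_le_of_eq_two_pow he hq
  have hcent : ∀ l, p - i ≤ l → l < p → IsCentralizedBy ℒ y l := fun l h1 h2 =>
    S.isCentralizedBy_of_lt_add_half he hq hp hpk hpn h2 (by omega)
  obtain ⟨κ, hκ, hκA⟩ := S.exists_X_pow_eq (i := p - i) (by omega) i (by omega) hpk hA hcent
  exact ⟨κ, hκ, hκA, fun l hl => hcent (p - i + l) (by omega) (by omega) _ (S.X_pow_mem l hκ rfl)⟩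

theorem exists_isGap_of_lt (S : IsFrame ℒ k q x y) {e : ℕ} (he : 3 ≤ e) (hq : q = 2 ^ e)
    {p t : ℕ} {A : L} (hp : q ≤ p) (hpt : p < t) (htk : t + 1 < k)
    (ht : ¬ IsCentralizedBy ℒ y t) (hA : A ∈ ℒ p) (hYA : Y A ≠ 0) :
    ∃ n, IsGap ℒ x y q e p n A ∧ p + 1 + n ≤ t ∧
      ∀ i, p < i → i < p + 1 + n → IsCentralizedBy ℒ y i := by
  have hq8 := eight_le_of_eq_two_pow he hq
  obtain ⟨s, hps, hst, hs, hbt⟩ := exists_next_not ht hpt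
  obtain ⟨n, rfl⟩ : ∃ n, s = p + 1 + n := ⟨s - p - 1, by omega⟩
  have hYm : Y A ∈ ℒ (p + 1) := S.Y_mem hA rfl
  have hne := (S.add_lt_and_X_pow_ne_zero_of_isCentralizedBy (by omega) (by omega) hYm hYA n
    fun j h1 h2 => hbt j (by omega) (by omega)).2
  refine ⟨n, ⟨hA, ?_, fun l hl => hbt (p + 1 + l) (by omega) (by omega) _ (S.X_pow_mem l hYm rfl),
    S.Y_ne_zero_of_not_isCentralizedBy (by omega) (by omega) hs (S.X_pow_mem n hYm rfl) hne⟩, hst,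
    hbt⟩
  rcases S.eq_add_or_add_two_pow_eq_add he hq hp hps (by omega) (fun h => hYA (h _ hA)) hs hbt with
    h | ⟨b, hb, h⟩
  · exact Or.inl (by omega)
  · exact Or.inr ⟨b, hb, by omega⟩

theorem exists_isGap_of_gt (S : IsFrame ℒ k q x y) {e : ℕ} (he : 3 ≤ e) (hq : q = 2 ^ e) {s : ℕ}
    {U : L} (hs : q < s) (hsk : s + 1 < k) (hU : U ∈ ℒ s) (hYU : Y U ≠ 0) :
    ∃ p n A, IsGap ℒ x y q e p n A ∧ q ≤ p ∧ p + 1 + n = s ∧ (X ^ n) (Y A) = U := by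
  have hq8 := eight_le_of_eq_two_pow he hq
  have hsn : ¬ IsCentralizedBy ℒ y s := fun h => hYU (h _ hU)
  obtain ⟨p, hqp, hps, hp, hbt⟩ := exists_prev_not S.not_isCentralizedBy hs
  obtain ⟨A, hA, hA0⟩ := S.exists_ne_zero (i := p) (by omega) (by omega)
  have hYA := S.Y_ne_zero_of_not_isCentralizedBy (by omega) (by omega) hp hA hA0
  obtain ⟨m, G, hms, _⟩ := S.exists_isGap_of_lt he hq hqp hps hsk hsn hA hYA
  obtain rfl : p + 1 + m = s := by
    by_contra h
    exact G.Y_X_pow_Y_ne_zero (hbt (p + 1 + m) (by omega) (by omega) _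
      (S.X_pow_mem m (S.Y_mem hA rfl) rfl))
  obtain ⟨a, rfl⟩ := S.exists_eq_smul (by omega) (by omega) (S.X_pow_mem m (S.Y_mem hA rfl) rfl)
    G.X_pow_Y_ne_zero hU
  refine ⟨p, m, a • A, ⟨(ℒ p).smul_mem a hA, G.length_eq, fun l hl => ?_, ?_⟩, hqp, rfl, ?_⟩
  · rw [map_smul, map_smul, map_smul, G.Y_X_pow_Y l hl, smul_zero]
  · rwa [map_smul, map_smul]
  · rw [map_smul, map_smul]

theorem X_eq_zero_of_isGap (S : IsFrame ℒ k q x y) {e : ℕ} (he : 3 ≤ e) (hq : q = 2 ^ e)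
    {p n : ℕ} {A : L} (hp : q ≤ p) (hpk : p + 1 < k) (G : IsGap ℒ x y q e p n A)
    (hn : q ≤ n + 2) : X A = 0 := by
  have hq8 := eight_le_of_eq_two_pow he hq
  obtain ⟨c, hc⟩ := G.exists_X_eq_smul S (by omega) hpk
  obtain ⟨κ, -, hκA, -⟩ := S.exists_X_pow_eq_of_not_isCentralizedBy he hq (i := 1) hp (by omega)
    G.not_isCentralizedBy G.mem (by omega)
  have hzero : (X ^ (n + 1 + 1)) κ = 0 := S.X_pow_eq_zero hq (by omega) κ
  rw [← pow_apply_pow, hκA, ← pow_apply_apply, hc, map_smul] at hzero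
  rw [hc, (smul_eq_zero.1 hzero).resolve_right G.X_pow_Y_ne_zero, zero_smul]

theorem X_pow_pred_Y_X_pow_pred_y (S : IsFrame ℒ k q x y) {e : ℕ} (hq : q = 2 ^ e) :
    (X ^ (q - 1)) (Y ((X ^ (q - 1)) y)) = 0 := by
  have hw := S.X_X_pow_pred_y
  have h2 := S.two_lt
  have h := lie_X_pow_pred_y (y := y) (u := (X ^ (q - 1)) y) (i := 0) hq (by omega) rfl hw
    (fun l hl => absurd hl l.not_lt_zero)
  rw [lie_self] at h
  exact h.symm

end IsFrame

namespace IsTail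

variable {e d t : ℕ} {τ v : L} {ρ : F}

theorem lie_X_pow_pred_y_of_X_pow_eq_v (T : IsTail ℒ k q x y e d t τ v ρ) {u : L} {m : ℕ}
    (hm : m + 2 ≤ q) (hm0 : 1 ≤ m ∨ X (X v) = 0) (hu : (X ^ m) u = v)
    (h : ∀ l < m, Y ((X ^ l) u) = 0) :
    ⁅u, (X ^ (q - 1)) y⁆ = (1 + ρ) • (X ^ (q - 1 - m)) (Y v) := by
  obtain ⟨σ, hσ⟩ := T.exists_X_X_v_eq_smul
  have hq := T.q_eq
  rw [IsFrame.derX.lie_pow_eq_pair m]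
  · rw [hu, ← apply_pow, hu, IsFrame.lie_y F, IsFrame.lie_y F, T.Y_X_v, map_smul, pow_apply_apply,
      show q - 1 - (m + 1) + 1 = q - 1 - m by omega, hq, cast_choose_pow_sub_one 2 (by omega),
      cast_choose_pow_sub_one 2 (by omega)]
    simp only [CharTwo.neg_eq, one_pow, one_smul, add_smul]
  · intro l hl hlm hlm1
    rw [IsFrame.lie_y F]
    rcases Nat.lt_or_gt_of_ne hlm with h' | h'
    · exact h l h'
    obtain ⟨j, rfl⟩ : ∃ j, l = j + 1 + 1 + m := ⟨l - 2 - m, by omega⟩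
    rw [← pow_apply_pow, hu, ← pow_apply_apply, ← pow_apply_apply]
    rcases hm0 with hm0 | hm0
    · rw [hσ, map_smul, map_smul, pow_apply_apply, T.Y_X_pow_Y_v _ (by omega), smul_zero]
    · rw [hm0, map_zero, map_zero]

end IsTail

end Neighbours

section SecondGapTwo

theorem cast_choose_two_pow_sub_half (R : Type*) [CommRing R] [CharP R 2] {e b s : ℕ}
    (hb : b < e) (hs : s < 2 ^ b) :
    ((2 ^ e - 2 ^ b).choose (2 ^ e / 2 - 2 ^ b + s) : R) = if s = 0 then 1 else 0 := by
  have hpos : 0 < 2 ^ (e - b - 1) := by positivity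
  have hexp : 2 ^ e / 2 - 2 ^ b = 2 ^ b * (2 ^ (e - b - 1) - 1) := by
    rw [Nat.mul_sub, ← pow_add, mul_one, show b + (e - b - 1) = e - 1 by omega,
      ← Nat.pow_div (by omega) two_pos, pow_one]
  have hlt : 2 ^ (e - b - 1) - 1 < 2 ^ (e - b) := by
    have := Nat.pow_le_pow_right two_pos (Nat.sub_le (e - b) 1)
    omega
  have h := cast_choose_pow_sub_pow_add (R := R) 2 (r := 0) hb.le hlt (by positivity) hs
  rw [add_zero] at h
  rw [hexp, h, CharTwo.neg_eq, one_pow, one_mul]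
  rcases s with _ | s <;> simp

theorem choose_sum_eq_one {R : Type*} [CommRing R] [CharP R 2] {b e N : ℕ} {ρ : R} (hb0 : b ≠ 0)
    (hb : b < e) (hN : N + 3 = 2 ^ e) :
    (N.choose (2 ^ b) + ρ * N.choose (2 ^ b - 1) + (1 + ρ) * N.choose (2 ^ b - 2) : R) = 1 := by
  rcases Nat.lt_or_ge b 2 with hb' | hb'
  · obtain rfl : b = 1 := by omega
    have he4 : 2 ^ 2 ≤ 2 ^ e := Nat.pow_le_pow_right two_pos hb
    have hchoose : ∀ s < 2 ^ 2, (N.choose s : R) = Nat.choose 1 s := fun s hs => by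
      have := cast_choose_pow_sub_pow_add (R := R) 2 (e := e) (b := 2) (m := 0) (r := 1) hb
        (by positivity) (by norm_num) hs
      rwa [mul_zero, zero_add, pow_zero, one_mul, show 2 ^ e - 2 ^ 2 + 1 = N by omega] at this
    rw [hchoose _ (by norm_num), hchoose _ (by norm_num), hchoose _ (by norm_num)]
    have := CharTwo.add_self_eq_zero ρ
    norm_num
    linear_combination this
  · have hb4 : 2 ^ 2 ≤ 2 ^ b := Nat.pow_le_pow_right two_pos hb'
    have hbe : 2 ^ b ≤ 2 ^ e := Nat.pow_le_pow_right two_pos hb.le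
    have hchoose : ∀ i < 2 ^ (e - b), ∀ s < 2 ^ b,
        (N.choose (2 ^ b * i + s) : R) = (2 ^ b - 3).choose s := fun i hi s hs => by
      have := cast_choose_pow_sub_pow_add (R := R) 2 (r := 2 ^ b - 3) hb.le hi (by omega) hs
      rwa [CharTwo.neg_eq, one_pow, one_mul, show 2 ^ e - 2 ^ b + (2 ^ b - 3) = N by omega]
        at this
    have hhigh : ∀ s < 2 ^ b, 2 ^ b - 3 < s → (N.choose s : R) = 0 := fun s hs hs' => by
      have := hchoose 0 (by positivity) s hs
      rwa [mul_zero, zero_add, Nat.choose_eq_zero_of_lt hs', Nat.cast_zero] at this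
    have hone := hchoose 1 (Nat.one_lt_two_pow (by omega)) 0 (by omega)
    rw [mul_one, add_zero, Nat.choose_zero_right, Nat.cast_one] at hone
    rw [hone, hhigh _ (by omega) (by omega), hhigh _ (by omega) (by omega), mul_zero, mul_zero,
      add_zero, add_zero]

variable [CharP F 2]

namespace IsTail

variable {e t : ℕ} {τ v : L} {ρ : F}

theorem lie_τ_Y_X_pow_pred_y (T : IsTail ℒ k q x y e 2 t τ v ρ) :
    ⁅τ, Y ((X ^ (q - 1)) y)⁆ = (1 + ρ) • (X ^ 2) (Y v) := by
  have hq8 := T.eight_le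
  obtain ⟨σ, hσ⟩ := T.exists_X_X_v_eq_smul
  have hv : (X ^ (q - 3)) (Y τ) = v := T.v_eq
  have hτ : ⁅τ, (X ^ (q - 1)) y⁆ = σ • X (Y v) := by
    rw [lie_X_pow_pred_y T.q_eq (i := 0) (by omega) rfl T.X_τ (by simp), pow_zero,
      Module.End.one_apply, ← hσ, ← hv, apply_pow, apply_pow,
      show q - 3 + 1 + 1 = q - 1 - 0 by omega]
  have hYτ : ⁅Y τ, (X ^ (q - 1)) y⁆ = (1 + ρ) • (X ^ 2) (Y v) := by
    rw [T.lie_X_pow_pred_y_of_X_pow_eq_v (m := q - 3) (by omega) (by left; omega) hv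
      fun l hl => T.Y_X_pow_Y_τ (by omega), show q - 1 - (q - 3) = 2 by omega]
  have hYX : Y (X (Y v)) = 0 := by simpa using T.Y_X_pow_Y_v 1 (by omega)
  have h := (IsFrame.derY : IsDerivation Y) τ ((X ^ (q - 1)) y)
  rw [hτ, map_smul, hYX, smul_zero, hYτ] at h
  exact (eq_of_add_eq_zero_of_charTwo F h.symm).symm

theorem lie_X_pow_Y_X_pow_pred_y (T : IsTail ℒ k q x y e 2 t τ v ρ) {κ : L} {m : ℕ}
    (hm : m + 3 ≤ q) (hκ : (X ^ (m + 2)) κ = τ) (h : ∀ l < m + 2, Y ((X ^ l) κ) = 0) (a : ℕ) :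
    ⁅κ, (X ^ (m + a)) (Y ((X ^ (q - 1)) y))⁆ =
      ((m + a).choose m + ρ * (m + a).choose (m + 1) + (1 + ρ) * (m + a).choose (m + 2) : F) •
        (X ^ a) (Y v) := by
  have hq8 := T.eight_le
  have hv : (X ^ (q - 3)) (Y τ) = v := T.v_eq
  have hlie : ∀ l < m + 2, ⁅(X ^ l) κ, Y ((X ^ (q - 1)) y)⁆ =
      Y ((X ^ (q - 1 - (m + 2 - l))) (Y τ)) := fun l hl =>
    lie_Y_X_pow_pred_y T.q_eq (by omega) (by omega)
      (by rw [pow_apply_pow, Nat.sub_add_cancel hl.le, hκ]) T.X_τ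
      fun j hj => by rw [pow_apply_pow]; exact h _ (by omega)
  have h0 : ⁅(X ^ m) κ, Y ((X ^ (q - 1)) y)⁆ = Y v := by
    rw [hlie m (by omega), ← hv, show q - 1 - (m + 2 - m) = q - 3 by omega]
  have h1 : ⁅(X ^ (m + 1)) κ, Y ((X ^ (q - 1)) y)⁆ = ρ • X (Y v) := by
    rw [hlie _ (by omega), ← T.Y_X_v, ← hv, apply_pow,
      show q - 1 - (m + 2 - (m + 1)) = q - 3 + 1 by omega]
  have h2 : ⁅(X ^ (m + 2)) κ, Y ((X ^ (q - 1)) y)⁆ = (1 + ρ) • (X ^ 2) (Y v) := by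
    rw [hκ, T.lie_τ_Y_X_pow_pred_y]
  rw [IsFrame.derX.lie_pow_eq_sum {m, m + 1, m + 2}]
  · rw [Finset.sum_insert (by simp), Finset.sum_pair (by simp), h0, h1, h2, map_smul, map_smul,
      pow_apply_apply, pow_apply_pow]
    match a with
    | 0 => simp [Nat.choose_eq_zero_of_lt]
    | 1 =>
      simp only [Nat.choose_succ_self, Nat.choose_self, Nat.choose_succ_self_right]
      simp
      module
    | a + 2 =>
      rw [show m + (a + 2) - (m + 1) + 1 = a + 2 by omega,
        show m + (a + 2) - (m + 2) + 2 = a + 2 by omega, Nat.add_sub_cancel_left]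
      module
  · intro l _ hls
    simp only [Finset.mem_insert, Finset.mem_singleton, not_or] at hls
    rcases Nat.lt_or_ge l m with hlm | hlm
    · rw [hlie l (by omega)]
      exact T.Y_X_pow_Y_τ (by omega)
    · rw [pow_apply_eq_zero_of_apply_pow_eq_zero hκ T.X_τ (by omega), zero_lie]

theorem choose_sum_eq_zero_of_isGap (T : IsTail ℒ k q x y e 2 t τ v ρ)
    (hbig : ℒ (k + q / 2 + 1) ≠ ⊥) {n : ℕ} (G : IsGap ℒ x y q e q n ((X ^ (q - 1)) y))
    (hnt : q + 1 + n ≤ t) {m : ℕ} (hm : m + 2 < q / 2) (hn : n + 3 ≤ q + m)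
    (hm' : n ≤ q / 2 + m) :
    ((n + 1).choose m + ρ * (n + 1).choose (m + 1) + (1 + ρ) * (n + 1).choose (m + 2) : F) = 0 := by
  have hq8 := T.eight_le
  have htk := T.t_lt
  have hnq := G.le_two_mul_length T.q_eq
  obtain ⟨κ, -, hκ, hYκ⟩ := T.exists_X_pow_eq_of_not_isCentralizedBy T.three_le_exponent T.q_eq
    T.q_le (by omega) T.not_isCentralizedBy_t T.τ_mem hm
  obtain ⟨c, hc⟩ := G.exists_X_pow_succ_Y_eq_smul T.toIsFrame (by omega)
  have hκ0 : Y κ = 0 := hYκ 0 (by omega)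
  have hlie := T.lie_X_pow_Y_X_pow_pred_y (by omega) hκ hYκ
  have hzero : ⁅κ, Y ((X ^ n) (Y ((X ^ (q - 1)) y)))⁆ = 0 := by
    have h := (IsFrame.derY : IsDerivation Y) κ ((X ^ n) (Y ((X ^ (q - 1)) y)))
    obtain ⟨a, rfl⟩ : ∃ a, n = m + a := ⟨n - m, by omega⟩
    rwa [hκ0, zero_lie, zero_add, hlie, map_smul, T.Y_X_pow_Y_v _ (by omega), smul_zero,
      eq_comm] at h
  have h := hlie (n + 1 - m)
  rw [show m + (n + 1 - m) = n + 1 by omega, hc, lie_smul, hzero, smul_zero] at h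
  exact (smul_eq_zero.1 h.symm).resolve_right (T.X_pow_Y_v_ne_zero hbig (by omega))

theorem add_two_eq_of_isGap (T : IsTail ℒ k q x y e 2 t τ v ρ)
    (hbig : ℒ (k + q / 2 + 1) ≠ ⊥) {n : ℕ} (G : IsGap ℒ x y q e q n ((X ^ (q - 1)) y))
    (hnt : q + 1 + n ≤ t) : n + 2 = q := by
  have hq8 := T.eight_le
  have hqd := T.eight_dvd
  rcases G.length_eq with h | ⟨b, hb, h⟩
  · refine absurd ?_ G.X_pow_Y_ne_zero
    rw [show n = q - 1 by omega, T.X_pow_pred_Y_X_pow_pred_y T.q_eq]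
  have hb2 := two_pow_mul_two_le T.q_eq hb
  match b with
  | 0 => omega
  | 1 =>
    have h0 := T.choose_sum_eq_zero_of_isGap hbig G hnt (m := q / 2 - 3) (by omega) (by omega)
      (by omega)
    have hodd : Odd (q / 2 - 3) := by
      rw [Nat.odd_iff]
      omega
    have hcast : ((q / 2 - 3 : ℕ) : F) = 1 := by
      rw [CharTwo.natCast_eq_ite, if_neg (Nat.not_even_iff_odd.2 hodd)]
    have hqe := T.q_eq
    rw [show n + 1 = 2 ^ e - 2 by omega, cast_choose_pow_sub_two 2 (by omega),
      cast_choose_pow_sub_two 2 (by omega), cast_choose_pow_sub_two 2 (by omega)] at h0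
    refine absurd ?_ T.ρ_ne_zero
    have h2 : (2 : F) = 0 := CharTwo.two_eq_zero
    simp only [CharTwo.neg_eq, one_pow, Nat.cast_add, hcast, Nat.cast_one, Nat.cast_ofNat, h2,
      CharTwo.add_self_eq_zero, add_zero, zero_add, mul_zero, mul_one] at h0
    exact h0
  | b + 2 =>
    have hb4 : 2 ^ 2 ≤ 2 ^ (b + 2) := Nat.pow_le_pow_right two_pos (by omega)
    have h0 := T.choose_sum_eq_zero_of_isGap hbig G hnt (m := q / 2 - 2 ^ (b + 2)) (by omega)
      (by omega) (by omega)
    have hchoose : ∀ s < 3, ((n + 1).choose (q / 2 - 2 ^ (b + 2) + s) : F) =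
        if s = 0 then 1 else 0 :=
      fun s hs => by
        rw [show n + 1 = q - 2 ^ (b + 2) by omega, T.q_eq]
        exact cast_choose_two_pow_sub_half F hb (by omega)
    have hc0 := hchoose 0 (by omega)
    rw [add_zero] at hc0
    rw [hc0, hchoose 1 (by omega), hchoose 2 (by omega)] at h0
    simp at h0

theorem succ_ne_of_isGap (T : IsTail ℒ k q x y e 2 t τ v ρ) {m p : ℕ} {A : L}
    (G : IsGap ℒ x y q e q (q - 2) ((X ^ (q - 1)) y)) (hp : q ≤ p) (hpt : p < t)
    (G' : IsGap ℒ x y q e p m A) (hA : (X ^ m) (Y A) = τ) : m + 1 ≠ q := by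
  intro hm
  have hq8 := T.eight_le
  have htk := T.t_lt
  have hX := T.X_eq_zero_of_isGap T.three_le_exponent T.q_eq hp (by omega) G' (by omega)
  have hE : ⁅A, Y ((X ^ (q - 1)) y)⁆ = 0 := by
    have h1 := (IsFrame.derY : IsDerivation Y) A ((X ^ (q - 1)) y)
    rw [lie_X_pow_pred_y T.q_eq (i := 0) (by omega) rfl hX (by simp),
      lie_X_pow_pred_y T.q_eq (i := m) (by omega) hA T.X_τ G'.Y_X_pow_Y, pow_zero,
      Module.End.one_apply, show q - 1 - 0 = m by omega, show q - 1 - m = 0 by omega, hA, pow_zero,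
      Module.End.one_apply, left_eq_add] at h1
    exact h1
  have h := G.Y_lie_X_pow_Y (j := q - 3) (by omega) A
  obtain ⟨m, rfl⟩ := Nat.exists_eq_add_of_le' (show 2 ≤ m by omega)
  rw [IsFrame.derX.lie_pow_apply_of_apply_eq_zero hX, hE, map_zero, map_zero,
    show q - 3 = m + 0 by omega, T.lie_X_pow_Y_X_pow_pred_y (by omega) hA G'.Y_X_pow_Y] at h
  exact T.Y_v_ne_zero (by simpa [Nat.choose_eq_zero_of_lt] using h.symm)

theorem add_two_ne_of_isGap (T : IsTail ℒ k q x y e 2 t τ v ρ) (hbig : ℒ (k + q / 2 + 1) ≠ ⊥)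
    {m p : ℕ} {A : L} (G : IsGap ℒ x y q e q (q - 2) ((X ^ (q - 1)) y)) (hp : q ≤ p)
    (hpt : p + 1 + m = t) (G' : IsGap ℒ x y q e p m A) (hA : (X ^ m) (Y A) = τ) : m + 2 ≠ q := by
  intro hm
  have hq8 := T.eight_le
  have hte := T.t_add_eq
  have hX := T.X_eq_zero_of_isGap T.three_le_exponent T.q_eq hp (by omega) G' (by omega)
  have hXpow := (IsFrame.derX : IsDerivation X).lie_pow_apply_of_apply_eq_zero hX
  obtain ⟨m, rfl⟩ := Nat.exists_eq_add_of_le' (show 2 ≤ m by omega)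
  obtain rfl : q = m + 4 := by omega
  have hlie := T.lie_X_pow_Y_X_pow_pred_y (by omega) hA G'.Y_X_pow_Y
  have hYE : Y ((X ^ (m + 4 - 1)) y) ∈ ℒ (m + 4 + 1) := T.Y_mem T.X_pow_pred_y_mem rfl
  have hv : ⁅A, (X ^ m) (Y ((X ^ (m + 4 - 1)) y))⁆ = v := by
    refine T.eq_v_of_Y_eq (T.lie_mem G'.mem (T.X_pow_mem _ hYE rfl) (by omega)) ?_
    rw [G.Y_lie_X_pow_Y (by omega)]
    exact (hlie 0).trans (by simp [Nat.choose_eq_zero_of_lt])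
  have hodd : ((m + 1 : ℕ) : F) = 1 := by
    have := T.eight_dvd
    rw [CharTwo.natCast_eq_ite, if_neg (by rw [Nat.even_iff]; omega)]
  have h := G.Y_lie_X_pow_Y (j := m + 1) (by omega) A
  rw [hXpow, ← apply_pow, ← hXpow, hv, T.Y_X_v, hlie 1, Nat.choose_self, Nat.choose_succ_self_right,
    Nat.choose_succ_self, hodd, pow_one] at h
  have hzero : X (Y v) = 0 := by
    simpa [add_smul] using h
  exact T.X_pow_Y_v_ne_zero hbig (a := 1) (by omega) hzero

theorem not_isGap (T : IsTail ℒ k q x y e 2 t τ v ρ) (hbig : ℒ (k + q / 2 + 1) ≠ ⊥)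
    {b m p : ℕ} {A : L} (G : IsGap ℒ x y q e q (q - 2) ((X ^ (q - 1)) y))
    (hpt : p + 1 + m = t) (hA : (X ^ m) (Y A) = τ) (hm : m + 1 + 2 ^ b = q) (hb0 : b ≠ 0)
    (hb : b < e) : ¬ IsGap ℒ x y q e p m A := by
  intro G'
  have hq8 := T.eight_le
  have hte := T.t_add_eq
  have hqm := G'.le_two_mul_length T.q_eq
  have hb2 : 2 ^ 1 ≤ 2 ^ b := Nat.pow_le_pow_right two_pos (by omega)
  obtain ⟨m, rfl⟩ := Nat.exists_eq_add_of_le' (show 2 ≤ m by omega)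
  have hE : Y ((X ^ (q - 1)) y) ∈ ℒ (q + 1) := T.Y_mem T.X_pow_pred_y_mem rfl
  have h := G.Y_lie_X_pow_Y (j := m + 2 ^ b) (by omega) A
  rw [T.isCentralizedBy_of_gt_diamond (i := k - 1 + 2 ^ b) (by omega) (by omega) _
      (T.lie_mem G'.mem (T.X_pow_mem _ hE rfl) (by omega)),
    T.lie_X_pow_Y_X_pow_pred_y (by omega) hA G'.Y_X_pow_Y] at h
  have h0 := (smul_eq_zero.1 h.symm).resolve_right (T.X_pow_Y_v_ne_zero hbig (by omega))
  rw [← Nat.choose_symm (show m ≤ m + 2 ^ b by omega),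
    ← Nat.choose_symm (show m + 1 ≤ m + 2 ^ b by omega),
    ← Nat.choose_symm (show m + 2 ≤ m + 2 ^ b by omega), Nat.add_sub_cancel_left,
    show m + 2 ^ b - (m + 1) = 2 ^ b - 1 by omega, show m + 2 ^ b - (m + 2) = 2 ^ b - 2 by omega]
    at h0
  rw [choose_sum_eq_one hb0 hb (by have := T.q_eq; omega)] at h0
  exact one_ne_zero h0

theorem eq_of_two (T : IsTail ℒ k q x y e 2 t τ v ρ) (hbig : ℒ (k + q / 2 + 1) ≠ ⊥) : t = q := by
  by_contra htq
  have he := T.three_le_exponent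
  have hqt : q < t := lt_of_le_of_ne T.q_le (Ne.symm htq)
  obtain ⟨n, G, hnt, -⟩ := T.exists_isGap_of_lt he T.q_eq le_rfl hqt T.t_lt T.not_isCentralizedBy_t
    T.X_pow_pred_y_mem T.Y_X_pow_pred_y_ne_zero
  obtain rfl : n = q - 2 := by
    have := T.add_two_eq_of_isGap hbig G hnt
    omega
  obtain ⟨p, m, A, G', hqp, hpt, hA⟩ :=
    T.exists_isGap_of_gt he T.q_eq hqt T.t_lt T.τ_mem T.Y_τ_ne_zero
  rcases G'.length_eq with h | ⟨b, hb, h⟩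
  · exact T.succ_ne_of_isGap G hqp (by omega) G' hA h
  · rcases eq_or_ne b 0 with rfl | hb0
    · exact T.add_two_ne_of_isGap hbig G hqp hpt G' hA h
    · exact T.not_isGap hbig G hpt hA h hb0 hb G'

end IsTail

end SecondGapTwo

section Opposites

variable (ℒ k x y) in
/-- For `A` of degree `p`, a string `κ, X κ, X² κ, …` whose only two brackets with `Y A` that can
be nonzero are the one in degree `k`, which is `Y v`, and the one in degree `k + 1`, which is
`c • X (Y v)`. -/
structure IsOppositeString (v : L) (p : ℕ) (A : L) (c : F) (m : ℕ) (κ : L) : Prop where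
  mem : ∃ j, j + m + p + 1 = k ∧ κ ∈ ℒ j
  Y_X_pow : ∀ l < m, Y ((X ^ l) κ) = 0
  lie_X_pow : ⁅(X ^ m) κ, Y A⁆ = Y v
  lie_X_pow_succ : ⁅(X ^ (m + 1)) κ, Y A⁆ = c • X (Y v)
  X_pow_add_two : (X ^ (m + 2)) κ = 0

variable (ℒ k q x y) in
/-- An element `U` centralized by `x` that detects `Y v` in its bracket with `Y A`, where `A` has
degree `p`; the degrees of `A` and `U` add up to `k - 1`. -/
structure IsLowOpposite (v : L) (p : ℕ) (A U : L) : Prop where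
  mem : ∃ s, s + p + 1 = k ∧ U ∈ ℒ s
  X_eq_zero : X U = 0
  Y_ne_zero : Y U ≠ 0
  lie_Y : ⁅U, Y A⁆ = Y v
  Y_X_pow_Y : ∀ l, l + 1 < q → Y ((X ^ l) (Y U)) = 0

variable (ℒ k x y) in
/-- An element `U` centralized by `x` whose preimages under `ad x` detect `Y v` in their bracket
with `Y A`, where `A` has degree `p`; the degrees of `A` and `U` add up to `k`. -/
structure IsHighOpposite (v : L) (p : ℕ) (A U : L) (c : F) : Prop where
  mem : ∃ s, s + p = k ∧ U ∈ ℒ s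
  X_eq_zero : X U = 0
  Y_ne_zero : Y U ≠ 0
  lie_Y : ⁅U, Y A⁆ = c • X (Y v)
  lie_Y_of_X_eq : ∀ j κ, j + p + 1 = k → κ ∈ ℒ j → X κ = U → ⁅κ, Y A⁆ = Y v

variable {e t p m n : ℕ} {τ v A B U κ : L} {ρ c : F}

theorem IsLowOpposite.isOppositeString (H : IsLowOpposite ℒ k q x y v p A U) {j : ℕ}
    (hj : j + m + p + 1 = k) (hκ : κ ∈ ℒ j) (hκU : (X ^ m) κ = U)
    (h : ∀ l < m, Y ((X ^ l) κ) = 0) : IsOppositeString ℒ k x y v p A (0 : F) m κ where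
  mem := ⟨j, hj, hκ⟩
  Y_X_pow := h
  lie_X_pow := hκU ▸ H.lie_Y
  lie_X_pow_succ := by rw [← apply_pow, hκU, H.X_eq_zero, zero_lie, zero_smul]
  X_pow_add_two := by rw [← apply_pow, ← apply_pow, hκU, H.X_eq_zero, map_zero]

theorem IsHighOpposite.isOppositeString (H : IsHighOpposite ℒ k x y v p A U c)
    (S : IsFrame ℒ k q x y) {j : ℕ} (hj : j + m + p + 1 = k) (hκ : κ ∈ ℒ j)
    (hκU : (X ^ (m + 1)) κ = U) (h : ∀ l < m, Y ((X ^ l) κ) = 0) :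
    IsOppositeString ℒ k x y v p A c m κ where
  mem := ⟨j, hj, hκ⟩
  Y_X_pow := h
  lie_X_pow := H.lie_Y_of_X_eq (j + m) _ hj (S.X_pow_mem m hκ rfl) (by rw [apply_pow, hκU])
  lie_X_pow_succ := hκU ▸ H.lie_Y
  X_pow_add_two := by rw [← apply_pow, hκU, H.X_eq_zero]

namespace IsTail

theorem k_eq (T : IsTail ℒ k q x y e 1 t τ v ρ) : k = t + q := by
  have := T.t_add_eq
  omega

theorem X_pow_Y_τ (T : IsTail ℒ k q x y e 1 t τ v ρ) : (X ^ (q - 2)) (Y τ) = v := T.v_eq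

theorem X_pow_pred_Y_τ (T : IsTail ℒ k q x y e 1 t τ v ρ) : (X ^ (q - 1)) (Y τ) = X v := by
  have := T.eight_le
  rw [← T.X_pow_Y_τ, apply_pow, show q - 2 + 1 = q - 1 by omega]

theorem exists_eq_smul_τ (T : IsTail ℒ k q x y e 1 t τ v ρ) {u : L} (hu : u ∈ ℒ t) :
    ∃ a : F, u = a • τ :=
  T.exists_eq_smul (by have := T.eight_le; have := T.q_le; omega) (by have := T.t_lt; omega) T.τ_mem
    (fun h => T.Y_τ_ne_zero (by rw [h, map_zero])) hu

theorem X_eq_zero_of_mem_t (T : IsTail ℒ k q x y e 1 t τ v ρ) {u : L} (hu : u ∈ ℒ t) : X u = 0 := by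
  obtain ⟨a, rfl⟩ := T.exists_eq_smul_τ hu
  rw [map_smul, T.X_τ, smul_zero]

theorem lie_Y_eq_zero (T : IsTail ℒ k q x y e 1 t τ v ρ) {i : ℕ} (hA : A ∈ ℒ p)
    (hκ : κ ∈ ℒ i) (hY : Y κ = 0) (ht : t < i + p) (hk : i + p + 1 < k) : ⁅κ, Y A⁆ = 0 := by
  have h := IsFrame.derY (F := F) (y := y) κ A
  rw [T.isCentralizedBy_of_gt _ ht hk _ (T.lie_mem hκ hA rfl), hY, zero_lie, zero_add] at h
  exact h.symm

end IsTail

variable [CharP F 2]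

theorem IsTail.lt_t (T : IsTail ℒ k q x y e 1 t τ v ρ) : q < t := by
  have := T.eight_le
  have := T.add_two_le
  refine lt_of_le_of_ne T.q_le ?_
  rintro rfl
  obtain ⟨a, ha⟩ := T.exists_eq_smul (by omega) (by omega) T.X_pow_pred_y_mem
    (fun h => T.Y_X_pow_pred_y_ne_zero (by rw [h, map_zero])) T.τ_mem
  refine T.X_last_ne_zero T.v_mem T.v_ne_zero ?_
  rw [← T.X_pow_pred_Y_τ, ha, map_smul, map_smul, T.X_pow_pred_Y_X_pow_pred_y T.q_eq, smul_zero]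

namespace IsOppositeString

theorem lie_X_pow_Y (R : IsOppositeString ℒ k x y v p A c m κ)
    (T : IsTail ℒ k q x y e 1 t τ v ρ) (hA : A ∈ ℒ p) (hm : m + 2 ≤ q) (a : ℕ) :
    ⁅κ, (X ^ (m + a)) (Y A)⁆ =
      ((m + a).choose m + c * (m + a).choose (m + 1) : F) • (X ^ a) (Y v) := by
  have hk := T.k_eq
  obtain ⟨j, hj, hκ⟩ := R.mem
  rw [IsFrame.derX.lie_pow_eq_pair m, R.lie_X_pow, R.lie_X_pow_succ, Nat.add_sub_cancel_left,
    map_smul, pow_apply_apply]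
  · rcases a with _ | a
    · simp
    · rw [show m + (a + 1) - (m + 1) + 1 = a + 1 by omega]
      module
  · intro l _ hlm hlm1
    rcases Nat.lt_or_gt_of_ne hlm with hl | hl
    · exact T.lie_Y_eq_zero hA (T.X_pow_mem l hκ rfl) (R.Y_X_pow l hl) (by omega) (by omega)
    · rw [pow_apply_eq_zero_of_le R.X_pow_add_two (by omega), zero_lie]

theorem lie_X_pow_Y_self (R : IsOppositeString ℒ k x y v p A c m κ)
    (T : IsTail ℒ k q x y e 1 t τ v ρ) (hA : A ∈ ℒ p) (hm : m + 2 ≤ q) :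
    ⁅κ, (X ^ m) (Y A)⁆ = Y v := by
  simpa using R.lie_X_pow_Y T hA hm 0

theorem choose_add_choose_eq_zero (R : IsOppositeString ℒ k x y v p A c m κ)
    (T : IsTail ℒ k q x y e 1 t τ v ρ) (hbig : ℒ (k + q / 2 + 1) ≠ ⊥) (G : IsGap ℒ x y q e p n A)
    (hpk : p + 2 + n < k) (hY : ⁅Y κ, (X ^ n) (Y A)⁆ = 0) (hm : m + 2 ≤ q) (hmn : m ≤ n)
    (hnq : n + 3 ≤ q + m) (hnm : n ≤ m + q / 2) :
    ((n + 1).choose m + c * (n + 1).choose (m + 1) : F) = 0 := by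
  obtain ⟨d, hd⟩ := G.exists_X_pow_succ_Y_eq_smul T.toIsFrame hpk
  have hn := R.lie_X_pow_Y T G.mem hm (n - m)
  have hsucc := R.lie_X_pow_Y T G.mem hm (n + 1 - m)
  rw [Nat.add_sub_cancel' hmn] at hn
  rw [Nat.add_sub_cancel' (by omega), hd, lie_smul] at hsucc
  have hder := IsFrame.derY (F := F) (y := y) κ ((X ^ n) (Y A))
  rw [hn, map_smul, T.Y_X_pow_Y_v _ (by omega), smul_zero, hY, zero_add] at hder
  rw [← hder, smul_zero] at hsucc
  exact (smul_eq_zero.1 hsucc.symm).resolve_right (T.X_pow_Y_v_ne_zero hbig (by omega))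

theorem lie_eq_v (R : IsOppositeString ℒ k x y v p A c m (Y B)) (T : IsTail ℒ k q x y e 1 t τ v ρ)
    (hA : A ∈ ℒ p) {j : ℕ} (hB : B ∈ ℒ j) (hj : j + m + p + 2 = k) (hm : m + 2 ≤ q)
    (hYA : Y ((X ^ m) (Y A)) = 0) : ⁅B, (X ^ m) (Y A)⁆ = v := by
  refine T.eq_v_of_Y_eq (T.lie_mem hB (T.X_pow_mem m (T.Y_mem hA rfl) rfl) (by omega)) ?_
  rw [IsFrame.derY, hYA, lie_zero, add_zero, R.lie_X_pow_Y_self T hA hm]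

theorem lie_X_pow_succ_Y (R : IsOppositeString ℒ k x y v p A c m κ)
    (T : IsTail ℒ k q x y e 1 t τ v ρ) (hA : A ∈ ℒ p) (hm : m + 2 ≤ q) :
    ⁅κ, (X ^ (m + 1)) (Y A)⁆ = (m + 1 + c : F) • X (Y v) := by
  rw [R.lie_X_pow_Y T hA hm 1, Nat.choose_succ_self_right, Nat.choose_self, pow_one, Nat.cast_succ,
    Nat.cast_one, mul_one]

theorem ρ_eq (R : IsOppositeString ℒ k x y v p A c m (Y B)) (T : IsTail ℒ k q x y e 1 t τ v ρ)
    (hbig : ℒ (k + q / 2 + 1) ≠ ⊥) (hA : A ∈ ℒ p) {j : ℕ} (hB : B ∈ ℒ j)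
    (hj : j + m + p + 2 = k) (hm : m + 2 ≤ q) (hXB : ∃ d : F, X B = d • Y B)
    (hYA : Y ((X ^ m) (Y A)) = 0) (hYA' : Y ((X ^ (m + 1)) (Y A)) = 0) :
    ρ = m + 1 + c := by
  have hYB : ⁅Y B, (X ^ m) (Y A)⁆ = Y v := by
    rw [← R.lie_eq_v T hA hB hj hm hYA, IsFrame.derY, hYA, lie_zero, add_zero]
  obtain ⟨d, hd⟩ := hXB
  have hX := IsFrame.derX (F := F) (x := x) B ((X ^ m) (Y A))
  rw [R.lie_eq_v T hA hB hj hm hYA, hd, smul_lie, hYB, apply_pow] at hX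
  have hYX := congrArg Y hX
  rw [T.Y_X_v, map_add, map_smul, T.Y_Y, smul_zero, zero_add, IsFrame.derY, hYA', lie_zero,
    add_zero, R.lie_X_pow_succ_Y T hA hm] at hYX
  have hXYv : X (Y v) ≠ 0 := by simpa using T.X_pow_Y_v_ne_zero hbig (a := 1) (by omega)
  exact smul_left_injective F hXYv hYX

theorem isHighOpposite (R : IsOppositeString ℒ k x y v p A c m (Y B))
    (T : IsTail ℒ k q x y e 1 t τ v ρ) (hA : A ∈ ℒ p) {j : ℕ} (hB : B ∈ ℒ j)
    (hj : j + m + p + 2 = k) (hm : m + 2 ≤ q) (hXB : X B = 0) (hYB : Y B ≠ 0)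
    (hYA : Y ((X ^ m) (Y A)) = 0) (hY : ∀ κ ∈ ℒ (j - 1), Y κ = 0)
    (h : ∀ κ ∈ ℒ (j - 1), X κ = B → ⁅κ, (X ^ (m + 1)) (Y A)⁆ = v) :
    IsHighOpposite ℒ k x y v (p + m + 2) ((X ^ (m + 1)) (Y A)) B (m + 1 + c + ρ) where
  mem := ⟨j, by omega, hB⟩
  X_eq_zero := hXB
  Y_ne_zero := hYB
  lie_Y := by
    have hX : ⁅B, (X ^ (m + 1)) (Y A)⁆ = X v := by
      rw [← apply_pow, ← R.lie_eq_v T hA hB hj hm hYA, IsFrame.derX, hXB, zero_lie, zero_add]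
    have hXY := IsFrame.derY (F := F) (y := y) B ((X ^ (m + 1)) (Y A))
    rw [hX, T.Y_X_v, R.lie_X_pow_succ_Y T hA hm] at hXY
    rw [add_smul, hXY, ← add_assoc, add_self_eq_zero_of_charTwo F, zero_add]
  lie_Y_of_X_eq i κ hi hκ hκB := by
    obtain rfl : i = j - 1 := by omega
    rw [← h κ hκ hκB, IsFrame.derY, hY κ hκ, zero_lie, zero_add]

end IsOppositeString

end Opposites

section OppositeLengths

variable [CharP F 2]

variable {e t p m n : ℕ} {τ v A B U κ : L} {ρ c : F}

namespace IsLowOpposite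

theorem lie_Y_X_pow_Y_eq_zero (H : IsLowOpposite ℒ k q x y v p A U)
    (T : IsTail ℒ k q x y e 1 t τ v ρ) (hA : A ∈ ℒ p) (hXA : X A = 0) (hn : n + 3 ≤ q) :
    ⁅Y U, (X ^ n) (Y A)⁆ = 0 := by
  have := T.eight_le
  have := T.add_two_le
  obtain ⟨s, hs, hU⟩ := H.mem
  obtain ⟨a, ha⟩ := T.exists_eq_smul (by omega) (by omega) T.v_mem T.v_ne_zero
    (T.lie_mem hU hA (n := k - 1) (by omega))
  have hYU : ⁅Y U, A⁆ = (a - 1) • Y v := by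
    have h := IsFrame.derY (F := F) (y := y) U A
    rw [ha, map_smul, H.lie_Y] at h
    rw [sub_smul, one_smul, h, add_sub_cancel_right]
  have hX : ∀ l, ⁅(X ^ l) (Y U), A⁆ = (a - 1) • (X ^ l) (Y v) := fun l => by
    induction l with
    | zero => exact hYU
    | succ l ih =>
      rw [← apply_pow, ← apply_pow, ← map_smul, ← ih, IsFrame.derX, hXA, lie_zero, add_zero]
  refine IsFrame.derX.lie_pow_eq_zero fun l hl => ?_
  have h := IsFrame.derY (F := F) (y := y) ((X ^ l) (Y U)) A
  rw [hX, map_smul, T.Y_X_pow_Y_v _ (by omega), smul_zero, H.Y_X_pow_Y l (by omega), zero_lie,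
    zero_add] at h
  exact h.symm

theorem length_eq (H : IsLowOpposite ℒ k q x y v p A U) (T : IsTail ℒ k q x y e 1 t τ v ρ)
    (hbig : ℒ (k + q / 2 + 1) ≠ ⊥) (hpt : p + 1 < t) (hXA : X A = 0)
    (G : IsGap ℒ x y q e p n A) : n + 1 = q := by
  have hk := T.k_eq
  have hq8 := T.eight_le
  have hq := T.q_eq
  rcases G.length_eq with hn | ⟨b, hb, hn⟩
  · exact hn
  exfalso
  have hb2 := two_pow_mul_two_le hq hb
  have hpos := Nat.two_pow_pos b
  obtain ⟨s, hs, hU⟩ := H.mem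
  have hsn : ¬ IsCentralizedBy ℒ y s := fun h => H.Y_ne_zero (h _ hU)
  obtain ⟨κ, hκ, hκU, hκY⟩ := T.exists_X_pow_eq_of_not_isCentralizedBy T.three_le_exponent hq
    (i := q / 2 - 2 ^ b) (by omega) (by omega) hsn hU (by omega)
  have hYκ : ⁅Y κ, (X ^ n) (Y A)⁆ = 0 := by
    rcases Nat.eq_zero_or_pos (q / 2 - 2 ^ b) with h0 | h0
    · obtain rfl : κ = U := by rwa [h0] at hκU
      exact H.lie_Y_X_pow_Y_eq_zero T G.mem hXA (by omega)
    · rw [show Y κ = 0 from hκY 0 h0, zero_lie]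
  have h := (H.isOppositeString (by omega) hκ hκU hκY).choose_add_choose_eq_zero T hbig G (by omega)
    hYκ (by omega) (by omega) (by omega) (by omega)
  have hchoose := cast_choose_two_pow_sub_half F (s := 0) hb hpos
  rw [show 2 ^ e - 2 ^ b = n + 1 by omega, ← hq, add_zero, if_pos rfl] at hchoose
  rw [hchoose, zero_mul, add_zero] at h
  exact one_ne_zero h

end IsLowOpposite

namespace IsHighOpposite

theorem choose_add_choose_eq_zero (H : IsHighOpposite ℒ k x y v p A U c)
    (T : IsTail ℒ k q x y e 1 t τ v ρ) (hbig : ℒ (k + q / 2 + 1) ≠ ⊥) (hp : q ≤ p)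
    (hpt : p < t) (G : IsGap ℒ x y q e p n A) (hm : m + 1 < q / 2) (hmn : m ≤ n)
    (hnq : n + 3 ≤ q + m) (hnm : n ≤ m + q / 2) :
    ((n + 1).choose m + c * (n + 1).choose (m + 1) : F) = 0 := by
  have hk := T.k_eq
  have hlen := G.length_lt
  obtain ⟨s, hs, hU⟩ := H.mem
  have hsn : ¬ IsCentralizedBy ℒ y s := fun h => H.Y_ne_zero (h _ hU)
  obtain ⟨κ, hκ, hκU, hκY⟩ := T.exists_X_pow_eq_of_not_isCentralizedBy T.three_le_exponent T.q_eq
    (by omega) (by omega) hsn hU hm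
  exact (H.isOppositeString T.toIsFrame (by omega) hκ hκU
    fun l hl => hκY l (by omega)).choose_add_choose_eq_zero T hbig G (by omega)
      (by rw [show Y κ = 0 from hκY 0 m.succ_pos, zero_lie]) (by omega) hmn hnq hnm

theorem length_eq (H : IsHighOpposite ℒ k x y v p A U c) (T : IsTail ℒ k q x y e 1 t τ v ρ)
    (hbig : ℒ (k + q / 2 + 1) ≠ ⊥) (hp : q ≤ p) (hpt : p < t) (G : IsGap ℒ x y q e p n A) :
    n + 1 = q ∨ n + 2 = q ∧ c = 1 := by
  have hq8 := T.eight_le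
  have hq := T.q_eq
  rcases G.length_eq with hn | ⟨b, hb, hn⟩
  · exact Or.inl hn
  have hb2 := two_pow_mul_two_le hq hb
  rcases Nat.eq_zero_or_pos b with rfl | hb0
  · have := T.eight_dvd
    rw [pow_zero] at hn
    have h := H.choose_add_choose_eq_zero T hbig hp hpt G (m := q / 2 - 2) (by omega) (by omega)
      (by omega) (by omega)
    rw [show n + 1 = 2 ^ e - 1 by omega, cast_choose_pow_sub_one 2 (by omega),
      cast_choose_pow_sub_one 2 (by omega)] at h
    simp only [CharTwo.neg_eq, one_pow, mul_one] at h
    exact Or.inr ⟨by omega, (CharTwo.add_eq_zero.1 h).symm⟩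
  · exfalso
    have hpow : 2 ≤ 2 ^ b := Nat.le_self_pow hb0.ne' 2
    have h := H.choose_add_choose_eq_zero T hbig hp hpt G (m := q / 2 - 2 ^ b) (by omega) (by omega)
      (by omega) (by omega)
    have hchoose : ∀ s < 2 ^ b,
        ((n + 1).choose (q / 2 - 2 ^ b + s) : F) = if s = 0 then 1 else 0 := by
      rw [hq, show n + 1 = 2 ^ e - 2 ^ b by omega]
      exact fun s hs => cast_choose_two_pow_sub_half F hb hs
    have h0 := hchoose 0 (by omega)
    rw [add_zero] at h0
    rw [h0, hchoose 1 (by omega)] at h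
    simp at h

end IsHighOpposite

end OppositeLengths

section Links

variable {e t p p' m n : ℕ} {τ v A B U κ : L} {ρ c : F}

variable (ℒ k q x y) in
/-- The condition that propagates along the degrees not centralized by `y`: the element `A` of
degree `p` has a low opposite, or a high one with one of the two scalars that do occur. -/
def HasOpposite (v : L) (ρ : F) (p : ℕ) (A : L) : Prop :=
  (∃ U, IsLowOpposite ℒ k q x y v p A U) ∨
    ∃ U c, (c = 0 ∨ c = 1 + ρ) ∧ IsHighOpposite ℒ k x y v p A U c

variable (ℒ k q x y) in
/-- An element `A` of degree `p ≤ t`, centralized by `x` and not by `y`, that has an opposite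
element unless its degree is `t`. -/
structure IsLink (t : ℕ) (v : L) (ρ : F) (p : ℕ) (A : L) : Prop where
  mem : A ∈ ℒ p
  X_eq_zero : X A = 0
  Y_ne_zero : Y A ≠ 0
  le : p ≤ t
  hasOpposite : p < t → HasOpposite ℒ k q x y v ρ p A

variable [CharP F 2]

theorem IsGap.lie_Y_eq_zero (G : IsGap ℒ x y q e p n A) (G' : IsGap ℒ x y q e p' m B)
    (T : IsTail ℒ k q x y e 1 t τ v ρ) (hn : 1 < n) (hm : 1 < m) (hXB : X B = 0)
    (ht : p' + p + 1 = t) : ⁅B, Y A⁆ = 0 := by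
  have := T.t_lt
  have := T.k_eq
  obtain ⟨η, hη⟩ := T.exists_eq_smul_τ (T.lie_mem G'.mem (T.Y_mem G.mem rfl) (by omega))
  have hX : ⁅B, X (Y A)⁆ = 0 := by
    have h := IsFrame.derX (F := F) (x := x) B (Y A)
    rw [hη, map_smul, T.X_τ, smul_zero, hXB, zero_lie, zero_add] at h
    exact h.symm
  have hYX : ⁅Y B, X (Y A)⁆ = 0 := by
    have h := IsFrame.derY (F := F) (y := y) B (X (Y A))
    rw [hX, map_zero, show Y (X (Y A)) = 0 from G.Y_X_pow_Y 1 hn, lie_zero, add_zero] at h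
    exact h.symm
  have hXY : ⁅X (Y B), Y A⁆ = 0 :=
    T.lie_Y_eq_zero G.mem (T.X_mem (T.Y_mem G'.mem rfl) rfl) (G'.Y_X_pow_Y 1 hm) (by omega)
      (by have := T.eight_le; omega)
  have hητ : η • X (Y τ) = 0 := by
    rw [← map_smul, ← map_smul, ← hη, IsFrame.derY, T.Y_Y, lie_zero, add_zero, IsFrame.derX, hXY,
      hYX, add_zero]
  have hXYτ : X (Y τ) ≠ 0 := fun h => T.v_ne_zero (by
    rw [← T.X_pow_Y_τ, show q - 2 = q - 3 + 1 by have := T.eight_le; omega, ← pow_apply_apply, h,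
      map_zero])
  rw [hη, (smul_eq_zero.1 hητ).resolve_right hXYτ, zero_smul]

theorem IsFrame.lie_X_pow_succ_of_X_X_eq_zero (h : X (X κ) = 0) (n : ℕ) (u : L) :
    ⁅κ, (X ^ (n + 1)) u⁆ = (X ^ (n + 1)) ⁅κ, u⁆ + (n + 1 : F) • ⁅X κ, (X ^ n) u⁆ := by
  rw [derX.lie_pow_eq_pair 0, derX.lie_pow_apply_of_apply_eq_zero h]
  · simp
  · intro l _ h0 h1
    obtain ⟨i, rfl⟩ : ∃ i, l = i + 1 + 1 := ⟨l - 2, by omega⟩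
    rw [← pow_apply_apply, ← pow_apply_apply, h, map_zero, zero_lie]

theorem IsGap.isLowOpposite (G' : IsGap ℒ x y q e p' m B) (hm : m + 1 = q) (hXB : X B = 0)
    (hk : p' + p + n + 2 = k) (h0 : ⁅B, Y A⁆ = 0) (h1 : ⁅Y B, (X ^ n) (Y A)⁆ = Y v) :
    IsLowOpposite ℒ k q x y v (p + 1 + n) ((X ^ n) (Y A)) B where
  mem := ⟨p', by omega, G'.mem⟩
  X_eq_zero := hXB
  Y_ne_zero := G'.Y_ne_zero
  lie_Y := by
    have h := IsFrame.derY (F := F) (y := y) B ((X ^ n) (Y A))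
    rw [IsFrame.derX.lie_pow_apply_of_apply_eq_zero hXB, h0, map_zero, map_zero, h1] at h
    exact (eq_of_add_eq_zero_of_charTwo F h.symm).symm
  Y_X_pow_Y l hl := G'.Y_X_pow_Y l (by omega)

theorem IsOppositeString.isHighOpposite_of_isGap
    (R : IsOppositeString ℒ k x y v p A c (q - 2) (Y B)) (T : IsTail ℒ k q x y e 1 t τ v ρ)
    (G : IsGap ℒ x y q e p (q - 1) A) (G' : IsGap ℒ x y q e p' m B) (hm : q ≤ m + 2)
    (hp' : q ≤ p') (hk : p' + p + q = k) :
    IsHighOpposite ℒ k x y v (p + q) ((X ^ (q - 1)) (Y A)) B (1 + c + ρ) := by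
  have hq8 := T.eight_le
  have hq2 := T.eight_dvd
  have htq := T.k_eq
  have hXB := T.X_eq_zero_of_isGap T.three_le_exponent T.q_eq hp' (by omega) G' hm
  have hYA := G.Y_X_pow_Y (q - 2) (by omega)
  have hcast : ((q - 2 : ℕ) : F) = 0 := by
    rw [CharTwo.natCast_eq_ite, if_pos (by rw [Nat.even_iff]; omega)]
  have hY : ∀ κ ∈ ℒ (p' - 1), Y κ = 0 := T.isCentralizedBy_of_lt_add_half T.three_le_exponent T.q_eq
    hp' (by omega) G'.not_isCentralizedBy (by omega) (by omega)
  have H := R.isHighOpposite T G.mem G'.mem (by omega) (by omega) hXB G'.Y_ne_zero hYA hY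
    fun κ hκ hκB => by
      rw [IsFrame.lie_X_pow_succ_of_X_X_eq_zero (by rw [hκB, hXB]), ← pow_apply_apply,
        T.X_eq_zero_of_mem_t (T.lie_mem hκ (T.Y_mem G.mem rfl) (by omega)), map_zero, hcast,
        zero_add, zero_add, one_smul, hκB]
      exact R.lie_eq_v T G.mem G'.mem (by omega) (by omega) hYA
  rwa [hcast, zero_add, show p + (q - 2) + 2 = p + q by omega,
    show q - 2 + 1 = q - 1 by omega] at H

theorem IsLowOpposite.lie_Y_X_pow_Y_eq_Y_v (H : IsLowOpposite ℒ k q x y v p A U)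
    (T : IsTail ℒ k q x y e 1 t τ v ρ) (hA : A ∈ ℒ p) (G' : IsGap ℒ x y q e p' n B)
    (hn : n < q) (hk : p' + n + p + 2 = k) (hBU : (X ^ n) (Y B) = U) (hBA : ⁅B, Y A⁆ = 0) :
    ⁅Y B, (X ^ n) (Y A)⁆ = Y v := by
  have htk := T.k_eq
  rw [IsFrame.derX.lie_pow_eq_single n, Nat.choose_self, Nat.cast_one, one_smul,
    Nat.sub_self, hBU, H.lie_Y, pow_zero, Module.End.one_apply]
  intro l hl hln
  rcases Nat.eq_zero_or_pos l with rfl | hl0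
  · have h := IsFrame.derY (F := F) (y := y) B (Y A)
    rw [hBA, map_zero, T.Y_Y, lie_zero, add_zero] at h
    exact h.symm
  · exact T.lie_Y_eq_zero hA (T.X_pow_mem l (T.Y_mem G'.mem rfl) rfl)
      (G'.Y_X_pow_Y l (by omega)) (by omega) (by omega)

theorem IsLowOpposite.hasOpposite (H : IsLowOpposite ℒ k q x y v p A U)
    (T : IsTail ℒ k q x y e 1 t τ v ρ) (hbig : ℒ (k + q / 2 + 1) ≠ ⊥) (hp : q ≤ p)
    (hpt : p + q < t) (G : IsGap ℒ x y q e p (q - 1) A) :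
    HasOpposite ℒ k q x y v ρ (p + q) ((X ^ (q - 1)) (Y A)) := by
  have hq8 := T.eight_le
  have hq2 := T.eight_dvd
  have hk := T.k_eq
  obtain ⟨s, hs, hU⟩ := H.mem
  obtain ⟨p', m, B, G', hp', hpm, hBU⟩ := T.exists_isGap_of_gt T.three_le_exponent T.q_eq
    (by omega) (by omega) hU H.Y_ne_zero
  have R := H.isOppositeString (by omega) (T.Y_mem G'.mem rfl) hBU G'.Y_X_pow_Y
  rcases G'.length_eq with hm | ⟨b, hb, hm⟩
  · left
    obtain rfl : m = q - 1 := by omega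
    have hXB := T.X_eq_zero_of_isGap T.three_le_exponent T.q_eq hp' (by omega) G' (by omega)
    have hBA := G.lie_Y_eq_zero G' T (by omega) (by omega) hXB (by omega)
    have hYBA := H.lie_Y_X_pow_Y_eq_Y_v T G.mem G' (by omega) (by omega) hBU hBA
    have H' := G'.isLowOpposite (k := k) (p := p) (n := q - 1) (by omega) hXB (by omega) hBA hYBA
    rw [show p + 1 + (q - 1) = p + q by omega] at H'
    exact ⟨B, H'⟩
  rcases Nat.eq_zero_or_pos b with rfl | hb0
  · right
    obtain rfl : m = q - 2 := by omega
    have H' := R.isHighOpposite_of_isGap T G G' (by omega) hp' (by omega)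
    rw [add_zero] at H'
    exact ⟨B, 1 + ρ, Or.inr rfl, H'⟩
  · have h2 : 2 ∣ 2 ^ b := dvd_pow_self 2 hb0.ne'
    have hpos := Nat.two_pow_pos b
    have hρ := R.ρ_eq T hbig G.mem G'.mem (by omega) (by omega)
      (G'.exists_X_eq_smul T.toIsFrame (by omega) (by omega)) (G.Y_X_pow_Y _ (by omega))
      (G.Y_X_pow_Y _ (by omega))
    rw [add_zero, ← Nat.cast_succ, CharTwo.natCast_eq_ite,
      if_pos (by rw [Nat.even_iff]; omega)] at hρ
    exact absurd hρ T.ρ_ne_zero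

theorem IsOppositeString.add_two_pow_ne (R : IsOppositeString ℒ k x y v p A c m (Y B))
    (T : IsTail ℒ k q x y e 1 t τ v ρ) (hbig : ℒ (k + q / 2 + 1) ≠ ⊥)
    (G : IsGap ℒ x y q e p (q - 1) A) {j b : ℕ} (hB : B ∈ ℒ j) (hj : j + m + p + 2 = k)
    (hb0 : 0 < b) (hb : b < e) : m + 2 + 2 ^ b ≠ q := fun hm => by
  have hq8 := T.eight_le
  have hq2 := T.eight_dvd
  have hq := T.q_eq
  have hb2 := two_pow_mul_two_le hq hb
  have h2 : 2 ∣ 2 ^ b := dvd_pow_self 2 hb0.ne'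
  have hpos := Nat.two_pow_pos b
  have hBA := T.isCentralizedBy_of_gt_diamond (i := k - 1 + 2 ^ b) (by omega) (by omega) _
    (T.lie_mem hB (T.X_pow_mem (q - 2) (T.Y_mem G.mem rfl) rfl) (by omega))
  have hYBA := R.lie_X_pow_Y T G.mem (by omega) (2 ^ b)
  rw [show m + 2 ^ b = q - 2 by omega] at hYBA
  rw [IsFrame.derY, G.Y_X_pow_Y _ (by omega), lie_zero, add_zero, hYBA] at hBA
  have hcoeff := (smul_eq_zero.1 hBA).resolve_right (T.X_pow_Y_v_ne_zero hbig (by omega))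
  rw [hq, cast_choose_pow_sub_two 2 (by omega), cast_choose_pow_sub_two 2 (by omega)] at hcoeff
  have hm0 : (m : F) = 0 := by
    rw [CharTwo.natCast_eq_ite, if_pos (by rw [Nat.even_iff]; omega)]
  simp [hm0, CharTwo.neg_eq, CharTwo.add_self_eq_zero] at hcoeff

theorem IsHighOpposite.hasOpposite (H : IsHighOpposite ℒ k x y v p A U c)
    (T : IsTail ℒ k q x y e 1 t τ v ρ) (hbig : ℒ (k + q / 2 + 1) ≠ ⊥) (hp : q ≤ p)
    (hpt : p + q < t) (G : IsGap ℒ x y q e p (q - 1) A) (hc : c = 0 ∨ c = 1 + ρ) :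
    HasOpposite ℒ k q x y v ρ (p + q) ((X ^ (q - 1)) (Y A)) := by
  have hq8 := T.eight_le
  have hq2 := T.eight_dvd
  have hk := T.k_eq
  obtain ⟨s, hs, hU⟩ := H.mem
  obtain ⟨p', m, B, G', hp', hpm, hBU⟩ := T.exists_isGap_of_gt T.three_le_exponent T.q_eq
    (by omega) (by omega) hU H.Y_ne_zero
  have hm2 := G'.le_two_mul_length T.q_eq
  obtain ⟨m, rfl⟩ : ∃ m', m = m' + 1 := ⟨m - 1, by omega⟩
  have R := H.isOppositeString T.toIsFrame (by omega) (T.Y_mem G'.mem rfl) hBU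
    fun l hl => G'.Y_X_pow_Y l (by omega)
  rcases G'.length_eq with hm | ⟨b, hb, hm⟩
  · obtain rfl : m = q - 2 := by omega
    refine Or.inr ⟨B, 1 + c + ρ, ?_, R.isHighOpposite_of_isGap T G G' (by omega) hp' (by omega)⟩
    rcases hc with rfl | rfl
    · exact Or.inr (by rw [add_zero])
    · exact Or.inl (by linear_combination CharTwo.add_self_eq_zero (1 + ρ))
  exfalso
  rcases Nat.eq_zero_or_pos b with rfl | hb0
  · have hρ := R.ρ_eq T hbig G.mem G'.mem (by omega) (by omega)
      (G'.exists_X_eq_smul T.toIsFrame (by omega) (by omega)) (G.Y_X_pow_Y _ (by omega))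
      (G.Y_X_pow_Y _ (by omega))
    rw [← Nat.cast_succ, CharTwo.natCast_eq_ite, if_pos (by rw [Nat.even_iff]; omega),
      zero_add] at hρ
    rcases hc with rfl | rfl
    · exact T.ρ_ne_zero hρ
    · exact one_ne_zero (right_eq_add.1 hρ)
  · exact R.add_two_pow_ne T hbig G G'.mem (by omega) hb0 hb (by omega)

theorem IsTail.isHighOpposite_τ (T : IsTail ℒ k q x y e 1 t τ v ρ) :
    IsHighOpposite ℒ k x y v q ((X ^ (q - 1)) y) τ (1 : F) := by
  have hq8 := T.eight_le
  have hk := T.k_eq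
  refine ⟨⟨t, hk.symm, T.τ_mem⟩, T.X_τ, T.Y_τ_ne_zero, ?_, fun j κ hj hκ hκτ => ?_⟩
  · have hder := IsFrame.derY (F := F) (y := y) τ ((X ^ (q - 1)) y)
    have hXXv : X (X v) = 0 := by
      rw [← T.X_pow_Y_τ, apply_pow, apply_pow, T.X_pow_eq_zero T.q_eq (by omega)]
    rw [lie_X_pow_pred_y T.q_eq (i := 0) (A := τ) (by omega) rfl T.X_τ
        (fun l hl => absurd hl l.not_lt_zero),
      T.lie_X_pow_pred_y_of_X_pow_eq_v (m := q - 2) (by omega) (Or.inr hXXv) T.X_pow_Y_τ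
        (fun l hl => T.Y_X_pow_Y_τ (by omega)), Nat.sub_zero, show q - 1 = q - 2 + 1 by omega,
      ← apply_pow, T.X_pow_Y_τ, T.Y_X_v, Nat.add_sub_cancel_left, pow_one,
      ← show q - 1 = q - 2 + 1 by omega] at hder
    rw [← sub_eq_iff_eq_add'.2 hder, ← sub_smul, CharTwo.sub_eq_add, add_left_comm,
      CharTwo.add_self_eq_zero, add_zero]
  · have hκY : Y κ = 0 := T.isCentralizedBy_of_lt_add_half T.three_le_exponent T.q_eq T.q_le
      (by omega) T.not_isCentralizedBy_t (by omega) (by omega) _ hκ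
    rw [lie_Y_X_pow_pred_y T.q_eq one_pos (by omega) (by rwa [pow_one]) T.X_τ
      fun l hl => by rwa [Nat.lt_one_iff.1 hl, pow_zero], show q - 1 - 1 = q - 2 by omega,
      T.X_pow_Y_τ]

end Links

section Chain

variable [CharP F 2] {e t p m n : ℕ} {τ v A B κ : L} {ρ : F}

theorem IsTail.lie_X_pow_Y_X_pow_pred_y_eq_v (T : IsTail ℒ k q x y e 1 t τ v ρ) (hκB : X κ = B)
    (hXB : X B = 0) (hYκ : Y κ = 0) (hBτ : (X ^ (q - 2)) (Y B) = τ) :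
    ⁅κ, (X ^ (q - 2)) (Y ((X ^ (q - 1)) y))⁆ = v := by
  have hq8 := T.eight_le
  have hq2 := T.eight_dvd
  have hκw : ⁅κ, Y ((X ^ (q - 1)) y)⁆ = Y τ := by
    rw [lie_Y_X_pow_pred_y T.q_eq one_pos (by omega) (by rwa [pow_one]) hXB
      fun l hl => by rwa [Nat.lt_one_iff.1 hl, pow_zero], show q - 1 - 1 = q - 2 by omega, hBτ]
  have hodd : ((q - 3 : ℕ) : F) + 1 = 0 := by
    rw [← Nat.cast_succ, CharTwo.natCast_eq_ite, if_pos (by rw [Nat.even_iff]; omega)]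
  rw [show q - 2 = q - 3 + 1 by omega, IsFrame.lie_X_pow_succ_of_X_X_eq_zero (by rw [hκB, hXB]),
    hκw, hodd, zero_smul, add_zero, ← show q - 2 = q - 3 + 1 by omega, T.X_pow_Y_τ]

theorem IsTail.lie_Y_X_pow_pred_y_eq_zero (T : IsTail ℒ k q x y e 1 t τ v ρ)
    (G : IsGap ℒ x y q e p m B) (hm : q ≤ m + 1) (hXB : X B = 0) (hBτ : (X ^ (q - 1)) (Y B) = τ) :
    ⁅B, Y ((X ^ (q - 1)) y)⁆ = 0 := by
  have hq8 := T.eight_le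
  have hder := IsFrame.derY (F := F) (y := y) B ((X ^ (q - 1)) y)
  rw [lie_X_pow_pred_y T.q_eq (i := 0) (A := B) (by omega) rfl hXB
      (fun l hl => absurd hl l.not_lt_zero),
    lie_X_pow_pred_y T.q_eq (i := q - 1) (A := τ) (by omega) hBτ T.X_τ
      (fun l hl => G.Y_X_pow_Y l (by omega)), Nat.sub_self, Nat.sub_zero, hBτ] at hder
  exact left_eq_add.1 hder

theorem IsTail.hasOpposite_start (T : IsTail ℒ k q x y e 1 t τ v ρ)
    (hbig : ℒ (k + q / 2 + 1) ≠ ⊥) (hpt : 2 * q - 1 < t)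
    (G : IsGap ℒ x y q e q (q - 2) ((X ^ (q - 1)) y)) :
    HasOpposite ℒ k q x y v ρ (2 * q - 1) ((X ^ (q - 2)) (Y ((X ^ (q - 1)) y))) := by
  have hq8 := T.eight_le
  have hq2 := T.eight_dvd
  have hk := T.k_eq
  have he := T.three_le_exponent
  have hq := T.q_eq
  have hw := T.X_pow_pred_y_mem
  obtain ⟨p', m, B, G', hp', hpm, hBτ⟩ := T.exists_isGap_of_gt he hq (by omega) (by omega) T.τ_mem
    T.Y_τ_ne_zero
  have hm2 := G'.le_two_mul_length hq
  obtain ⟨m, rfl⟩ : ∃ m', m = m' + 1 := ⟨m - 1, by omega⟩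
  have R := T.isHighOpposite_τ.isOppositeString T.toIsFrame (by omega) (T.Y_mem G'.mem rfl) hBτ
    fun l hl => G'.Y_X_pow_Y l (by omega)
  rcases G'.length_eq with hm | ⟨b, hb, hm⟩
  · left
    obtain rfl : m = q - 2 := by omega
    have hXB := T.X_eq_zero_of_isGap he hq hp' (by omega) G' (by omega)
    have hBτ' : (X ^ (q - 1)) (Y B) = τ := by rwa [show q - 1 = q - 2 + 1 by omega]
    have hBw := T.lie_Y_X_pow_pred_y_eq_zero G' (by omega) hXB hBτ'
    have H := G'.isLowOpposite (k := k) (p := q) (n := q - 2) (by omega) hXB (by omega) hBw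
      (R.lie_X_pow_Y_self T hw (by omega))
    rw [show q + 1 + (q - 2) = 2 * q - 1 by omega] at H
    exact ⟨B, H⟩
  rcases Nat.eq_zero_or_pos b with rfl | hb0
  · right
    obtain rfl : m = q - 3 := by omega
    have hXB := T.X_eq_zero_of_isGap he hq hp' (by omega) G' (by omega)
    have hY : ∀ κ ∈ ℒ (p' - 1), Y κ = 0 := T.isCentralizedBy_of_lt_add_half he hq hp' (by omega)
      G'.not_isCentralizedBy (by omega) (by omega)
    have H := R.isHighOpposite T hw G'.mem (by omega) (by omega) hXB G'.Y_ne_zero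
      (G.Y_X_pow_Y _ (by omega)) hY fun κ hκ hκB => by
        rw [show q - 3 + 1 = q - 2 by omega]
        exact T.lie_X_pow_Y_X_pow_pred_y_eq_v hκB hXB (hY κ hκ)
          (by rwa [show q - 2 = q - 3 + 1 by omega])
    rw [← Nat.cast_succ, CharTwo.natCast_eq_ite, if_pos (by rw [Nat.even_iff]; omega), zero_add,
      show q - 3 + 1 = q - 2 by omega, show q + (q - 3) + 2 = 2 * q - 1 by omega] at H
    exact ⟨B, 1 + ρ, Or.inr rfl, H⟩
  · have h2 : 2 ∣ 2 ^ b := dvd_pow_self 2 hb0.ne'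
    have hpos := Nat.two_pow_pos b
    have hρ := R.ρ_eq T hbig hw G'.mem (by omega) (by omega)
      (G'.exists_X_eq_smul T.toIsFrame (by omega) (by omega)) (G.Y_X_pow_Y _ (by omega))
      (G.Y_X_pow_Y _ (by omega))
    rw [CharTwo.natCast_eq_ite, if_pos (by rw [Nat.even_iff]; omega), zero_add,
      CharTwo.add_self_eq_zero] at hρ
    exact absurd hρ T.ρ_ne_zero

theorem IsTail.isLink_start (T : IsTail ℒ k q x y e 1 t τ v ρ) (hbig : ℒ (k + q / 2 + 1) ≠ ⊥) :
    IsLink ℒ k q x y t v ρ (2 * q - 1) ((X ^ (q - 2)) (Y ((X ^ (q - 1)) y))) ∧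
      ∀ i, q < i → i < 2 * q - 1 → IsCentralizedBy ℒ y i := by
  have hq8 := T.eight_le
  have hw := T.X_pow_pred_Y_X_pow_pred_y T.q_eq
  obtain ⟨n, G, hnt, hcent⟩ := T.exists_isGap_of_lt T.three_le_exponent T.q_eq le_rfl T.lt_t T.t_lt
    T.not_isCentralizedBy_t T.X_pow_pred_y_mem T.Y_X_pow_pred_y_ne_zero
  have hn : n + 2 = q := (T.isHighOpposite_τ.length_eq T hbig le_rfl T.lt_t G).elim
    (fun h => absurd (by rwa [show n = q - 1 by omega]) G.X_pow_Y_ne_zero) And.left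
  obtain rfl : n = q - 2 := by omega
  exact ⟨{
    mem := T.X_pow_mem _ (T.Y_mem T.X_pow_pred_y_mem rfl) (by omega)
    X_eq_zero := by rwa [apply_pow, show q - 2 + 1 = q - 1 by omega]
    Y_ne_zero := G.Y_X_pow_Y_ne_zero
    le := by omega
    hasOpposite := fun h => T.hasOpposite_start hbig h G }, fun i hi hi' => hcent i hi (by omega)⟩

theorem IsLink.next (K : IsLink ℒ k q x y t v ρ p A) (T : IsTail ℒ k q x y e 1 t τ v ρ)
    (hbig : ℒ (k + q / 2 + 1) ≠ ⊥) (hp : q ≤ p) (hpt : p < t) :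
    IsLink ℒ k q x y t v ρ (p + q) ((X ^ (q - 1)) (Y A)) ∧
      ∀ i, p < i → i < p + q → IsCentralizedBy ℒ y i := by
  have hq8 := T.eight_le
  obtain ⟨n, G, hnt, hcent⟩ := T.exists_isGap_of_lt T.three_le_exponent T.q_eq hp hpt T.t_lt
    T.not_isCentralizedBy_t K.mem K.Y_ne_zero
  have hn2 := G.le_two_mul_length T.q_eq
  have hn : n + 1 = q := by
    rcases K.hasOpposite hpt with ⟨U, H⟩ | ⟨U, c, hc, H⟩
    · exact H.length_eq T hbig (by omega) K.X_eq_zero G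
    · refine (H.length_eq T hbig hp hpt G).resolve_right ?_
      rintro ⟨-, rfl⟩
      exact hc.elim one_ne_zero fun h => T.ρ_ne_zero (left_eq_add.1 h)
  obtain rfl : n = q - 1 := by omega
  refine ⟨{
    mem := T.X_pow_mem _ (T.Y_mem K.mem rfl) (by omega)
    X_eq_zero := by rw [apply_pow]; exact T.X_pow_eq_zero T.q_eq (by omega) _
    Y_ne_zero := G.Y_X_pow_Y_ne_zero
    le := by omega
    hasOpposite := fun h => ?_ }, fun i hi hi' => hcent i hi (by omega)⟩
  rcases K.hasOpposite hpt with ⟨U, H⟩ | ⟨U, c, hc, H⟩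
  · exact H.hasOpposite T hbig hp h G
  · exact H.hasOpposite T hbig hp h G hc

variable (F q x y) in
/-- The images of `[y, x, …, x]` of degree `q - 1` under the powers of the adjoint map of
`[y, x, …, x]` of degree `q`: the `m`-th one spans the component of degree `(m + 1) q - 1`. -/
def chain (m : ℕ) : L :=
  ((LieAlgebra.ad F L ((X ^ (q - 1)) y)) ^ m) ((X ^ (q - 2)) y)

theorem chain_succ_eq_lie : chain F q x y (m + 1) = ⁅chain F q x y m, (X ^ (q - 1)) y⁆ := by
  rw [chain, chain, ← apply_pow, LieAlgebra.ad_apply, lie_comm_of_charTwo F]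

namespace IsTail

theorem chain_one (T : IsTail ℒ k q x y e 1 t τ v ρ) :
    chain F q x y 1 = (X ^ (q - 2)) (Y ((X ^ (q - 1)) y)) := by
  have hq8 := T.eight_le
  rw [chain_succ_eq_lie, chain, pow_zero, Module.End.one_apply,
    lie_X_pow_pred_y T.q_eq (i := 1) (A := (X ^ (q - 1)) y) (by omega)
      (by rw [pow_one, apply_pow, show q - 2 + 1 = q - 1 by omega]) T.X_X_pow_pred_y
      (fun l hl => by rw [pow_apply_pow]; exact T.Y_X_pow_y (by omega)),
    show q - 1 - 1 = q - 2 by omega]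

theorem chain_succ (T : IsTail ℒ k q x y e 1 t τ v ρ) (h : X (chain F q x y m) = 0) :
    chain F q x y (m + 1) = (X ^ (q - 1)) (Y (chain F q x y m)) := by
  have hq8 := T.eight_le
  rw [chain_succ_eq_lie]
  exact lie_X_pow_pred_y T.q_eq (i := 0) (by omega) rfl h fun l hl => absurd hl l.not_lt_zero

theorem isLink_chain (T : IsTail ℒ k q x y e 1 t τ v ρ) (hbig : ℒ (k + q / 2 + 1) ≠ ⊥) (hm : 1 ≤ m)
    (hmt : m * q ≤ t) :
    IsLink ℒ k q x y t v ρ ((m + 1) * q - 1) (chain F q x y m) ∧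
      ∀ i, q < i → i < (m + 1) * q - 1 → (∀ j, 1 ≤ j → j < m → i ≠ (j + 1) * q - 1) →
        IsCentralizedBy ℒ y i := by
  have hq8 := T.eight_le
  induction m, hm using Nat.le_induction with
  | base =>
    rw [T.chain_one]
    exact (T.isLink_start hbig).imp_right fun h i hi hi' _ => h i hi hi'
  | succ m hm ih =>
    have hmq : (m + 1) * q = m * q + q := by ring
    have hmq' : (m + 1 + 1) * q = m * q + q + q := by ring
    have hqm := Nat.mul_le_mul_right q hm
    obtain ⟨K, hlow⟩ := ih (by omega)
    obtain ⟨K', hhigh⟩ := K.next T hbig (by omega) (by omega)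
    rw [← T.chain_succ K.X_eq_zero, show (m + 1) * q - 1 + q = (m + 1 + 1) * q - 1 by omega] at K'
    refine ⟨K', fun i hi hi' hne => ?_⟩
    rcases Nat.lt_trichotomy i ((m + 1) * q - 1) with h | h | h
    · exact hlow i hi h fun j hj hjm => hne j hj (by omega)
    · exact absurd h (hne m hm (by omega))
    · exact hhigh i h (by omega)

theorem exists_chain (T : IsTail ℒ k q x y e 1 t τ v ρ) (hbig : ℒ (k + q / 2 + 1) ≠ ⊥) :
    ∃ N, 3 ≤ N ∧ k + 1 = N * q ∧
      (∀ m, 2 ≤ m → m < N → IsLink ℒ k q x y t v ρ (m * q - 1) (chain F q x y (m - 1))) ∧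
      ∀ i, q < i → i + 1 < k → (∀ m, 2 ≤ m → m < N → i + 1 ≠ m * q) →
        IsCentralizedBy ℒ y i := by
  have hq8 := T.eight_le
  have hk := T.k_eq
  have hqt := T.lt_t
  obtain ⟨M, hM⟩ : ∃ M, M = t / q := ⟨_, rfl⟩
  have hMt : M * q ≤ t := hM ▸ Nat.div_mul_le_self t q
  have htM : t < (M + 1) * q := by
    rw [hM, mul_comm]
    exact Nat.lt_mul_div_succ t (by omega)
  have hM1 : 1 ≤ M := hM ▸ Nat.div_pos hqt.le (by omega)
  obtain ⟨K, hcent⟩ := T.isLink_chain hbig hM1 hMt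
  have ht : t = (M + 1) * q - 1 := le_antisymm (by omega) K.le
  have hM2 : (M + 2) * q = (M + 1) * q + q := by ring
  refine ⟨M + 2, by omega, by omega, fun m hm hmN => ?_, fun i hqi hik hne => ?_⟩
  · obtain ⟨m, rfl⟩ := Nat.exists_eq_add_of_le' (by omega : 1 ≤ m)
    have hmM := Nat.mul_le_mul_right q (show m ≤ M by omega)
    exact (T.isLink_chain hbig (by omega) (by omega)).1
  · rcases Nat.lt_trichotomy i t with h | h | h
    · exact hcent i hqi (by omega) fun j hj hjM hij => hne (j + 1) (by omega) (by omega) (by omega)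
    · exact absurd (by omega) (hne (M + 1) (by omega) (by omega))
    · exact T.isCentralizedBy_of_gt i h hik

end IsTail

end Chain

section PowerOfTwo

variable {e t N : ℕ} {τ v : L} {ρ : F}

theorem mul_add_ne_mul {m r : ℕ} (hr0 : 0 < r) (hrq : r < q) (n : ℕ) : n * q + r ≠ m * q := by
  intro h
  have hdvd : q ∣ r := (Nat.dvd_add_right (dvd_mul_left q n)).1 ⟨m, by rw [h, mul_comm]⟩
  exact absurd (Nat.le_of_dvd hr0 hdvd) (by omega)

theorem IsTail.smul {d : ℕ} (T : IsTail ℒ k q x y e d t τ v ρ) {a : F} (ha : a ≠ 0) :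
    IsTail ℒ k q x y e d t (a • τ) (a • v) ρ where
  toIsFrame := T.toIsFrame
  three_le_exponent := T.three_le_exponent
  q_eq := T.q_eq
  d_eq := T.d_eq
  q_le := T.q_le
  t_add_eq := T.t_add_eq
  isCentralizedBy_of_gt := T.isCentralizedBy_of_gt
  τ_mem := (ℒ t).smul_mem _ T.τ_mem
  X_τ := by rw [map_smul, T.X_τ, smul_zero]
  v_eq := by rw [map_smul, map_smul, T.v_eq]
  v_ne_zero := smul_ne_zero ha T.v_ne_zero
  Y_X_v := by rw [map_smul, map_smul, T.Y_X_v, map_smul, map_smul, smul_comm]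
  ρ_ne_zero := T.ρ_ne_zero
  succ_eq_span := by
    rw [T.succ_eq_span, map_smul, map_smul, Submodule.span_singleton_smul_eq (IsUnit.mk0 a ha)]
  Y_X_pow_Y_v l hl := by rw [map_smul, map_smul, map_smul, T.Y_X_pow_Y_v l hl, smul_zero]

variable (ℒ k q x y) in
/-- The configuration around the second diamond in degree `k = N q - 1` once the components not
centralized by `y` are known: beyond degree `q` they are spanned by the members of the chain, the
last of which is `τ`. -/
structure IsChainTail (e t : ℕ) (τ v : L) (ρ : F) (N : ℕ) : Prop
    extends IsTail ℒ k q x y e 1 t τ v ρ where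
  three_le : 3 ≤ N
  add_one_eq : k + 1 = N * q
  chain_mem : ∀ m, 1 ≤ m → m + 2 ≤ N → chain F q x y m ∈ ℒ ((m + 1) * q - 1)
  X_chain : ∀ m, 1 ≤ m → m + 2 ≤ N → X (chain F q x y m) = 0
  Y_chain_ne_zero : ∀ m, 1 ≤ m → m + 2 ≤ N → Y (chain F q x y m) ≠ 0
  chain_eq_τ : chain F q x y (N - 2) = τ
  isCentralizedBy_of_ne : ∀ i, q < i → i + 1 < k → (∀ m, 2 ≤ m → m < N → i + 1 ≠ m * q) →
    IsCentralizedBy ℒ y i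

local notation "W" => LieAlgebra.ad F L (((LieAlgebra.ad F L x) ^ (q - 1)) y)

variable (F q x y) in
/-- The images of `[v, y, x, …, x]` of degree `k + q - 1` under the powers of the adjoint map of
`[y, x, …, x]` of degree `q`: they continue the chain beyond the second diamond. -/
def chainBeyond (v : L) (j : ℕ) : L :=
  (W ^ j) ((X ^ (q - 1)) (Y v))

theorem W_pow_chain (a m : ℕ) : (W ^ a) (chain F q x y m) = chain F q x y (a + m) :=
  pow_apply_pow ..

theorem W_chain (m : ℕ) : W (chain F q x y m) = chain F q x y (m + 1) :=
  apply_pow ..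

theorem W_chainBeyond (j : ℕ) : W (chainBeyond F q x y v j) = chainBeyond F q x y v (j + 1) :=
  apply_pow ..

theorem chainBeyond_zero : chainBeyond F q x y v 0 = (X ^ (q - 1)) (Y v) := rfl

namespace IsChainTail

theorem Y_X_pow_Y_chain (C : IsChainTail ℒ k q x y e t τ v ρ N) {m l : ℕ} (hm : 1 ≤ m)
    (hmN : m + 3 ≤ N) (hl : l + 2 ≤ q) : Y ((X ^ l) (Y (chain F q x y m))) = 0 := by
  have hq8 := C.eight_le
  have hk := C.add_one_eq
  have hNq := Nat.mul_le_mul_right q hmN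
  have hmq := Nat.mul_le_mul_right q hm
  have hsucc : (m + 1) * q = m * q + q := by ring
  have hsucc3 : (m + 3) * q = m * q + q + q + q := by ring
  refine C.isCentralizedBy_of_ne ((m + 1) * q + l) (by omega) (by omega) (fun j _ _ h => ?_) _
    (C.X_pow_mem l (C.Y_mem (C.chain_mem m hm (by omega)) (j := (m + 1) * q) (by omega)) rfl)
  exact mul_add_ne_mul (q := q) (Nat.succ_pos l) (by omega) (m + 1) h

theorem lie_chain_chain_eq_zero (C : IsChainTail ℒ k q x y e t τ v ρ N) {a b : ℕ} (ha : 1 ≤ a)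
    (hb : 1 ≤ b) (hab : a + b + 2 ≤ N) : ⁅chain F q x y a, chain F q x y b⁆ = 0 := by
  have hq8 := C.eight_le
  have hk := C.add_one_eq
  have hNq := Nat.mul_le_mul_right q hab
  have haq := Nat.mul_le_mul_right q ha
  have hbq := Nat.mul_le_mul_right q hb
  have hmem : ⁅chain F q x y a, chain F q x y b⁆ ∈ ℒ ((a + b + 2) * q - 2) :=
    C.lie_mem (C.chain_mem a ha (by omega)) (C.chain_mem b hb (by omega)) (by
      have : (a + b + 2) * q = (a + 1) * q + (b + 1) * q := by ring
      have : (a + 1) * q = a * q + q := by ring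
      have : (b + 1) * q = b * q + q := by ring
      omega)
  have hX : X ⁅chain F q x y a, chain F q x y b⁆ = 0 := by
    rw [IsFrame.derX, C.X_chain a ha (by omega), C.X_chain b hb (by omega), zero_lie, lie_zero,
      add_zero]
  have hsucc : (a + b + 2) * q = (a + b + 1) * q + q := by ring
  have hsucc' : (a + b + 1) * q = a * q + b * q + q := by ring
  by_contra h0
  rcases Nat.lt_or_ge ((a + b + 2) * q - 2 + 1) k with hlt | hge
  · refine C.ne_bot (i := (a + b + 2) * q - 2 + 1) (by omega) (by omega)
      (C.succ_eq_bot_of_X_Y_eq_zero (by omega) hmem h0 hX ?_)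
    exact C.isCentralizedBy_of_ne _ (by omega) hlt
      (fun j _ _ h => mul_add_ne_mul (q := q) (r := q - 1) (m := j) (by omega) (by omega)
        (a + b + 1) (by omega)) _ hmem
  · rw [show (a + b + 2) * q - 2 = k - 1 by omega] at hmem
    exact C.X_last_ne_zero hmem h0 hX

end IsChainTail

variable [CharP F 2]

theorem IsFrame.Y_X_pow_Y_lie (S : IsFrame ℒ k q x y) {a b r : ℕ} {A B : L} (hr : 1 ≤ r)
    (hab : b + a = r) (hA : A ∈ ℒ a) (hB : B ∈ ℒ b) (hXA : X A = 0) (hXB : X B = 0)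
    (hAY : ∀ l, l + 2 ≤ q → Y ((X ^ l) (Y A)) = 0) (hBY : ∀ l, l + 2 ≤ q → Y ((X ^ l) (Y B)) = 0)
    (h : ℒ r = Submodule.span F {⁅B, A⁆}) (i : ℕ) (hi : i + 2 ≤ q) :
    Y ((X ^ i) (Y ⁅B, A⁆)) = 0 := by
  have hX : X ⁅B, A⁆ = 0 := by rw [derX, hXA, hXB, zero_lie, lie_zero, add_zero]
  suffices H : Y ((X ^ i) (Y ⁅B, A⁆)) = 0 ∧ ⁅(X ^ i) (Y B), Y A⁆ = 0 from H.1
  induction i using Nat.strong_induction_on with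
  | _ i ih =>
    have hsymm : ⁅Y B, (X ^ i) (Y A)⁆ = ⁅(X ^ i) (Y B), Y A⁆ := by
      simpa using derX.lie_pow_pow_eq (fun l hl => (ih l hl (by omega)).2) (le_refl i)
    have hexpand : (X ^ i) (Y ⁅B, A⁆) = ⁅(X ^ i) (Y B), A⁆ + ⁅B, (X ^ i) (Y A)⁆ := by
      rw [derY, map_add, derX.lie_pow_apply_of_apply_eq_zero hXB, lie_comm_of_charTwo F (Y B),
        ← derX.lie_pow_apply_of_apply_eq_zero hXA, lie_comm_of_charTwo F A]
    have hY : Y ((X ^ i) (Y ⁅B, A⁆)) = 0 := by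
      rw [hexpand, map_add, derY, derY, hBY i hi, hAY i hi, zero_lie, lie_zero, zero_add, add_zero,
        hsymm, add_self_eq_zero_of_charTwo F]
    have hcent : IsCentralizedBy ℒ y (r + 1 + i) := isCentralizedBy_of_eq_span
      (S.eq_span_X_pow (i := r + 1) (by omega) i rfl (S.eq_span_Y hr rfl h hX)
        fun l hl => (ih l hl (by omega)).1) hY
    have hlie := derY (F := F) (y := y) ((X ^ i) (Y B)) A
    rw [hcent _ (S.lie_mem (S.X_pow_mem i (S.Y_mem hB rfl) rfl) hA (by omega)), hBY i hi, zero_lie,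
      zero_add] at hlie
    exact ⟨hY, hlie.symm⟩

namespace IsTail

theorem X_X_v (T : IsTail ℒ k q x y e 1 t τ v ρ) : X (X v) = 0 := by
  rw [← T.X_pow_pred_Y_τ, apply_pow]
  exact T.X_pow_eq_zero T.q_eq (by omega) _

theorem lie_X_pow_Y_τ_Y_X_pow_pred_y (T : IsTail ℒ k q x y e 1 t τ v ρ) {l : ℕ} (hl : l + 3 ≤ q) :
    ⁅(X ^ l) (Y τ), Y ((X ^ (q - 1)) y)⁆ = (1 + ρ) • Y ((X ^ (l + 1)) (Y v)) := by
  have h := IsFrame.derY (F := F) (y := y) ((X ^ l) (Y τ)) ((X ^ (q - 1)) y)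
  rw [T.lie_X_pow_pred_y_of_X_pow_eq_v (m := q - 2 - l) (by omega) (Or.inl (by omega))
      (by rw [pow_apply_pow, ← T.X_pow_Y_τ]; congr 2; omega)
      (fun j hj => by rw [pow_apply_pow]; exact T.Y_X_pow_Y_τ (by omega)),
    T.Y_X_pow_Y_τ (by omega), zero_lie, zero_add, map_smul,
    show q - 1 - (q - 2 - l) = l + 1 by omega] at h
  exact h.symm

theorem Y_X_pow_sub_two_Y_v (T : IsTail ℒ k q x y e 1 t τ v ρ) (hbig : ℒ (k + q / 2 + 1) ≠ ⊥) :
    Y ((X ^ (q - 2)) (Y v)) = 0 := by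
  have hq8 := T.eight_le
  have hYw : Y ((X ^ (q - 3)) (Y ((X ^ (q - 1)) y))) = 0 :=
    (T.isLink_start hbig).2 (q + 1 + (q - 3)) (by omega) (by omega) _
      (T.X_pow_mem _ (T.Y_mem T.X_pow_pred_y_mem rfl) rfl)
  have h := IsFrame.derY (F := F) (y := y) τ ((X ^ (q - 3)) (Y ((X ^ (q - 1)) y)))
  rw [hYw, lie_zero, add_zero, IsFrame.derX.lie_pow_apply_of_apply_eq_zero T.X_τ,
    T.isHighOpposite_τ.lie_Y, one_smul, pow_apply_apply, show q - 3 + 1 = q - 2 by omega,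
    IsFrame.derX.lie_pow_eq_single (q - 3), T.lie_X_pow_Y_τ_Y_X_pow_pred_y (by omega),
    Nat.choose_self, Nat.cast_one, one_smul, Nat.sub_self, pow_zero, Module.End.one_apply,
    show q - 3 + 1 = q - 2 by omega, add_smul, one_smul] at h
  · exact (smul_eq_zero.1 (left_eq_add.1 h)).resolve_left T.ρ_ne_zero
  · intro l hl hne
    rw [T.lie_X_pow_Y_τ_Y_X_pow_pred_y (by omega), T.Y_X_pow_Y_v _ (by omega), smul_zero]

theorem add_eq_span_of_lt (T : IsTail ℒ k q x y e 1 t τ v ρ) (hbig : ℒ (k + q / 2 + 1) ≠ ⊥) {a : ℕ}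
    (ha : 1 ≤ a) (haq : a < q) : ℒ (k + a) = Submodule.span F {(X ^ a) (Y v)} := by
  have hq8 := T.eight_le
  rcases Nat.lt_or_ge (a + 1) q with h | h
  · exact T.add_eq_span ha (by omega)
  · obtain rfl : a = q - 2 + 1 := by omega
    rw [← apply_pow]
    exact T.eq_span_X (i := k + (q - 2)) (by omega) rfl (T.add_eq_span (by omega) (by omega))
      (T.Y_X_pow_sub_two_Y_v hbig)

end IsTail

theorem IsTail.exists_isChainTail (T : IsTail ℒ k q x y e 1 t τ v ρ)
    (hbig : ℒ (k + q / 2 + 1) ≠ ⊥) :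
    ∃ τ' v' N, IsChainTail ℒ k q x y e t τ' v' ρ N := by
  obtain ⟨N, hN, hk, hlink, hcent⟩ := T.exists_chain hbig
  have hchain (m : ℕ) (hm : 1 ≤ m) (hmN : m + 2 ≤ N) :
      IsLink ℒ k q x y t v ρ ((m + 1) * q - 1) (chain F q x y m) :=
    hlink (m + 1) (by omega) (by omega)
  have hlast := hchain (N - 2) (by omega) (by omega)
  obtain ⟨a, ha⟩ : ∃ a : F, chain F q x y (N - 2) = a • τ := by
    refine T.exists_eq_smul_τ ?_
    have hNq : (N - 2 + 1) * q + q = N * q := by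
      rw [← Nat.succ_mul, show (N - 2 + 1).succ = N by omega]
    have hkt := T.k_eq
    rw [show t = (N - 2 + 1) * q - 1 by omega]
    exact hlast.mem
  have ha0 : a ≠ 0 := by
    rintro rfl
    exact hlast.Y_ne_zero (by rw [ha, zero_smul, map_zero])
  exact ⟨a • τ, a • v, N, {
    toIsTail := T.smul ha0
    three_le := hN
    add_one_eq := hk
    chain_mem := fun m hm hmN => (hchain m hm hmN).mem
    X_chain := fun m hm hmN => (hchain m hm hmN).X_eq_zero
    Y_chain_ne_zero := fun m hm hmN => (hchain m hm hmN).Y_ne_zero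
    chain_eq_τ := ha
    isCentralizedBy_of_ne := hcent }⟩

namespace IsTail

theorem X_chainBeyond (T : IsTail ℒ k q x y e 1 t τ v ρ) (j : ℕ) :
    X (chainBeyond F q x y v j) = 0 := by
  induction j with
  | zero =>
    rw [chainBeyond_zero, apply_pow]
    exact T.X_pow_eq_zero T.q_eq (by omega) _
  | succ j ih =>
    rw [← W_chainBeyond, LieAlgebra.ad_apply F L (_ : L) (chainBeyond F q x y v j), IsFrame.derX,
      ih, T.X_X_pow_pred_y, zero_lie, lie_zero, add_zero]

theorem chainBeyond_succ (T : IsTail ℒ k q x y e 1 t τ v ρ) (j : ℕ) :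
    chainBeyond F q x y v (j + 1) = (X ^ (q - 1)) (Y (chainBeyond F q x y v j)) := by
  rw [← W_chainBeyond, LieAlgebra.ad_apply, lie_comm_of_charTwo F]
  exact lie_X_pow_pred_y T.q_eq (i := 0) (by have := T.eight_le; omega) rfl (T.X_chainBeyond j)
    fun l hl => absurd hl l.not_lt_zero

theorem W_v (T : IsTail ℒ k q x y e 1 t τ v ρ) :
    W v = (1 + ρ) • chainBeyond F q x y v 0 := by
  have hq8 := T.eight_le
  rw [LieAlgebra.ad_apply, lie_comm_of_charTwo F, T.lie_X_pow_pred_y_of_X_pow_eq_v (m := 0)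
    (by omega) (Or.inr T.X_X_v) rfl (fun l hl => absurd hl l.not_lt_zero), chainBeyond_zero,
    Nat.sub_zero]

theorem W_X_v (T : IsTail ℒ k q x y e 1 t τ v ρ) : W (X v) = 0 := by
  have h := IsFrame.derX (F := F) (x := x) v ((X ^ (q - 1)) y)
  rw [T.X_X_pow_pred_y, lie_zero, add_zero, lie_comm_of_charTwo F, ← LieAlgebra.ad_apply F L, T.W_v,
    map_smul, T.X_chainBeyond, smul_zero, lie_comm_of_charTwo F] at h
  exact h.symm

end IsTail

namespace IsChainTail

theorem chain_pred (C : IsChainTail ℒ k q x y e t τ v ρ N) : chain F q x y (N - 1) = X v := by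
  have hN := C.three_le
  rw [show N - 1 = N - 2 + 1 by omega, C.chain_succ (by rw [C.chain_eq_τ, C.X_τ]), C.chain_eq_τ,
    C.X_pow_pred_Y_τ]

theorem lie_chain_pred (C : IsChainTail ℒ k q x y e t τ v ρ N) (j : ℕ) :
    ⁅chain F q x y (N - 1), chain F q x y j⁆ = ρ • chainBeyond F q x y v j := by
  have hq8 := C.eight_le
  rw [C.chain_pred]
  induction j with
  | zero =>
    rw [chain, pow_zero, Module.End.one_apply,
      IsFrame.derX.lie_pow_apply_of_apply_eq_zero C.X_X_v, IsFrame.lie_y F, C.Y_X_v, map_smul,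
      pow_apply_apply, chainBeyond_zero, show q - 2 + 1 = q - 1 by omega]
  | succ j ih =>
    have h := isDerivation_ad (R := F) ((X ^ (q - 1)) y) (X v) (chain F q x y j)
    rw [C.W_X_v, zero_lie, zero_add, ih, map_smul, W_chainBeyond, W_chain] at h
    exact h.symm

theorem lie_chain_one (C : IsChainTail ℒ k q x y e t τ v ρ N) :
    ⁅chain F q x y (N - 2), chain F q x y 1⁆ = chainBeyond F q x y v 0 := by
  have hN := C.three_le
  have hv : ⁅chain F q x y (N - 2), chain F q x y 0⁆ = v := by
    rw [C.chain_eq_τ, chain, pow_zero, Module.End.one_apply,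
      IsFrame.derX.lie_pow_apply_of_apply_eq_zero C.X_τ, IsFrame.lie_y F, C.X_pow_Y_τ]
  have h := isDerivation_ad (R := F) ((X ^ (q - 1)) y) (chain F q x y (N - 2)) (chain F q x y 0)
  rw [hv, C.W_v, W_chain, W_chain, show N - 2 + 1 = N - 1 by omega, C.lie_chain_pred, add_smul,
    one_smul, add_comm] at h
  exact (add_left_cancel h).symm

variable {f Q : ℕ}

theorem exists_lie_chain_eq_smul (C : IsChainTail ℒ k q x y e t τ v ρ N) (hQ : Q = 2 ^ f)
    (hQN : Q * 3 ≤ N) {j : ℕ} (hj : j + 1 < Q) :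
    ∃ θ : F, θ ≠ 0 ∧
      ⁅chain F q x y (N - Q - 1), chain F q x y (Q + j)⁆ = θ • chainBeyond F q x y v j := by
  have hW := isDerivation_ad (R := F) ((X ^ (q - 1)) y)
  rcases Nat.eq_zero_or_pos j with rfl | hj0
  · refine ⟨1, one_ne_zero, ?_⟩
    have h := hW.lie_pow_pow_eq (u := chain F q x y 1) (a := chain F q x y 1) (n := N - 3)
      (j := Q - 1) (fun i hi => by
        rw [W_pow_chain]
        exact C.lie_chain_chain_eq_zero (by omega) le_rfl (by omega)) (by omega)
    rwa [W_pow_chain, W_pow_chain, W_pow_chain, show N - 3 - (Q - 1) + 1 = N - Q - 1 by omega,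
      show Q - 1 + 1 = Q + 0 by omega, show N - 3 + 1 = N - 2 by omega, C.lie_chain_one,
      ← one_smul F (chainBeyond F q x y v 0)] at h
  · refine ⟨ρ, C.ρ_ne_zero, ?_⟩
    have h := hW.pow_char_pow 2 f (chain F q x y (N - Q - 1)) (chain F q x y j)
    rw [C.lie_chain_chain_eq_zero (by omega) hj0 (by omega), map_zero, ← hQ, W_pow_chain,
      W_pow_chain, show Q + (N - Q - 1) = N - 1 by omega, C.lie_chain_pred] at h
    exact (eq_of_add_eq_zero_of_charTwo F h.symm).symm

theorem Y_X_pow_Y_chainBeyond (C : IsChainTail ℒ k q x y e t τ v ρ N) (hQ : Q = 2 ^ f)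
    (hQN : Q * 3 ≤ N) {j : ℕ} (hj : j + 1 < Q)
    (h : ℒ (k + j * q + (q - 1)) = Submodule.span F {chainBeyond F q x y v j}) {i : ℕ}
    (hi : i + 2 ≤ q) : Y ((X ^ i) (Y (chainBeyond F q x y v j))) = 0 := by
  have hk := C.add_one_eq
  have hq8 := C.eight_le
  obtain ⟨θ, hθ, hlie⟩ := C.exists_lie_chain_eq_smul hQ hQN hj
  have hdeg : (N - Q - 1 + 1) * q - 1 + ((Q + j + 1) * q - 1) = k + j * q + (q - 1) := by
    have hQj := Nat.mul_le_mul_right q (show 1 ≤ Q + j + 1 by omega)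
    have hNQ := Nat.mul_le_mul_right q (show 1 ≤ N - Q - 1 + 1 by omega)
    have hadd : (N - Q - 1 + 1) * q + (Q + j + 1) * q = N * q + j * q + q := by
      rw [← add_mul, ← add_mul, ← Nat.succ_mul]
      congr 1
      omega
    omega
  have hY := C.Y_X_pow_Y_lie (by omega) hdeg (C.chain_mem (Q + j) (by omega) (by omega))
    (C.chain_mem (N - Q - 1) (by omega) (by omega)) (C.X_chain (Q + j) (by omega) (by omega))
    (C.X_chain (N - Q - 1) (by omega) (by omega))
    (fun l hl => C.Y_X_pow_Y_chain (by omega) (by omega) hl)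
    (fun l hl => C.Y_X_pow_Y_chain (by omega) (by omega) hl)
    (by rw [h, hlie, Submodule.span_singleton_smul_eq (IsUnit.mk0 θ hθ)]) i hi
  rw [hlie, map_smul, map_smul, map_smul] at hY
  exact (smul_eq_zero.1 hY).resolve_left hθ

theorem eq_span_chainBeyond (C : IsChainTail ℒ k q x y e t τ v ρ N)
    (hbig : ℒ (k + q / 2 + 1) ≠ ⊥) (hQ : Q = 2 ^ f) (hQN : Q * 3 ≤ N) {j : ℕ} (hj : j < Q) :
    ℒ (k + j * q + (q - 1)) = Submodule.span F {chainBeyond F q x y v j} ∧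
      ∀ i, k < i → i ≤ k + j * q + (q - 1) → ∃ u, ℒ i = Submodule.span F {u} := by
  have hq8 := C.eight_le
  have hqk := C.add_two_le
  induction j with
  | zero =>
    rw [zero_mul, add_zero]
    refine ⟨C.add_eq_span_of_lt hbig (by omega) (by omega), fun i hki hi => ?_⟩
    obtain ⟨a, rfl⟩ := Nat.exists_eq_add_of_lt hki
    exact ⟨_, C.add_eq_span_of_lt hbig (a := a + 1) (by omega) (by omega)⟩
  | succ j ih =>
    obtain ⟨hspan, hlow⟩ := ih (by omega)
    have hsucc : (j + 1) * q = j * q + q := by ring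
    have hhigh (i : ℕ) (hi : i < q) : ℒ (k + j * q + q + i) =
        Submodule.span F {(X ^ i) (Y (chainBeyond F q x y v j))} :=
      C.eq_span_X_pow (by omega) i rfl
        (C.eq_span_Y (by omega) (by omega) hspan (C.X_chainBeyond j))
        fun l hl => C.Y_X_pow_Y_chainBeyond hQ hQN hj hspan (by omega)
    refine ⟨?_, fun i hki hi => ?_⟩
    · rw [C.chainBeyond_succ, ← hhigh _ (by omega), hsucc, ← add_assoc k]
    · rcases Nat.lt_or_ge i (k + j * q + q) with hlt | hge
      · exact hlow i hki (by omega)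
      · obtain ⟨a, rfl⟩ := Nat.exists_eq_add_of_le hge
        exact ⟨_, hhigh a (by omega)⟩

theorem chainBeyond_pred_eq_zero (C : IsChainTail ℒ k q x y e t τ v ρ N) (hQ : Q = 2 ^ f) {r : ℕ}
    (hr : 0 < r) (hN : N = Q * (2 * r + 1)) : chainBeyond F q x y v (Q - 1) = 0 := by
  have hW := isDerivation_ad (R := F) ((X ^ (q - 1)) y)
  have hQ0 : 0 < Q := hQ ▸ Nat.two_pow_pos f
  rcases Nat.eq_or_lt_of_le (Nat.succ_le_of_lt hQ0) with hQ1 | hQ1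
  · obtain rfl : Q = 1 := hQ1.symm
    have h := hW.lie_pow_two_mul_self_eq_zero (c := chain F q x y 1) (n := r - 1) fun i hi => by
      rw [W_pow_chain]
      exact C.lie_chain_chain_eq_zero (by omega) le_rfl (by omega)
    rwa [W_pow_chain, show 2 * (r - 1) + 1 = N - 2 by omega, C.lie_chain_one] at h
  · have hpow (i : ℕ) :
        ((W ^ Q) ^ i) (chain F q x y (Q - 1)) = chain F q x y (Q * i + (Q - 1)) := by
      rw [← pow_mul, W_pow_chain]
    have h := (hW.pow_char_pow 2 f).lie_pow_two_mul_self_eq_zero (c := chain F q x y (Q - 1))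
      (n := r) fun i hi => by
        rw [← hQ, hpow]
        have hle : Q * (i + 2) ≤ Q * (2 * r + 1) := Nat.mul_le_mul_left Q (by omega)
        rw [← hN, mul_add] at hle
        exact C.lie_chain_chain_eq_zero (by omega) (by omega) (by omega)
    rw [mul_add, mul_one] at hN
    rw [← hQ, hpow, show Q * (2 * r) + (Q - 1) = N - 1 by omega, C.lie_chain_pred] at h
    exact (smul_eq_zero.1 h).resolve_left C.ρ_ne_zero

theorem exists_eq_two_pow (C : IsChainTail ℒ k q x y e t τ v ρ N)
    (hdim : ((4 * k + 1 : ℕ) : Cardinal) < 3 * Module.rank F L)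
    (hbig : ℒ (k + q / 2 + 1) ≠ ⊥) : ∃ s, N = 2 ^ s := by
  have hq8 := C.eight_le
  have hk := C.add_one_eq
  have hN3 := C.three_le
  obtain ⟨f, o, ⟨r, rfl⟩, hN⟩ := Nat.exists_eq_two_pow_mul_odd (n := N) (by omega)
  rcases Nat.eq_zero_or_pos r with rfl | hr
  · exact ⟨f, by rw [hN, mul_zero, zero_add, mul_one]⟩
  obtain ⟨Q, hQ⟩ : ∃ Q, Q = 2 ^ f := ⟨_, rfl⟩
  rw [← hQ] at hN
  have hQ0 : 0 < Q := hQ ▸ Nat.two_pow_pos f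
  have hQN : Q * 3 ≤ N := hN ▸ Nat.mul_le_mul_left Q (by omega)
  obtain ⟨hspan, hlow⟩ := C.eq_span_chainBeyond hbig hQ hQN (Nat.sub_lt hQ0 one_pos)
  refine absurd (C.chainBeyond_pred_eq_zero hQ hr hN) (ne_zero_of_eq_span hspan ?_)
  have hpred : (Q - 1) * q + q = Q * q := by
    rw [← Nat.succ_mul, Nat.succ_eq_add_one, Nat.sub_add_cancel hQ0]
  have hQNq : Q * q * 3 ≤ N * q := by
    rw [mul_right_comm]
    exact Nat.mul_le_mul_right q hQN
  have h := C.thin.succ_ne_bot C.diamond hdim (M := k + (Q - 1) * q + (q - 2)) (by omega)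
    (fun i hki hi => hlow i hki (by omega)) (by omega)
  rwa [add_assoc, show q - 2 + 1 = q - 1 by omega] at h

end IsChainTail

end PowerOfTwo

section Nottingham

namespace IsFrame

theorem isCentralizedBy_of_mem (S : IsFrame ℒ k q x y) {i : ℕ} (hi : 2 ≤ i) (hik : i < k)
    {A z : L} (hA : A ∈ ℒ i) (hA0 : A ≠ 0) (hz : LieAlgebra.ad F L z A = 0) :
    IsCentralizedBy ℒ z i := by
  intro u hu
  obtain ⟨a, rfl⟩ := S.exists_eq_smul hi hik hA hA0 hu
  rw [map_smul, hz, smul_zero]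

theorem succ_lt_of_eq_or_succ_eq_mul (S : IsFrame ℒ k q x y) {r h : ℕ} (hk : k + 1 = r * q)
    (hh : h = q ∨ ∃ m, 1 < m ∧ m < r ∧ h + 1 = m * q) : h + 1 < k := by
  have hq := S.two_lt
  have hqk := S.add_two_le
  obtain rfl | ⟨m, -, hmr, hm⟩ := hh
  · omega
  · have := Nat.mul_le_mul_right q hmr
    rw [Nat.succ_mul] at this
    omega

variable [CharP F 2]

theorem lie_eq_zero_of_add_le (S : IsFrame ℒ k q x y) {i j : ℕ} (hi : 2 ≤ i) (hj : 2 ≤ j)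
    (hij : i + j ≤ q) {u w : L} (hu : u ∈ ℒ i) (hw : w ∈ ℒ j) : ⁅u, w⁆ = 0 := by
  have hqk := S.add_two_le
  obtain ⟨m, rfl⟩ : ∃ m, i = m + 1 := ⟨i - 1, by omega⟩
  obtain ⟨n, rfl⟩ : ∃ n, j = n + 1 := ⟨j - 1, by omega⟩
  obtain ⟨a, rfl⟩ :=
    S.exists_eq_smul hi (by omega) (S.X_pow_y_mem rfl) (S.X_pow_y_ne_zero (by omega)) hu
  obtain ⟨b, rfl⟩ :=
    S.exists_eq_smul hj (by omega) (S.X_pow_y_mem rfl) (S.X_pow_y_ne_zero (by omega)) hw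
  rw [smul_lie, lie_smul, derX.lie_pow_eq_zero fun l hl => ?_, smul_zero, smul_zero]
  rw [lie_y F, pow_apply_pow]
  exact S.Y_X_pow_y (by omega)

theorem isMetabelian (S : IsFrame ℒ k q x y) : IsMetabelian F (L ⧸ liePower F L (q + 1)) := by
  rw [isMetabelian_quotient_iff]
  intro a ha b hb
  rw [← LieSubmodule.mem_toSubmodule, S.thin.toSubmodule_liePower] at ha hb ⊢
  refine lie_mem_of_mem_degreeGE (fun i j hi hj u hu w hw => ?_) ha hb
  rcases Nat.lt_or_ge q (i + j) with h | h
  · exact le_degreeGE h (S.lie_mem hu hw rfl)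
  · rw [S.lie_eq_zero_of_add_le hi hj h hu hw]
    exact zero_mem _

theorem lie_X_pow_y_X_y (S : IsFrame ℒ k q x y) :
    ⁅(X ^ (q - 2)) y, X y⁆ = Y ((X ^ (q - 1)) y) := by
  have hq := S.two_lt
  have h := derX (F := F) (x := x) ((X ^ (q - 2)) y) y
  rw [lie_y F, lie_y F, S.Y_X_pow_y (by omega), map_zero, apply_pow,
    show q - 2 + 1 = q - 1 by omega] at h
  exact (eq_of_add_eq_zero_of_charTwo F h.symm).symm

theorem not_isMetabelian (S : IsFrame ℒ k q x y) :
    ¬ IsMetabelian F (L ⧸ liePower F L (q + 2)) := by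
  have hq := S.two_lt
  rw [isMetabelian_quotient_iff]
  intro h
  have hmem (i : ℕ) (hi : 2 ≤ i) (u : L) (hu : u ∈ ℒ i) : u ∈ liePower F L 2 := by
    rw [← LieSubmodule.mem_toSubmodule, S.thin.toSubmodule_liePower]
    exact le_degreeGE hi hu
  have hlie := h _ (hmem (q - 1) (by omega) _ (S.X_pow_y_mem (n := q - 2) (by omega))) _
    (hmem 2 le_rfl _ (S.X_mem S.y_mem rfl))
  rw [S.lie_X_pow_y_X_y, ← LieSubmodule.mem_toSubmodule, S.thin.toSubmodule_liePower] at hlie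
  exact S.Y_X_pow_pred_y_ne_zero (Submodule.disjoint_def.1
    (S.thin.graded.disjoint_degreeGE (Nat.lt_succ_self (q + 1))) _
    (S.Y_mem S.X_pow_pred_y_mem rfl) hlie)

theorem isNottinghamWithFakeSecondDiamond (S : IsFrame ℒ k q x y) :
    IsNottinghamWithFakeSecondDiamond ℒ q where
  charTwo := inferInstance
  thin := S.thin
  metabelian := S.isMetabelian
  maximalClass := by
    have := S.add_two_le
    exact S.thin.isMaximalClass_quotient S.diamond (n := q + 1) (by omega) (by omega)
  not_metabelian := S.not_isMetabelian

theorem three_le_exponent (S : IsFrame ℒ k q x y)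
    (hmet : IsMetabelian F (L ⧸ liePower F L 6)) {e : ℕ} (hq : q = 2 ^ e) : 3 ≤ e := by
  have h2q := S.two_lt
  by_contra he
  have hq4 : q = 4 := by interval_cases e <;> omega
  have h := S.not_isMetabelian
  rw [hq4] at h
  exact h hmet

theorem isFakeDiamondOfTypeOne_iff (S : IsFrame ℒ k q x y) {e : ℕ} (he : 3 ≤ e)
    (hq : q = 2 ^ e) {h : ℕ} (h1 : 1 < h) (hk : h < k) : IsFakeDiamondOfTypeOne ℒ x y h ↔
      h + 1 < k ∧ IsCentralizedBy ℒ x h ∧ ¬ IsCentralizedBy ℒ y h := by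
  constructor
  · rintro ⟨⟨hne, w, hw0, hw, hXX, hYY, hXY⟩, -⟩
    have hwm : w ∈ ℒ (h - 1) := mem_of_eq_span hw
    rw [sub_self, zero_smul, one_smul] at hXY
    simp only [lie_y F] at hXX hYY hXY
    have hYw : Y w = 0 := by
      by_contra h0
      exact hne (S.succ_eq_bot_of_X_Y_eq_zero (by omega) (S.Y_mem hwm (by omega)) h0 hXY.symm hYY)
    have hXw : X w ≠ 0 := S.X_ne_zero (by omega) hwm hw0 hYw (S.ne_bot (by omega) (by omega))
    have hXm : X w ∈ ℒ h := S.X_mem hwm (by omega)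
    refine ⟨?_, S.isCentralizedBy_of_mem h1 hk hXm hXw hXX, fun hY =>
      hne (S.succ_eq_bot_of_X_Y_eq_zero (by omega) hXm hXw hXX (hY _ hXm))⟩
    by_contra hlast
    rw [show h = k - 1 by omega] at hXm
    exact S.X_last_ne_zero hXm hXw hXX
  · rintro ⟨hk1, hx, hy⟩
    have hqh : q ≤ h := by
      by_contra hlt
      exact hy (S.isCentralizedBy_of_lt h1 (by omega))
    have hq8 := eight_le_of_eq_two_pow he hq
    obtain ⟨w, hw, hw0⟩ := S.exists_ne_zero (i := h - 1) (by omega) (by omega)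
    have hYw : ⁅w, y⁆ = 0 := (lie_y F w).trans
      (S.isCentralizedBy_of_lt_add_half he hq hqh hk hy (by omega) (by omega) w hw)
    refine ⟨⟨S.ne_bot (by omega) (by omega), w, hw0, ?_, ?_, ?_, ?_⟩,
      S.thin.finrank_eq_one S.diamond h1 hk⟩
    · refine le_antisymm (fun u hu => ?_) ((Submodule.span_singleton_le_iff_mem _ _).2 hw)
      obtain ⟨a, rfl⟩ := S.exists_eq_smul (by omega) (by omega) hw hw0 hu
      exact Submodule.smul_mem _ _ (Submodule.mem_span_singleton_self w)
    · rw [lie_comm_of_charTwo F w, lie_comm_of_charTwo F _ x]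
      exact hx _ (S.X_mem hw (by omega))
    · rw [hYw, zero_lie]
    · rw [sub_self, zero_smul, one_smul, hYw, zero_lie]

end IsFrame

variable {d e t N : ℕ} {τ v : L} {ρ : F}

theorem IsChainTail.isCentralizedBy_of_succ_eq_mul (C : IsChainTail ℒ k q x y e t τ v ρ N)
    {i m : ℕ} (hm : 1 < m) (hmN : m < N) (hi : i + 1 = m * q) :
    IsCentralizedBy ℒ x i ∧ ¬ IsCentralizedBy ℒ y i := by
  have hq8 := C.eight_le
  have hk := C.add_one_eq
  have h2m := Nat.mul_le_mul_right q hm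
  have hmN' := Nat.mul_le_mul_right q hmN
  rw [Nat.succ_mul] at h2m hmN'
  obtain ⟨n, rfl⟩ : ∃ n, m = n + 1 := ⟨m - 1, by omega⟩
  have hmem : chain F q x y n ∈ ℒ i := by
    rw [show i = (n + 1) * q - 1 by omega]
    exact C.chain_mem n (by omega) (by omega)
  have hY : Y (chain F q x y n) ≠ 0 := C.Y_chain_ne_zero n (by omega) (by omega)
  exact ⟨C.isCentralizedBy_of_mem (by omega) (by omega) hmem (fun h => hY (by rw [h, map_zero]))
    (C.X_chain n (by omega) (by omega)), fun h => hY (h _ hmem)⟩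

variable [CharP F 2]

theorem IsTail.add_half_ne_bot (T : IsTail ℒ k q x y e d t τ v ρ)
    (hdim : ((4 * k + 1 : ℕ) : Cardinal) < 3 * Module.rank F L) (hqt : q < t) :
    ℒ (k + q / 2 + 1) ≠ ⊥ := by
  have hq8 := T.eight_le
  have htk := T.t_add_eq
  have hhalf : q + q / 2 ≤ t := by
    by_contra h
    exact T.not_isCentralizedBy (T.isCentralizedBy_of_lt_add_half T.three_le_exponent T.q_eq T.q_le
      (by have := T.t_lt; omega) T.not_isCentralizedBy_t hqt (by omega))
  refine T.thin.succ_ne_bot T.diamond hdim (by omega) (fun i hki hi => ?_)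
    (by rcases T.d_eq with h | h <;> omega)
  obtain ⟨a, rfl⟩ := Nat.exists_eq_add_of_lt hki
  exact ⟨_, T.add_eq_span (a := a + 1) (by omega) (by omega)⟩

namespace IsFrame

theorem exists_succ_eq_two_mul_two_pow_mul (S : IsFrame ℒ k q x y)
    (hdim : ((4 * k + 1 : ℕ) : Cardinal) < 3 * Module.rank F L) {e : ℕ} (he : 3 ≤ e)
    (hq : q = 2 ^ e) :
    ∃ s, k + 1 = 2 * 2 ^ s * q ∧
      (∀ i m, 1 < m → m < 2 * 2 ^ s → i + 1 = m * q →
        IsCentralizedBy ℒ x i ∧ ¬ IsCentralizedBy ℒ y i) ∧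
      ∀ i, q < i → i + 1 < k → (∀ m, 1 < m → m < 2 * 2 ^ s → i + 1 ≠ m * q) →
        IsCentralizedBy ℒ y i := by
  have hk1 : ℒ (k + 1) ≠ ⊥ :=
    S.thin.succ_ne_bot S.diamond hdim le_rfl (fun i hki hi => absurd hi (by omega))
      (by have := S.add_two_le; have := eight_le_of_eq_two_pow he hq; omega)
  obtain ⟨d, t, τ, v, ρ, T⟩ := S.exists_isTail he hq hk1
  have htk := T.t_add_eq
  obtain rfl | rfl := T.d_eq
  · have hbig := T.add_half_ne_bot hdim T.lt_t
    obtain ⟨τ', v', N, C⟩ := T.exists_isChainTail hbig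
    obtain ⟨s, hs⟩ := C.exists_eq_two_pow hdim hbig
    have hN3 := C.three_le
    obtain ⟨r, rfl⟩ : ∃ r, s = r + 1 :=
      Nat.exists_eq_succ_of_ne_zero (by rintro rfl; omega)
    obtain rfl : N = 2 * 2 ^ r := hs.trans (pow_succ' 2 r)
    exact ⟨r, C.add_one_eq, fun i m => C.isCentralizedBy_of_succ_eq_mul, C.isCentralizedBy_of_ne⟩
  · obtain rfl : t = q := by
      by_contra htq
      exact htq (T.eq_of_two (T.add_half_ne_bot hdim (lt_of_le_of_ne T.q_le (Ne.symm htq))))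
    exact ⟨0, by omega, fun i m hm hm2 => absurd hm2 (by omega),
      fun i hi hik _ => T.isCentralizedBy_of_gt i hi hik⟩

theorem exists_isCentralizedBy_iff (S : IsFrame ℒ k q x y)
    (hdim : ((4 * k + 1 : ℕ) : Cardinal) < 3 * Module.rank F L) {e : ℕ} (he : 3 ≤ e)
    (hq : q = 2 ^ e) :
    ∃ s, k + 1 = 2 * 2 ^ s * q ∧ ∀ i, 1 < i → i + 1 < k →
      (IsCentralizedBy ℒ x i ∨ IsCentralizedBy ℒ y i) ∧
      (¬ IsCentralizedBy ℒ y i ↔ i = q ∨ ∃ m, 1 < m ∧ m < 2 * 2 ^ s ∧ i + 1 = m * q) := by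
  obtain ⟨s, hk, hmul, hne⟩ := S.exists_succ_eq_two_mul_two_pow_mul hdim he hq
  refine ⟨s, hk, fun i hi hik => ?_⟩
  by_cases hm : ∃ m, 1 < m ∧ m < 2 * 2 ^ s ∧ i + 1 = m * q
  · obtain ⟨m, hm1, hms, him⟩ := id hm
    have h := hmul i m hm1 hms him
    exact ⟨Or.inl h.1, iff_of_true h.2 (Or.inr hm)⟩
  · rcases Nat.lt_trichotomy i q with h | rfl | h
    · have hy := S.isCentralizedBy_of_lt hi h
      exact ⟨Or.inr hy, iff_of_false (not_not.2 hy) (not_or.2 ⟨h.ne, hm⟩)⟩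
    · exact ⟨Or.inl S.X_eq_zero_of_mem, iff_of_true S.not_isCentralizedBy (Or.inl rfl)⟩
    · have hy := hne i h hik fun m hm1 hms him => hm ⟨m, hm1, hms, him⟩
      exact ⟨Or.inr hy, iff_of_false (not_not.2 hy) (not_or.2 ⟨h.ne', hm⟩)⟩

end IsFrame

end Nottingham

end ThinAlgebra

end ThinLie

theorem theorem3p1 {F : Type*} {L : Type*} [Field F] [CharP F 2] [LieRing L] [LieAlgebra F L]
    (ℒ : ℕ → Submodule F L) (hthin : ThinLie.IsThin ℒ)
    (k : ℕ) (hk : ThinLie.IsSecondDiamond ℒ k)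
    (hdim : ((4 * k + 1 : ℕ) : Cardinal) < 3 * Module.rank F L)
    (hnonmet : ¬ ThinLie.IsMetabelian F (L ⧸ ThinLie.liePower F L k))
    (hmet : ThinLie.IsMetabelian F (L ⧸ ThinLie.liePower F L 6))
    (qb : ℕ) (x y : L) (hxy : ThinLie.IsFirstTwoCentralizers ℒ qb x y) :
    (∃ e : ℕ, qb = 2 ^ e) ∧
    ThinLie.IsNottinghamWithFakeSecondDiamond ℒ qb ∧
    (∀ i : ℕ, 1 < i → i + 1 < k →
      (∀ u ∈ ℒ i, ⁅u, x⁆ = 0) ∨ (∀ u ∈ ℒ i, ⁅u, y⁆ = 0)) ∧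
    ∃ r : ℕ, (∃ s : ℕ, r = 2 ^ s) ∧ k + 1 = 2 * r * qb ∧
      ∀ h : ℕ, 1 < h → h < k →
        (ThinLie.IsFakeDiamondOfTypeOne ℒ x y h ↔
          h = qb ∨ ∃ m : ℕ, 1 < m ∧ m < 2 * r ∧ h + 1 = m * qb) := by
  have S : ThinLie.IsFrame ℒ k qb x y := ⟨hthin, hk, hxy⟩
  obtain ⟨e, hq⟩ := S.exists_eq_two_pow
  have he : 3 ≤ e := S.three_le_exponent hmet hq
  obtain ⟨s, hks, hcent⟩ := S.exists_isCentralizedBy_iff hdim he hq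
  refine ⟨⟨e, hq⟩, S.isNottinghamWithFakeSecondDiamond, fun i hi hik => ?_,
    2 ^ s, ⟨s, rfl⟩, hks, fun h hh hhk => ?_⟩
  · simpa only [ThinLie.IsCentralizedBy, LieAlgebra.ad_apply, ThinLie.lie_comm_of_charTwo F _ x,
      ThinLie.lie_comm_of_charTwo F _ y] using (hcent i hi hik).1
  · rw [S.isFakeDiamondOfTypeOne_iff he hq hh hhk]
    constructor
    · rintro ⟨hhk', -, hy⟩
      exact (hcent h hh hhk').2.1 hy
    · intro hdeg
      have hhk' : h + 1 < k := S.succ_lt_of_eq_or_succ_eq_mul hks hdeg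
      have hy := (hcent h hh hhk').2.2 hdeg
      exact ⟨hhk', (hcent h hh hhk').1.resolve_right hy, hy⟩
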